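/- A subset of $\mathbb{R}^n$ is semialgebraic if it is a finite Boolean combination of sets $\{p>0\}$ with $p$ a real polynomial. For a closed set $X\subset\mathbb{R}^2$ and $x\in\mathbb{R}^2$ let $m(x)=\{y\in X : \|y-x\|=d(x,X)\}$ be the set of points of $X$ closest to $x$, and let $M_X=\{x\in\mathbb{R}^2\setminus X : \# m(x)>1\}$ be the medial axis of $X$. For $a\in A\subset\mathbb{R}^2$ the Peano tangent cone $C_a(A)$ is the set of all limits $\lim_\nu t_\nu(x_\nu-a)$ with $t_\nu>0$, $x_\nu\in A$, $x_\nu\to a$. Curves are continuous, and their germs at $0$ and the tangent cones at $0$ of these germs are those of their images for small parameter values; when $C_0(\delta)$ is a half-line, it is called the tangent half-line of $\delta$ at $0$. The dimension of a semialgebraic set is the largest dimension of a nonempty semialgebraic $\mathcal{C}^1$ submanifold contained in it. Let $X\subset\mathbb{R}^2$ be a closed semialgebraic set of dimension one. Let $\delta_1,\delta_2:[0,\varepsilon)\to\mathbb{R}^2$, $\varepsilon>0$, be semialgebraic curves (i.e. continuous with semialgebraic graph) with $\delta_1(0)=\delta_2(0)=0$ whose germs at $0$ are distinct, which have the same tangent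 half-line $l=C_0(\delta_1)=C_0(\delta_2)$ at $0$, and which are contained in $\overline{M_X}$. Then there is a branch of $X$ at $0$, that is, for some $0<\eta\le\varepsilon$ an injective semialgebraic curve $\gamma:[0,\eta)\to X$ with $\gamma(0)=0$ (so, in particular, $0\in X$), such that: 1. $\gamma$ lies between $\delta_1$ and $\delta_2$: there are linear coordinates $(x,y)$ in $\mathbb{R}^2$ in which $l$ is the nonnegative $x$-axis, the germs at $0$ of $\delta_1,\delta_2,\gamma$ are the germs of graphs $y=f_1(x)$, $y=f_2(x)$, $y=g(x)$ over $x\ge 0$, and either $f_1(x)<g(x)<f_2(x)$ for all sufficiently small $x>0$, or $f_2(x)<g(x)<f_1(x)$ for all sufficiently small $x>0$; 2. there is $i_0\in\{1,2\}$ such that $\gamma(t)\in m(\delta_{i_0}(t))$ for all $t\in[0,\eta)$; 3. $C_0(\gamma)=l$, i.e. $\gamma$ is tangent to $l$ too. -/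

import Mathlib

open Set Filter Topology

/-- Semialgebraic subsets of `ℝⁿ`: the smallest Boolean algebra of sets that contains all the sets
`{x | 0 < p x}`, `p` a real polynomial in `n` variables. -/
inductive IsSemialgebraic {n : ℕ} : Set (EuclideanSpace ℝ (Fin n)) → Prop
  | pos (p : MvPolynomial (Fin n) ℝ) :
      IsSemialgebraic {x | 0 < MvPolynomial.eval (fun i => x i) p}
  | compl {S : Set (EuclideanSpace ℝ (Fin n))} : IsSemialgebraic S → IsSemialgebraic Sᶜ
  | union {S T : Set (EuclideanSpace ℝ (Fin n))} :
      IsSemialgebraic S → IsSemialgebraic T → IsSemialgebraic (S ∪ T)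

/-- `Γ` is an (embedded) `d`-dimensional submanifold of class `C¹` of `ℝⁿ`: near each of its points
a `C¹` diffeomorphism between open sets of `ℝⁿ` straightens it to the coordinate subspace spanned
by the first `d` vectors of the standard basis. -/
def IsC1Submanifold {n : ℕ} (Γ : Set (EuclideanSpace ℝ (Fin n))) (d : ℕ) : Prop :=
  d ≤ n ∧ ∀ a ∈ Γ, ∃ Φ : OpenPartialHomeomorph (EuclideanSpace ℝ (Fin n)) (EuclideanSpace ℝ (Fin n)),
    a ∈ Φ.source ∧ ContDiffOn ℝ 1 Φ Φ.source ∧ ContDiffOn ℝ 1 Φ.symm Φ.target ∧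
    ∀ x ∈ Φ.source, (x ∈ Γ ↔ ∀ i : Fin n, d ≤ (i : ℕ) → Φ x i = 0)

/-- `dim X = d`: the number `d` is the largest dimension of a nonempty semialgebraic `C¹`
submanifold contained in `X`. -/
def HasSemialgebraicDim {n : ℕ} (X : Set (EuclideanSpace ℝ (Fin n))) (d : ℕ) : Prop :=
  IsGreatest {k : ℕ | ∃ Γ : Set (EuclideanSpace ℝ (Fin n)),
    Γ ⊆ X ∧ Γ.Nonempty ∧ IsSemialgebraic Γ ∧ IsC1Submanifold Γ k} d

/-- The set `m(x)` of the points of `X` closest to `x`. -/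
def closestPoints {n : ℕ} (X : Set (EuclideanSpace ℝ (Fin n))) (x : EuclideanSpace ℝ (Fin n)) :
    Set (EuclideanSpace ℝ (Fin n)) :=
  {y | y ∈ X ∧ ‖y - x‖ = Metric.infDist x X}

/-- The medial axis `M_X`: the points off `X` with more than one closest point in `X`. -/
def medialAxis {n : ℕ} (X : Set (EuclideanSpace ℝ (Fin n))) : Set (EuclideanSpace ℝ (Fin n)) :=
  {x | x ∉ X ∧ (closestPoints X x).Nontrivial}

/-- The Peano tangent cone `C_a(X)`. -/
def peanoTangentCone {n : ℕ} (X : Set (EuclideanSpace ℝ (Fin n)))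
    (a : EuclideanSpace ℝ (Fin n)) : Set (EuclideanSpace ℝ (Fin n)) :=
  {v | ∃ (x : ℕ → EuclideanSpace ℝ (Fin n)) (t : ℕ → ℝ), (∀ k, x k ∈ X) ∧ (∀ k, 0 < t k) ∧
    Tendsto x atTop (𝓝 a) ∧ Tendsto (fun k => t k • (x k - a)) atTop (𝓝 v)}

/-- The closed half-line from the origin in the direction `v`. -/
def halfLine {n : ℕ} (v : EuclideanSpace ℝ (Fin n)) : Set (EuclideanSpace ℝ (Fin n)) :=
  {x | ∃ s : ℝ, 0 ≤ s ∧ x = s • v}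

/-- `c` restricted to `[0, ε)` is a continuous semialgebraic curve (its graph is a semialgebraic
subset of `ℝ × ℝⁿ = ℝⁿ⁺¹`) that starts at the origin. -/
structure IsSemialgebraicCurve {n : ℕ} (c : ℝ → EuclideanSpace ℝ (Fin n)) (ε : ℝ) : Prop where
  pos : 0 < ε
  continuousOn : ContinuousOn c (Ico 0 ε)
  semialgebraic : IsSemialgebraic {z : EuclideanSpace ℝ (Fin (n + 1)) |
    z 0 ∈ Ico 0 ε ∧ ∀ i : Fin n, z i.succ = c (z 0) i}
  map_zero : c 0 = 0

/-- A branch of `X` at the origin: a simple semialgebraic curve contained in `X` and starting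
at the origin. -/
structure IsBranch {n : ℕ} (X : Set (EuclideanSpace ℝ (Fin n)))
    (c : ℝ → EuclideanSpace ℝ (Fin n)) (ε : ℝ) : Prop where
  curve : IsSemialgebraicCurve c ε
  injOn : InjOn c (Ico 0 ε)
  mem : ∀ t ∈ Ico 0 ε, c t ∈ X

/-- The tangent cone at the origin of the germ of the curve `c` (identified with its image)
is the set `l`. -/
def HasTangent {n : ℕ} (c : ℝ → EuclideanSpace ℝ (Fin n))
    (l : Set (EuclideanSpace ℝ (Fin n))) : Prop :=
  ∀ᶠ η in 𝓝[>] (0 : ℝ), peanoTangentCone (c '' Ico 0 η) 0 = l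

/-- The curves `c₁` and `c₂` have the same germ of the image at the origin. -/
def SameGerm {n : ℕ} (c₁ c₂ : ℝ → EuclideanSpace ℝ (Fin n)) : Prop :=
  ∀ᶠ η in 𝓝[>] (0 : ℝ),
    ∀ᶠ p in 𝓝 (0 : EuclideanSpace ℝ (Fin n)), (p ∈ c₁ '' Ico 0 η ↔ p ∈ c₂ '' Ico 0 η)

/-- In the linear coordinates `(x, y) = e p` of the plane, the germ at the origin of (the image of)
the curve `c` is the germ of the graph `y = f x`, `x ≥ 0`. -/
def IsGraphGerm (e : EuclideanSpace ℝ (Fin 2) ≃ₗ[ℝ] EuclideanSpace ℝ (Fin 2))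
    (c : ℝ → EuclideanSpace ℝ (Fin 2)) (f : ℝ → ℝ) : Prop :=
  ∀ᶠ η in 𝓝[>] (0 : ℝ), ∀ᶠ p in 𝓝 (0 : EuclideanSpace ℝ (Fin 2)),
    (p ∈ c '' Ico 0 η ↔ 0 ≤ e p 0 ∧ e p 1 = f (e p 0))

/-- The germ of `γ` lies (strictly, off the origin) between the germs of `δ₁` and `δ₂`, three curves
in the plane tangent to the half-line `l`: in suitable linear coordinates `l` is the nonnegative
`x`-axis, the three germs are graphs over it, and the graph of `γ` lies between the two others. -/
def LiesBetween (l : Set (EuclideanSpace ℝ (Fin 2)))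
    (δ₁ δ₂ γ : ℝ → EuclideanSpace ℝ (Fin 2)) : Prop :=
  ∃ (e : EuclideanSpace ℝ (Fin 2) ≃ₗ[ℝ] EuclideanSpace ℝ (Fin 2)) (f₁ f₂ g : ℝ → ℝ),
    (∀ p, p ∈ l ↔ 0 ≤ e p 0 ∧ e p 1 = 0) ∧
    IsGraphGerm e δ₁ f₁ ∧ IsGraphGerm e δ₂ f₂ ∧ IsGraphGerm e γ g ∧
    ((∀ᶠ x in 𝓝[>] (0 : ℝ), f₁ x < g x ∧ g x < f₂ x) ∨
      (∀ᶠ x in 𝓝[>] (0 : ℝ), f₂ x < g x ∧ g x < f₁ x))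

/-! Geometry. In an orthonormal frame with `l` as positive first axis, the two curves are graphs of
`f₁ < f₂` (after exchange) with `fᵢ x / x → 0`, and everything happens in the thin wedge between
them. The medial axis has empty interior, so near the apex a semialgebraic graph contained in its
closure is contained in the medial axis itself (`eventually_med_of_closure`); both walls thus
consist of medial points. The engine is `Near.not_med`: if `q` is closest to `p`, then `q` is the
only closest point of every other point of the segment `pq`, so that no such point is medial. A
shortest segment starting inside the wedge therefore cannot cross a wall (`Near.trapped`): it ends
in the wedge, runs back through the apex, or escapes forwards. Forward escape is excluded once the
apex belongs to `X` (`Wedge.apex_mem`), because then closest points of points at abscissa `x` have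
abscissa below `3 * x`. Hence a point of the closed wedge near the apex has a closest point which is
the apex or lies in the open wedge. The apex cannot serve all points of both walls: its Voronoi cell
is convex, and tangency to the axis would put some wall point strictly inside a triangle spanned in
that cell, where no point is medial (`Wedge.not_forall_near_apex`). So along one wall there are
always closest points in the open wedge. The lexicographically largest one depends semialgebraically
on the parameter and traces `γ`; its abscissa is strictly increasing near `0`, which makes `γ` an
injective graph, and squeezing between the walls gives the tangent. Tameness. The argument
quantifies over reals freely, so the Tarski–Seidenberg theorem is proved first, by counting roots
with Cauchy indices computed by a Euclidean algorithm with parameters. The consequence used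
throughout is `Def1.eventually_or`: a semialgebraic condition on `t` either holds for all small `t >
0` or fails for all of them. It yields generic continuity and monotonicity of semialgebraic
functions of one variable. -/

/-- The sign of a real number, as an integer. -/
noncomputable def sgn (x : ℝ) : ℤ := (SignType.sign x : ℤ)

theorem sgn_zero : sgn 0 = 0 := by simp [sgn]
theorem sgn_of_pos {x : ℝ} (h : 0 < x) : sgn x = 1 := by simp [sgn, sign_pos h]
theorem sgn_of_neg {x : ℝ} (h : x < 0) : sgn x = -1 := by simp [sgn, sign_neg h]
theorem sgn_one : sgn 1 = 1 := sgn_of_pos one_pos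
theorem sgn_mul (x y : ℝ) : sgn (x * y) = sgn x * sgn y := by
  simp [sgn, sign_mul]
theorem sgn_pow (x : ℝ) (n : ℕ) : sgn (x ^ n) = sgn x ^ n := by
  induction n with
  | zero => simp [sgn_one]
  | succ n ih => rw [pow_succ, pow_succ, sgn_mul, ih]
theorem sgn_neg (x : ℝ) : sgn (-x) = -sgn x := by
  rw [neg_eq_neg_one_mul, sgn_mul, sgn_of_neg (by norm_num)]; ring

theorem sgn_eq_one_iff {x : ℝ} : sgn x = 1 ↔ 0 < x := by
  rcases lt_trichotomy x 0 with h | h | h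
  · rw [sgn_of_neg h]; constructor <;> intro h' <;> [omega; linarith]
  · subst h; simp [sgn_zero]
  · simp [sgn_of_pos h, h]

theorem sgn_mem (x : ℝ) : sgn x = -1 ∨ sgn x = 0 ∨ sgn x = 1 := by
  rcases lt_trichotomy x 0 with h | h | h
  · simp [sgn_of_neg h]
  · simp [h, sgn_zero]
  · simp [sgn_of_pos h]

/-! ### Cauchy indices of real rational functions. -/

namespace Polynomial

/-- The value at `a` of the cofactor of the highest power of `X - a` that divides `p`. -/
noncomputable def cofactorAt (p : ℝ[X]) (a : ℝ) : ℝ :=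
  (p /ₘ (X - C a) ^ p.rootMultiplicity a).eval a

theorem rootMultiplicity_cofactorAt_of_eq {p u : ℝ[X]} {a : ℝ} {n : ℕ}
    (h : p = (X - C a) ^ n * u) (hu : u.eval a ≠ 0) :
    p.rootMultiplicity a = n ∧ p.cofactorAt a = u.eval a := by
  have hu0 : u ≠ 0 := by rintro rfl; simp at hu
  have hX : (X - C a : ℝ[X]) ≠ 0 := X_sub_C_ne_zero a
  have hm : p.rootMultiplicity a = n := by
    rw [h, rootMultiplicity_mul (mul_ne_zero (pow_ne_zero _ hX) hu0),
      rootMultiplicity_X_sub_C_pow, rootMultiplicity_eq_zero hu, add_zero]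
  refine ⟨hm, ?_⟩
  rw [cofactorAt, hm, h, mul_divByMonic_cancel_left _ ((monic_X_sub_C a).pow n)]

theorem exists_eq_pow_mul_cofactor {p : ℝ[X]} (hp : p ≠ 0) (a : ℝ) :
    ∃ u : ℝ[X], p = (X - C a) ^ p.rootMultiplicity a * u ∧ u.eval a ≠ 0 ∧
      p.cofactorAt a = u.eval a :=
  ⟨p /ₘ (X - C a) ^ p.rootMultiplicity a, (pow_mul_divByMonic_rootMultiplicity_eq p a).symm,
    eval_divByMonic_pow_rootMultiplicity_ne_zero a hp, rfl⟩

theorem cofactorAt_mul {p q : ℝ[X]} (hp : p ≠ 0) (hq : q ≠ 0) (a : ℝ) :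
    (p * q).cofactorAt a = p.cofactorAt a * q.cofactorAt a := by
  obtain ⟨u, hu, hu0, hu'⟩ := exists_eq_pow_mul_cofactor hp a
  obtain ⟨w, hw, hw0, hw'⟩ := exists_eq_pow_mul_cofactor hq a
  have := rootMultiplicity_cofactorAt_of_eq (p := p * q) (u := u * w) (a := a)
    (n := p.rootMultiplicity a + q.rootMultiplicity a)
    (by nth_rewrite 1 [hu, hw]; ring) (by simp [hu0, hw0])
  rw [this.2, hu', hw', eval_mul]

/-- The contribution of `a` to the Cauchy index of `q / p`. -/
noncomputable def localIndex (p q : ℝ[X]) (a : ℝ) : ℤ :=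
  if q.rootMultiplicity a < p.rootMultiplicity a ∧
    Odd (p.rootMultiplicity a + q.rootMultiplicity a)
  then sgn (p.cofactorAt a) * sgn (q.cofactorAt a) else 0

/-- The Cauchy index of `q / p` over the real line. -/
noncomputable def cauchyIndex (p q : ℝ[X]) : ℤ := ∑ a ∈ p.roots.toFinset, localIndex p q a

/-- The Cauchy index of `1 / h`. -/
noncomputable def oddRootSum (h : ℝ[X]) : ℤ :=
  ∑ a ∈ h.roots.toFinset, if Odd (h.rootMultiplicity a) then sgn (h.cofactorAt a) else 0

theorem localIndex_eq_zero_of_not_root {p q : ℝ[X]} {a : ℝ} (h : ¬ p.IsRoot a) :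
    localIndex p q a = 0 := by
  simp [localIndex, rootMultiplicity_eq_zero h]

/-- At a given point at most one of `q / p` and `p / q` has a pole, and when the pole has odd order
its sign is that of the cofactor of `p * q`. This is the inversion step of the Euclidean algorithm
for Cauchy indices. -/
theorem cauchyIndex_add_swap {p q : ℝ[X]} (hp : p ≠ 0) (hq : q ≠ 0) :
    cauchyIndex p q + cauchyIndex q p = oddRootSum (p * q) := by
  have hpq := mul_ne_zero hp hq
  have key : ∀ f g : ℝ[X], f ≠ 0 → f ∣ p * q →
      cauchyIndex f g = ∑ a ∈ (p * q).roots.toFinset, localIndex f g a := by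
    intro f g hf hd
    refine Finset.sum_subset ?_ ?_
    · intro a ha
      simp only [Multiset.mem_toFinset, mem_roots hf, mem_roots hpq] at ha ⊢
      exact ha.dvd hd
    · intro a _ ha
      simp only [Multiset.mem_toFinset, mem_roots hf] at ha
      exact localIndex_eq_zero_of_not_root ha
  rw [key p q hp (dvd_mul_right _ _), key q p hq (dvd_mul_left _ _), ← Finset.sum_add_distrib,
    oddRootSum]
  refine Finset.sum_congr rfl fun a _ => ?_
  rw [rootMultiplicity_mul hpq, cofactorAt_mul hp hq, sgn_mul, localIndex, localIndex]
  rcases lt_trichotomy (q.rootMultiplicity a) (p.rootMultiplicity a) with h | h | h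
  · simp [h, h.not_gt]
  · have : ¬ Odd (p.rootMultiplicity a + q.rootMultiplicity a) := by
      rw [h, Nat.not_odd_iff_even]; exact ⟨_, rfl⟩
    simp [h]
  · simp [h, h.not_gt, add_comm (q.rootMultiplicity a), mul_comm]

theorem cauchyIndex_zero_right (p : ℝ[X]) : cauchyIndex p 0 = 0 := by
  refine Finset.sum_eq_zero fun a _ => ?_
  simp [localIndex, cofactorAt, sgn_zero]

theorem localIndex_eq_zero_of_dvd {p q : ℝ[X]} {a : ℝ} {n : ℕ} (hn : p.rootMultiplicity a ≤ n)
    (h : (X - C a) ^ n ∣ q) : localIndex p q a = 0 := by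
  by_cases hq : q = 0
  · simp [hq, localIndex, cofactorAt, sgn_zero]
  · have := (le_rootMultiplicity_iff hq).2 h
    simp only [localIndex, ite_eq_right_iff, and_imp]
    intro h'; omega

/-- Adding the polynomial `s` to `c * (q / p)` changes no polar part: this is the division step of
the Euclidean algorithm. -/
theorem cauchyIndex_linear {p q s : ℝ[X]} {c : ℝ} (hp : p ≠ 0) (hc : 0 < c) :
    cauchyIndex p (C c * q + p * s) = cauchyIndex p q := by
  refine Finset.sum_congr rfl fun a _ => ?_
  obtain ⟨u, hu, hu0, hu'⟩ := exists_eq_pow_mul_cofactor hp a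
  set m := p.rootMultiplicity a with hm
  by_cases hd : (X - C a) ^ m ∣ q
  · rw [localIndex_eq_zero_of_dvd hm.ge (q := q) hd, localIndex_eq_zero_of_dvd hm.ge]
    exact dvd_add (hd.mul_left _) ((Dvd.intro _ hu.symm).mul_right _)
  · have hq : q ≠ 0 := by rintro rfl; simp at hd
    obtain ⟨w, hw, hw0, hw'⟩ := exists_eq_pow_mul_cofactor hq a
    set k := q.rootMultiplicity a with hk
    have hkm : k < m := by
      by_contra! hle
      exact hd ((pow_dvd_pow _ hle).trans (Dvd.intro _ hw.symm))
    obtain ⟨d, hd'⟩ : ∃ d, m = k + (d + 1) := ⟨m - k - 1, by omega⟩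
    have := rootMultiplicity_cofactorAt_of_eq (p := C c * q + p * s)
      (u := C c * w + (X - C a) ^ (d + 1) * (u * s)) (a := a) (n := k)
      (by rw [hu, hd', pow_add]; nth_rewrite 1 [hw]; ring)
      (by simp [hc.ne', hw0])
    rw [localIndex, localIndex, this.1, this.2, ← hk, ← hm, hw']
    simp [sgn_mul, sgn_of_pos hc]

/-- The logarithmic derivative of `f` has a simple pole with positive residue at each root, so
multiplying it by `g` makes the index record the sign of `g` there. Roots are counted without
multiplicity. -/
theorem cauchyIndex_derivative_mul {f : ℝ[X]} (hf : f ≠ 0) (g : ℝ[X]) :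
    cauchyIndex f (derivative f * g) = ∑ a ∈ f.roots.toFinset, sgn (g.eval a) := by
  refine Finset.sum_congr rfl fun a ha => ?_
  simp only [Multiset.mem_toFinset, mem_roots hf] at ha
  obtain ⟨u, hu, hu0, hu'⟩ := exists_eq_pow_mul_cofactor hf a
  have hpos : 0 < f.rootMultiplicity a := (rootMultiplicity_pos hf).2 ha
  obtain ⟨d, hd⟩ : ∃ d, f.rootMultiplicity a = d + 1 := ⟨_, (Nat.sub_add_cancel hpos).symm⟩
  have hder : derivative f = (X - C a) ^ d * (C ((d : ℝ) + 1) * u + (X - C a) * derivative u) := by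
    conv_lhs => rw [hu, hd]
    rw [derivative_mul, derivative_X_sub_C_pow, Nat.add_sub_cancel]
    simp only [map_add, map_one, map_natCast, Nat.cast_add, Nat.cast_one]
    ring
  by_cases hg : g.eval a = 0
  · rw [hg, sgn_zero]
    obtain ⟨w, hw⟩ := dvd_iff_isRoot.2 hg
    refine localIndex_eq_zero_of_dvd le_rfl ?_
    rw [hd, hder, hw, pow_succ]
    exact ⟨(C ((d : ℝ) + 1) * u + (X - C a) * derivative u) * w, by ring⟩
  · have hd0 : (0 : ℝ) < d + 1 := by positivity
    have := rootMultiplicity_cofactorAt_of_eq (p := derivative f * g)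
      (u := (C ((d : ℝ) + 1) * u + (X - C a) * derivative u) * g) (a := a) (n := d)
      (by rw [hder]; ring) (by simp [hu0, hg, hd0.ne'])
    rw [localIndex, this.1, this.2, hd, hu', if_pos ⟨by omega, ⟨d, by ring⟩⟩, ← sgn_mul]
    have : u.eval a * ((C ((d : ℝ) + 1) * u + (X - C a) * derivative u) * g).eval a =
        ((d + 1) * (u.eval a) ^ 2) * g.eval a := by simp; ring
    rw [this, sgn_mul, sgn_of_pos (by positivity), one_mul]

/-- The sign of a polynomial near `+∞`. -/
noncomputable def signTop (p : ℝ[X]) : ℤ := sgn p.leadingCoeff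

/-- The sign of a polynomial near `-∞`. -/
noncomputable def signBot (p : ℝ[X]) : ℤ := sgn (p.comp (-X)).leadingCoeff

theorem signTop_mul (p q : ℝ[X]) : signTop (p * q) = signTop p * signTop q := by
  simp [signTop, sgn_mul]

theorem signBot_mul (p q : ℝ[X]) : signBot (p * q) = signBot p * signBot q := by
  simp [signBot, sgn_mul]

theorem sgn_eval_eq_signTop {u : ℝ[X]} {b : ℝ} (hr : ∀ a, b ≤ a → u.eval a ≠ 0) :
    sgn (u.eval b) = signTop u := by
  have main : ∀ w : ℝ[X], (∀ a, b ≤ a → w.eval a ≠ 0) → 0 < w.leadingCoeff → 0 < w.eval b := by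
    intro w hw hl
    by_cases hdeg : 0 < w.degree
    · have ht := w.tendsto_atTop_of_leadingCoeff_nonneg hdeg hl.le
      obtain ⟨c, hc1, hc2⟩ := ((ht.eventually_gt_atTop 0).and (eventually_ge_atTop b)).exists
      by_contra! hle
      obtain ⟨x, hx, hx0⟩ := intermediate_value_Icc hc2 w.continuous.continuousOn ⟨hle, hc1.le⟩
      exact hw x hx.1 hx0
    · rw [eq_C_of_degree_le_zero (not_lt.1 hdeg)] at hl ⊢
      simpa using hl
  have hu : u ≠ 0 := by rintro rfl; exact hr b le_rfl (by simp)
  rcases lt_or_gt_of_ne (leadingCoeff_ne_zero.2 hu) with h | h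
  · have := main (-u) (by simpa using hr) (by simpa using h)
    rw [signTop, sgn_of_neg h, sgn_of_neg (by simpa using this)]
  · rw [signTop, sgn_of_pos h, sgn_of_pos (main u hr h)]

/-- The sign of `h` changes exactly at the roots of odd multiplicity, by twice the sign of the
cofactor; the sum telescopes. The induction strips off the largest root. -/
theorem two_mul_oddRootSum {h : ℝ[X]} (hh : h ≠ 0) :
    2 * oddRootSum h = signTop h - signBot h := by
  induction hn : h.roots.toFinset.card generalizing h with
  | zero =>
    have h0 : h.roots.toFinset = ∅ := Finset.card_eq_zero.1 hn
    have hr : ∀ a, h.eval a ≠ 0 := by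
      intro a ha
      have : a ∈ h.roots.toFinset := by simp [hh, ha]
      simp [h0] at this
    have h1 := sgn_eval_eq_signTop (u := h) (b := 0) (fun a _ => hr a)
    have h2 := sgn_eval_eq_signTop (u := h.comp (-X)) (b := 0) (fun a _ => by simpa using hr (-a))
    simp only [eval_comp, eval_neg, eval_X, neg_zero] at h2
    rw [signBot, ← signTop, ← h1, ← h2, oddRootSum, h0]; simp
  | succ n ih =>
    have hne : h.roots.toFinset.Nonempty := Finset.card_pos.1 (by omega)
    set b := h.roots.toFinset.max' hne with hb
    have hbm : b ∈ h.roots.toFinset := Finset.max'_mem _ _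
    obtain ⟨u, hu, hu0, hu'⟩ := exists_eq_pow_mul_cofactor hh b
    set m := h.rootMultiplicity b
    have hune : u ≠ 0 := by rintro rfl; simp at hu0
    have hmpos : 0 < m := (rootMultiplicity_pos hh).2 (by simpa [hh] using hbm)
    have hroots : u.roots.toFinset = h.roots.toFinset.erase b := by
      ext a
      simp only [Multiset.mem_toFinset, mem_roots hune, Finset.mem_erase, mem_roots hh, IsRoot.def]
      constructor
      · intro ha
        refine ⟨fun hab => hu0 (hab ▸ ha), ?_⟩
        rw [hu, eval_mul, ha, mul_zero]
      · rintro ⟨hab, ha⟩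
        rw [hu, eval_mul] at ha
        simpa [sub_eq_zero, hab] using ha
    have hlt : ∀ a ∈ u.roots.toFinset, a < b := by
      intro a ha
      rw [hroots, Finset.mem_erase] at ha
      exact lt_of_le_of_ne (Finset.le_max' _ _ ha.2) ha.1
    have hub : sgn (u.eval b) = signTop u := by
      refine sgn_eval_eq_signTop fun a hba ha => ?_
      exact absurd (hlt a (by simp [hune, ha])) (not_lt.2 hba)
    have ihu := ih hune (by rw [hroots, Finset.card_erase_of_mem hbm, hn]; rfl)
    -- All other roots lie to the left of `b`, where `(X - b) ^ m` has sign `(-1) ^ m`.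
    have hsum : oddRootSum h = (-1) ^ m * oddRootSum u +
        if Odd m then sgn (u.eval b) else 0 := by
      rw [oddRootSum, ← Finset.sum_erase_add _ _ hbm, hu', ← hroots, oddRootSum, Finset.mul_sum]
      congr 1
      refine Finset.sum_congr rfl fun a ha => ?_
      obtain ⟨w, hw, hw0, hw'⟩ := exists_eq_pow_mul_cofactor hune a
      have hab := hlt a ha
      have := rootMultiplicity_cofactorAt_of_eq (p := h) (u := (X - C b) ^ m * w) (a := a)
        (n := u.rootMultiplicity a) (by rw [hu]; nth_rewrite 1 [hw]; ring)
        (by simp [hw0, sub_eq_zero, hab.ne])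
      rw [this.1, this.2, hw']
      have : sgn (((X - C b) ^ m * w).eval a) = (-1) ^ m * sgn (w.eval a) := by
        simp [sgn_mul, sgn_pow, sgn_of_neg (sub_neg.2 hab)]
      rw [this]; split_ifs <;> simp
    have ht : signTop h = signTop u := by
      rw [hu, signTop_mul]; simp [signTop, sgn_one]
    have hbt : signBot h = (-1) ^ m * signBot u := by
      have : ((X - C b : ℝ[X]).comp (-X)).leadingCoeff = -1 := by
        have : (X - C b : ℝ[X]).comp (-X) = -(X + C b) := by simp; ring
        rw [this, leadingCoeff_neg, leadingCoeff_X_add_C]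
      rw [hu, signBot_mul]
      simp only [signBot, pow_comp, leadingCoeff_pow, this, sgn_pow, sgn_neg, sgn_one]
    rw [hsum, ht, hbt, hub]
    rcases Nat.even_or_odd m with he | ho
    · simp only [he.neg_one_pow, Nat.not_odd_iff_even.2 he, if_false]; linarith
    · simp only [ho.neg_one_pow, ho, if_true]; linarith

theorem two_mul_cauchyIndex_eq {p q : ℝ[X]} (hp : p ≠ 0) (hq : q ≠ 0) :
    2 * cauchyIndex p q = signTop p * signTop q - signBot p * signBot q - 2 * cauchyIndex q p := by
  have h1 := cauchyIndex_add_swap hp hq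
  have h2 := two_mul_oddRootSum (mul_ne_zero hp hq)
  rw [signTop_mul, signBot_mul] at h2
  linarith

end Polynomial

/-! ### Boolean calculus of semialgebraic predicates and integer-valued functions. -/

/-- Semialgebraic subsets of `ℝ^ι`: Boolean combinations of the sets `{p > 0}`. -/
inductive Semialg {ι : Type} : Set (ι → ℝ) → Prop
  | pos (p : MvPolynomial ι ℝ) : Semialg {x | 0 < MvPolynomial.eval x p}
  | compl {S : Set (ι → ℝ)} : Semialg S → Semialg Sᶜ
  | union {S T : Set (ι → ℝ)} : Semialg S → Semialg T → Semialg (S ∪ T)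

/-- A predicate on `ℝ^ι` is semialgebraic. -/
def DefPred {ι : Type} (P : (ι → ℝ) → Prop) : Prop := Semialg {x | P x}

namespace DefPred

variable {ι κ : Type} {P Q : (ι → ℝ) → Prop}

theorem congr (h : DefPred P) (hPQ : ∀ x, Q x ↔ P x) : DefPred Q := by
  have : Q = P := funext fun x => propext (hPQ x)
  rwa [this]

theorem not (h : DefPred P) : DefPred fun x => ¬ P x := Semialg.compl h

theorem or (h : DefPred P) (h' : DefPred Q) : DefPred fun x => P x ∨ Q x := Semialg.union h h'

theorem and (h : DefPred P) (h' : DefPred Q) : DefPred fun x => P x ∧ Q x :=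
  (h.not.or h'.not).not.congr fun x => by tauto

theorem imp (h : DefPred P) (h' : DefPred Q) : DefPred fun x => P x → Q x :=
  (h.not.or h').congr fun x => by tauto

theorem poly_pos (p : MvPolynomial ι ℝ) : DefPred fun x => 0 < MvPolynomial.eval x p :=
  Semialg.pos p

theorem poly_eq_zero (p : MvPolynomial ι ℝ) : DefPred fun x => MvPolynomial.eval x p = 0 :=
  ((poly_pos p).not.and (poly_pos (-p)).not).congr fun x => by
    simp only [map_neg, not_lt, Left.neg_nonpos_iff]; constructor
    · intro h; simp [h]
    · rintro ⟨h, h'⟩; exact le_antisymm h h'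

theorem const (c : Prop) : DefPred fun _ : ι → ℝ => c := by
  by_cases h : c
  · exact (poly_pos 1).congr fun x => by simp [h]
  · exact (poly_pos 0).congr fun x => by simp [h]

theorem finset_ex {α : Type*} (s : Finset α) {R : α → (ι → ℝ) → Prop}
    (h : ∀ a ∈ s, DefPred (R a)) : DefPred fun x => ∃ a ∈ s, R a x := by
  classical
  induction s using Finset.induction_on with
  | empty => exact (const False).congr fun x => by simp
  | insert a s _ ih =>
    refine ((h a (by simp)).or (ih fun b hb => h b (by simp [hb]))).congr fun x => by simp

theorem finset_all {α : Type*} (s : Finset α) {R : α → (ι → ℝ) → Prop}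
    (h : ∀ a ∈ s, DefPred (R a)) : DefPred fun x => ∀ a ∈ s, R a x :=
  (finset_ex s fun a ha => (h a ha).not).not.congr fun x => by push Not; rfl

theorem list_ex {α : Type*} (s : List α) {R : α → (ι → ℝ) → Prop}
    (h : ∀ a ∈ s, DefPred (R a)) : DefPred fun x => ∃ a ∈ s, R a x := by
  classical
  exact (finset_ex s.toFinset fun a ha => h a (by simpa using ha)).congr fun x => by simp

/-- Polynomial substitution. -/
theorem comp_poly {R : (κ → ℝ) → Prop} (h : DefPred R) (φ : κ → MvPolynomial ι ℝ) :
    DefPred fun x => R fun k => MvPolynomial.eval x (φ k) := by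
  have : ∀ S : Set (κ → ℝ), Semialg S →
      Semialg {x : ι → ℝ | (fun k => MvPolynomial.eval x (φ k)) ∈ S} := by
    intro S hS
    induction hS with
    | pos p =>
      refine (poly_pos (MvPolynomial.bind₁ φ p)).congr fun x => ?_
      rw [← MvPolynomial.aeval_eq_eval, MvPolynomial.aeval_bind₁]
      simp [MvPolynomial.aeval_eq_eval]
    | compl _ ih => exact ih.compl
    | union _ _ ih ih' => exact ih.union ih'
  exact this _ h

end DefPred

/-- An integer-valued function with finitely many values and semialgebraic level sets. -/
structure DefInt {ι : Type} (N : (ι → ℝ) → ℤ) : Prop where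
  finite : (range N).Finite
  level : ∀ k, DefPred fun x => N x = k

namespace DefInt

variable {ι : Type} {N M : (ι → ℝ) → ℤ}

theorem pred (h : DefInt N) (R : ℤ → Prop) : DefPred fun x => R (N x) := by
  refine (DefPred.finset_ex h.finite.toFinset
    (R := fun k x => R k ∧ N x = k) fun k _ => (DefPred.const _).and (h.level k)).congr fun x => ?_
  simp

theorem const (k : ℤ) : DefInt fun _ : ι → ℝ => k :=
  ⟨(finite_singleton k).subset (by rintro _ ⟨x, rfl⟩; rfl), fun j => DefPred.const _⟩

theorem map₂ (h : DefInt N) (h' : DefInt M) (φ : ℤ → ℤ → ℤ) : DefInt fun x => φ (N x) (M x) := by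
  refine ⟨(h.finite.image2 φ h'.finite).subset ?_, fun k => ?_⟩
  · rintro _ ⟨x, rfl⟩; exact ⟨_, ⟨x, rfl⟩, _, ⟨x, rfl⟩, rfl⟩
  · refine (DefPred.finset_ex h.finite.toFinset (R := fun a x => N x = a ∧ φ a (M x) = k)
      fun a _ => (h.level a).and (h'.pred (fun b => φ a b = k))).congr fun x => ?_
    simp

theorem ite {P : (ι → ℝ) → Prop} [∀ x, Decidable (P x)] (hP : DefPred P) (h : DefInt N)
    (h' : DefInt M) : DefInt fun x => if P x then N x else M x := by
  refine ⟨(h.finite.union h'.finite).subset ?_, fun k => ?_⟩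
  · rintro _ ⟨x, rfl⟩
    dsimp only; split_ifs
    · exact Or.inl ⟨x, rfl⟩
    · exact Or.inr ⟨x, rfl⟩
  · refine ((hP.and (h.level k)).or (hP.not.and (h'.level k))).congr fun x => ?_
    split_ifs with hx <;> simp [hx]

theorem add (h : DefInt N) (h' : DefInt M) : DefInt fun x => N x + M x := h.map₂ h' _
theorem mul (h : DefInt N) (h' : DefInt M) : DefInt fun x => N x * M x := h.map₂ h' _
theorem sub (h : DefInt N) (h' : DefInt M) : DefInt fun x => N x - M x := h.map₂ h' _

theorem sum {α : Type*} (s : Finset α) {N : α → (ι → ℝ) → ℤ} (h : ∀ a ∈ s, DefInt (N a)) :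
    DefInt fun x => ∑ a ∈ s, N a x := by
  classical
  induction s using Finset.induction_on with
  | empty => simpa using const 0
  | insert a s ha ih =>
    simp only [Finset.sum_insert ha]
    exact (h a (by simp)).add (ih fun b hb => h b (by simp [hb]))

theorem sgn_poly (p : MvPolynomial ι ℝ) : DefInt fun x => sgn (MvPolynomial.eval x p) := by
  classical
  have : (fun x => sgn (MvPolynomial.eval x p)) = fun x =>
      if 0 < MvPolynomial.eval x p then 1 else if MvPolynomial.eval x p = 0 then 0 else -1 := by
    funext x
    split_ifs with h h'
    · exact sgn_of_pos h
    · rw [h', sgn_zero]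
    · exact sgn_of_neg (lt_of_le_of_ne (not_lt.1 h) h')
  rw [this]
  exact ite (DefPred.poly_pos p) (const 1) (ite (DefPred.poly_eq_zero p) (const 0) (const (-1)))

end DefInt

/-! ### Eliminating one real variable, with parameters. -/

namespace Polynomial

theorem exists_pseudo_divide {R : Type*} [CommRing R] [IsDomain R] {p : R[X]} (hp : p ≠ 0)
    (q : R[X]) : ∃ (k : ℕ) (s r : R[X]), C (p.leadingCoeff ^ k) * q = p * s + r ∧
      r.degree < p.degree := by
  induction hd : q.degree using WellFoundedLT.induction generalizing q with
  | ind d ih =>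
    by_cases hlt : q.degree < p.degree
    · exact ⟨0, 0, q, by simp, hlt⟩
    have hle := not_lt.1 hlt
    have hq : q ≠ 0 := by
      rintro rfl; rw [degree_zero, le_bot_iff, degree_eq_bot] at hle; exact hp hle
    have hn : p.natDegree ≤ q.natDegree := natDegree_le_natDegree hle
    have hpl := leadingCoeff_ne_zero.2 hp
    have hql := leadingCoeff_ne_zero.2 hq
    set t : R[X] := C q.leadingCoeff * X ^ (q.natDegree - p.natDegree)
    have ht : t ≠ 0 := by simp [t, hq]
    have hdeg : (C p.leadingCoeff * q - p * t).degree < q.degree := by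
      have h1 : (C p.leadingCoeff * q).degree = q.degree := degree_C_mul hpl
      rw [← h1]
      refine degree_sub_lt_left ?_ (mul_ne_zero (by simpa using hp) hq) ?_
      · rw [h1, degree_mul, degree_C_mul_X_pow _ hql, degree_eq_natDegree hp,
          degree_eq_natDegree hq]
        norm_cast; omega
      · rw [leadingCoeff_mul, leadingCoeff_mul, leadingCoeff_C, leadingCoeff_C_mul_X_pow, mul_comm]
    obtain ⟨k, s, r, h, hr⟩ := ih _ (hd ▸ hdeg) _ rfl
    refine ⟨k + 1, s + C (p.leadingCoeff ^ k) * t, r, ?_, hr⟩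
    have h' : C (p.leadingCoeff ^ k) * (C p.leadingCoeff * q) =
        p * s + r + C (p.leadingCoeff ^ k) * (p * t) := by rw [← h]; ring
    rw [pow_succ, C_mul, mul_assoc, h']; ring

variable {ι : Type}

/-- An even power of the leading coefficient becomes positive wherever that coefficient does not
vanish, as `cauchyIndex_linear` requires. -/
theorem exists_pseudo_divide_even {R : Type*} [CommRing R] [IsDomain R] {p : R[X]} (hp : p ≠ 0)
    (q : R[X]) : ∃ (k : ℕ) (s r : R[X]), C (p.leadingCoeff ^ (2 * k)) * q = p * s + r ∧
      r.degree < p.degree := by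
  obtain ⟨k, s, r, h, hr⟩ := exists_pseudo_divide hp q
  refine ⟨k, C (p.leadingCoeff ^ k) * s, C (p.leadingCoeff ^ k) * r, ?_, ?_⟩
  · rw [two_mul, pow_add, C_mul]
    linear_combination C (p.leadingCoeff ^ k) * h
  · rwa [degree_C_mul (pow_ne_zero _ (leadingCoeff_ne_zero.2 hp))]

/-- The real polynomial obtained by substituting values for the parameters. -/
noncomputable abbrev spec (x : ι → ℝ) (f : (MvPolynomial ι ℝ)[X]) : ℝ[X] :=
  f.map (MvPolynomial.eval x)

theorem spec_eraseLead {x : ι → ℝ} {f : (MvPolynomial ι ℝ)[X]}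
    (h : MvPolynomial.eval x f.leadingCoeff = 0) : spec x f.eraseLead = spec x f := by
  have := congrArg (spec x) (eraseLead_add_C_mul_X_pow f)
  simpa only [spec, Polynomial.map_add, Polynomial.map_mul, Polynomial.map_C, h, C_0, zero_mul,
    add_zero] using this

/-- The degree may drop under specialization. Where the leading coefficient vanishes, its term is
erased and the induction on the degree continues. -/
theorem defInt_signTop (f : (MvPolynomial ι ℝ)[X]) : DefInt fun x => signTop (spec x f) := by
  classical
  induction hd : f.degree using WellFoundedLT.induction generalizing f with
  | ind d ih =>
    by_cases hf : f = 0
    · simpa [hf, signTop, sgn_zero] using DefInt.const 0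
    have h := DefInt.ite (DefPred.poly_eq_zero f.leadingCoeff)
      (ih _ (hd ▸ degree_eraseLead_lt hf) _ rfl) (DefInt.sgn_poly f.leadingCoeff)
    convert h using 2 with x
    split_ifs with hx
    · rw [spec_eraseLead hx]
    · rw [signTop, spec, leadingCoeff_map_of_leadingCoeff_ne_zero _ hx]

theorem defInt_signBot (f : (MvPolynomial ι ℝ)[X]) : DefInt fun x => signBot (spec x f) := by
  convert defInt_signTop (f.comp (-X)) using 2 with x
  simp [signBot, signTop, spec, Polynomial.map_comp]

theorem signTop_eq_zero_iff {p : ℝ[X]} : signTop p = 0 ↔ p = 0 := by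
  rw [signTop, ← leadingCoeff_eq_zero]
  rcases lt_trichotomy p.leadingCoeff 0 with h | h | h
  · simp [sgn_of_neg h, h.ne]
  · simp [h, sgn_zero]
  · simp [sgn_of_pos h, h.ne']

theorem defPred_spec_eq_zero (f : (MvPolynomial ι ℝ)[X]) : DefPred fun x => spec x f = 0 :=
  ((defInt_signTop f).level 0).congr fun _ => signTop_eq_zero_iff.symm

/-- The Euclidean algorithm run uniformly in the parameters: replace `q` by its remainder modulo
`p`, exchange the two by the inversion formula, and branch on the vanishing of the leading
coefficient of `p` and of the remainder. -/
theorem defInt_cauchyIndex (p q : (MvPolynomial ι ℝ)[X]) :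
    DefInt fun x => cauchyIndex (spec x p) (spec x q) := by
  classical
  induction hd : p.degree using WellFoundedLT.induction generalizing p q with
  | ind d ih =>
    by_cases hp : p = 0
    · simpa [hp, cauchyIndex] using DefInt.const 0
    obtain ⟨k, s, r, hs, hr⟩ := exists_pseudo_divide_even hp q
    have key : DefInt fun x => signTop (spec x p) * signTop (spec x r) -
        signBot (spec x p) * signBot (spec x r) - 2 * cauchyIndex (spec x r) (spec x p) :=
      (((defInt_signTop p).mul (defInt_signTop r)).sub
        ((defInt_signBot p).mul (defInt_signBot r))).sub
        ((DefInt.const 2).mul (ih _ (hd ▸ hr) r p rfl))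
    have h := DefInt.ite (DefPred.poly_eq_zero p.leadingCoeff)
      (ih _ (hd ▸ degree_eraseLead_lt hp) _ q rfl)
      (DefInt.ite (defPred_spec_eq_zero r) (DefInt.const 0) (key.map₂ (DefInt.const 2) (· / ·)))
    convert h using 2 with x
    split_ifs with hx hrx
    · rw [spec_eraseLead hx]
    all_goals
      set c := MvPolynomial.eval x p.leadingCoeff with hc
      have hpx : spec x p ≠ 0 := by
        intro h0
        have := leadingCoeff_map_of_leadingCoeff_ne_zero (MvPolynomial.eval x) hx
        rw [← spec, h0, leadingCoeff_zero] at this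
        exact hx this.symm
      have hs' : C (c ^ (2 * k)) * spec x q = spec x p * spec x s + spec x r := by
        have := congrArg (spec x) hs
        simpa [spec, ← hc] using this
      have hcp : 0 < c ^ (2 * k) := (even_two_mul k).pow_pos hx
      have hq : cauchyIndex (spec x p) (spec x q) = cauchyIndex (spec x p) (spec x r) := by
        rw [← cauchyIndex_linear (s := -spec x s) hpx hcp]
        congr 1
        linear_combination hs'
    · rw [hq, hrx, cauchyIndex_zero_right]
    · have := two_mul_cauchyIndex_eq hpx hrx
      rw [hq]; omega

theorem eventually_eval_pos_of_signTop {p : ℝ[X]} (h : signTop p = 1) :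
    ∀ᶠ y in atTop, 0 < p.eval y := by
  have hp : p ≠ 0 := by rintro rfl; simp [signTop, sgn_zero] at h
  obtain ⟨B, hB⟩ := eventually_atTop.1 (eventually_atTop_not_isRoot p hp)
  filter_upwards [eventually_ge_atTop B] with y hy
  rw [← sgn_eq_one_iff, sgn_eval_eq_signTop fun a ha => hB a (hy.trans ha), h]

theorem exists_forall_pos_of_signTop {α : Type*} {G : Finset α} {g : α → ℝ[X]}
    (h : ∀ i ∈ G, signTop (g i) = 1) : ∃ y, ∀ i ∈ G, 0 < (g i).eval y :=
  ((Finset.eventually_all G).2 fun i hi => eventually_eval_pos_of_signTop (h i hi)).exists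

/-- On the component of the complement of the roots of the product that contains `y`, all the signs
are constant. An unbounded component is tested at infinity; a bounded one contains, by Rolle, a
critical point of the product, which reduces the question to roots of one polynomial. -/
theorem exists_forall_pos_iff {α : Type*} (G : Finset α) (g : α → ℝ[X]) :
    (∃ y, ∀ i ∈ G, 0 < (g i).eval y) ↔ (∀ i ∈ G, signTop (g i) = 1) ∨
      (∀ i ∈ G, signBot (g i) = 1) ∨ (derivative (∏ i ∈ G, g i) ≠ 0 ∧
        ∃ y, (derivative (∏ i ∈ G, g i)).eval y = 0 ∧ ∀ i ∈ G, 0 < (g i).eval y) := by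
  constructor
  · rintro ⟨y, hy⟩
    set P := ∏ i ∈ G, g i with hP
    have hPy : P.eval y ≠ 0 := by
      rw [hP, eval_prod]; exact (Finset.prod_pos hy).ne'
    have hP0 : P ≠ 0 := by rintro h; simp [h] at hPy
    have hroot : ∀ i ∈ G, ∀ a, (g i).eval a = 0 → P.eval a = 0 := by
      intro i hi a ha
      rw [hP, eval_prod]; exact Finset.prod_eq_zero hi ha
    by_cases hT : ∀ a, y ≤ a → P.eval a ≠ 0
    · left; intro i hi
      rw [← sgn_eval_eq_signTop (fun a ha h => hT a ha (hroot i hi a h)), sgn_of_pos (hy i hi)]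
    by_cases hB : ∀ a, a ≤ y → P.eval a ≠ 0
    · right; left; intro i hi
      rw [signBot, ← signTop, ← sgn_eval_eq_signTop (u := (g i).comp (-X)) (b := -y)
        (fun a ha h => hB (-a) (by linarith) (hroot i hi _ (by simpa using h)))]
      simpa using sgn_of_pos (hy i hi)
    right; right
    push Not at hT hB
    obtain ⟨b', hb', hb'0⟩ := hT
    obtain ⟨a', ha', ha'0⟩ := hB
    have hmem : ∀ a, a ∈ P.roots.toFinset ↔ P.eval a = 0 := by intro a; simp [hP0]
    have hne1 : (P.roots.toFinset.filter (y ≤ ·)).Nonempty :=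
      ⟨b', by rw [Finset.mem_filter, hmem]; exact ⟨hb'0, hb'⟩⟩
    have hne2 : (P.roots.toFinset.filter (· ≤ y)).Nonempty :=
      ⟨a', by rw [Finset.mem_filter, hmem]; exact ⟨ha'0, ha'⟩⟩
    obtain ⟨b, hb, hbmin⟩ := Finset.exists_min_image _ id hne1
    obtain ⟨a, ha, hamax⟩ := Finset.exists_max_image _ id hne2
    simp only [Finset.mem_filter, hmem, id] at hb ha hbmin hamax
    have hyb : y < b := lt_of_le_of_ne hb.2 fun h => hPy (h ▸ hb.1)
    have hay : a < y := lt_of_le_of_ne ha.2 fun h => hPy (h ▸ ha.1)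
    obtain ⟨c, hc, hc0⟩ := exists_deriv_eq_zero (f := fun t => P.eval t) (hay.trans hyb)
      P.continuous.continuousOn (by rw [ha.1, hb.1])
    rw [Polynomial.deriv] at hc0
    have hno : ∀ t ∈ Ioo a b, P.eval t ≠ 0 := by
      intro t ht h0
      rcases le_total y t with h | h
      · exact absurd (hbmin t ⟨h0, h⟩) (not_le.2 ht.2)
      · exact absurd (hamax t ⟨h0, h⟩) (not_le.2 ht.1)
    refine ⟨?_, c, hc0, fun i hi => ?_⟩
    · intro h0
      rw [eq_C_of_derivative_eq_zero h0] at hPy ha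
      simp at hPy ha; exact hPy ha.1
    · by_contra! hle
      have hcont : ContinuousOn (fun t => (g i).eval t) (uIcc c y) := (g i).continuous.continuousOn
      have := intermediate_value_uIcc hcont (show (0 : ℝ) ∈ uIcc _ _ from
        mem_uIcc.2 (Or.inl ⟨hle, (hy i hi).le⟩))
      obtain ⟨t, ht, ht0⟩ := this
      refine hno t ?_ (hroot i hi t ht0)
      exact (ordConnected_Ioo.uIcc_subset hc ⟨hay, hyb⟩) ht
  · rintro (h | h | ⟨-, y, -, hy⟩)
    · exact exists_forall_pos_of_signTop h
    · obtain ⟨y, hy⟩ := exists_forall_pos_of_signTop (g := fun i => (g i).comp (-X)) h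
      exact ⟨-y, by simpa using hy⟩
    · exact ⟨y, hy⟩

/-- For a sign `σ`, the number `σ + σ ^ 2` is `2` if `σ = 1` and `0` otherwise. The product of these
factors, summed over the roots of `f`, is positive exactly when a suitable root exists; expanded, it
is a sum of Cauchy indices. -/
theorem exists_root_forall_pos_iff {α : Type*} [DecidableEq α] {f : ℝ[X]} (hf : f ≠ 0)
    (G : Finset α) (g : α → ℝ[X]) :
    (∃ y, f.eval y = 0 ∧ ∀ i ∈ G, 0 < (g i).eval y) ↔
      0 < ∑ t ∈ G.powerset, cauchyIndex f
        (derivative f * ((∏ i ∈ t, g i) * ∏ i ∈ G \ t, g i ^ 2)) := by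
  simp only [cauchyIndex_derivative_mul hf]
  rw [Finset.sum_comm]
  have h1 : ∀ a, ∑ t ∈ G.powerset, sgn (((∏ i ∈ t, g i) * ∏ i ∈ G \ t, g i ^ 2).eval a) =
      ∏ i ∈ G, (sgn ((g i).eval a) + sgn ((g i).eval a) ^ 2) := by
    intro a
    have hprod : ∀ (s : Finset α) (h : α → ℝ), sgn (∏ i ∈ s, h i) = ∏ i ∈ s, sgn (h i) := by
      intro s h
      induction s using Finset.induction_on with
      | empty => simp [sgn_one]
      | insert a s ha ih => rw [Finset.prod_insert ha, Finset.prod_insert ha, sgn_mul, ih]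
    rw [Finset.prod_add]
    refine Finset.sum_congr rfl fun t _ => ?_
    simp only [eval_mul, eval_prod, eval_pow, sgn_mul, hprod, sgn_pow]
  simp only [h1]
  have h2 : ∀ a, 0 ≤ ∏ i ∈ G, (sgn ((g i).eval a) + sgn ((g i).eval a) ^ 2) := fun a =>
    Finset.prod_nonneg fun i _ => by
      rcases sgn_mem ((g i).eval a) with h | h | h <;> simp [h]
  have h3 : ∀ a, 0 < ∏ i ∈ G, (sgn ((g i).eval a) + sgn ((g i).eval a) ^ 2) ↔
      ∀ i ∈ G, 0 < (g i).eval a := by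
    intro a
    constructor
    · intro h i hi
      have := Finset.prod_ne_zero_iff.1 h.ne' i hi
      rw [← sgn_eq_one_iff]
      rcases sgn_mem ((g i).eval a) with h | h | h
      · simp [h] at this
      · simp [h] at this
      · exact h
    · intro h
      refine Finset.prod_pos fun i hi => ?_
      rw [sgn_of_pos (h i hi)]; norm_num
  rw [Finset.sum_pos_iff_of_nonneg fun a _ => h2 a]
  simp [h3, hf]

theorem defPred_exists_root_forall_pos {α : Type*} (G : Finset α)
    (f : (MvPolynomial ι ℝ)[X]) (g : α → (MvPolynomial ι ℝ)[X]) :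
    DefPred fun x => spec x f ≠ 0 ∧
      ∃ y, (spec x f).eval y = 0 ∧ ∀ i ∈ G, 0 < (spec x (g i)).eval y := by
  classical
  have h : DefInt fun x => ∑ t ∈ G.powerset, cauchyIndex (spec x f)
      (spec x (derivative f * ((∏ i ∈ t, g i) * ∏ i ∈ G \ t, g i ^ 2))) :=
    DefInt.sum _ fun t _ => defInt_cauchyIndex _ _
  refine ((defPred_spec_eq_zero f).not.and (h.pred (0 < ·))).congr fun x => ?_
  refine and_congr_right fun hx => ?_
  rw [exists_root_forall_pos_iff hx]
  simp [spec, Polynomial.map_mul, Polynomial.map_prod, derivative_map]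

theorem defPred_exists_forall_pos {α : Type*} (G : Finset α) (g : α → (MvPolynomial ι ℝ)[X]) :
    DefPred fun x => ∃ y, ∀ i ∈ G, 0 < (spec x (g i)).eval y := by
  have h := defPred_exists_root_forall_pos G (derivative (∏ i ∈ G, g i)) g
  refine ((DefPred.finset_all G fun i _ => (defInt_signTop (g i)).level 1).or
    ((DefPred.finset_all G fun i _ => (defInt_signBot (g i)).level 1).or h)).congr fun x => ?_
  rw [exists_forall_pos_iff]
  simp only [spec, ← derivative_map, Polynomial.map_prod, ne_eq]

end Polynomial

/-! ### Normal forms and the projection theorem. -/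

namespace Semialg

variable {ι : Type}

/-- `S` is a finite union of sets given by one equation and finitely many strict inequalities. -/
def HasNormalForm (S : Set (ι → ℝ)) : Prop :=
  ∃ L : List (MvPolynomial ι ℝ × List (MvPolynomial ι ℝ)), ∀ x, x ∈ S ↔
    ∃ c ∈ L, MvPolynomial.eval x c.1 = 0 ∧ ∀ g ∈ c.2, 0 < MvPolynomial.eval x g

theorem HasNormalForm.union {S T : Set (ι → ℝ)} (hS : HasNormalForm S) (hT : HasNormalForm T) :
    HasNormalForm (S ∪ T) := by
  obtain ⟨L, hL⟩ := hS
  obtain ⟨L', hL'⟩ := hT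
  refine ⟨L ++ L', fun x => ?_⟩
  simp only [mem_union, hL, hL', List.mem_append, or_and_right, exists_or]

/-- Two equations are merged into one by a sum of squares, so a single equation per piece suffices.
-/
theorem HasNormalForm.inter {S T : Set (ι → ℝ)} (hS : HasNormalForm S) (hT : HasNormalForm T) :
    HasNormalForm (S ∩ T) := by
  obtain ⟨L, hL⟩ := hS
  obtain ⟨L', hL'⟩ := hT
  refine ⟨(L.product L').map fun c => (c.1.1 ^ 2 + c.2.1 ^ 2, c.1.2 ++ c.2.2), fun x => ?_⟩
  rw [mem_inter_iff, hL, hL']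
  have hsq : ∀ a b : ℝ, a ^ 2 + b ^ 2 = 0 ↔ a = 0 ∧ b = 0 := by
    intro a b
    rw [add_eq_zero_iff_of_nonneg (sq_nonneg a) (sq_nonneg b)]; simp
  constructor
  · rintro ⟨⟨c, hc, h1, h2⟩, c', hc', h1', h2'⟩
    refine ⟨_, List.mem_map.2 ⟨(c, c'), List.mem_product.2 ⟨hc, hc'⟩, rfl⟩, ?_, ?_⟩
    · simp [h1, h1']
    · intro g hg
      rcases List.mem_append.1 hg with h | h
      exacts [h2 g h, h2' g h]
  · rintro ⟨d, hd, h1, h2⟩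
    obtain ⟨⟨c, c'⟩, hcc, rfl⟩ := List.mem_map.1 hd
    obtain ⟨hc, hc'⟩ := List.mem_product.1 hcc
    simp only [map_add, map_pow, hsq] at h1
    exact ⟨⟨c, hc, h1.1, fun g hg => h2 g (List.mem_append.2 (Or.inl hg))⟩,
      c', hc', h1.2, fun g hg => h2 g (List.mem_append.2 (Or.inr hg))⟩

theorem hasNormalForm {S : Set (ι → ℝ)} (h : Semialg S) :
    HasNormalForm S ∧ HasNormalForm Sᶜ := by
  induction h with
  | pos p =>
    refine ⟨⟨[(0, [p])], fun x => by simp⟩, ⟨[(p, []), (0, [-p])], fun x => ?_⟩⟩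
    simp only [mem_compl_iff, mem_ofPred_eq, not_lt, List.mem_cons, List.not_mem_nil, or_false,
      exists_eq_or_imp, exists_eq_left, forall_eq, map_zero, map_neg, true_and, false_imp_iff,
      implies_true, and_true, Left.neg_pos_iff]
    rw [le_iff_lt_or_eq, or_comm]
  | compl _ ih => exact ⟨ih.2, by rw [compl_compl]; exact ih.1⟩
  | union _ _ ih ih' =>
    exact ⟨ih.1.union ih'.1, by rw [compl_union]; exact ih.2.inter ih'.2⟩

end Semialg

theorem eval_optionEquivLeft {ι : Type} (z : Option ι → ℝ) (p : MvPolynomial (Option ι) ℝ) :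
    (Polynomial.spec (fun i => z (some i)) (MvPolynomial.optionEquivLeft ℝ ι p)).eval (z none) =
      MvPolynomial.eval z p := by
  induction p using MvPolynomial.induction_on with
  | C r => simp [Polynomial.spec]
  | add p q hp hq =>
    simp only [map_add, Polynomial.spec, Polynomial.map_add, Polynomial.eval_add] at *
    rw [hp, hq]
  | mul_X p n hp =>
    simp only [map_mul, Polynomial.spec, Polynomial.map_mul, Polynomial.eval_mul] at *
    rw [hp]
    cases n <;> simp

/-- The Tarski–Seidenberg theorem. -/
theorem DefPred.exists {ι : Type} {P : (ι → ℝ) → ℝ → Prop}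
    (h : DefPred fun z : Option ι → ℝ => P (fun i => z (some i)) (z none)) :
    DefPred fun x => ∃ y, P x y := by
  classical
  obtain ⟨L, hL⟩ := (Semialg.hasNormalForm h).1
  let Φ := MvPolynomial.optionEquivLeft ℝ ι
  have key : ∀ c ∈ L, DefPred fun x : ι → ℝ => ∃ y, (Polynomial.spec x (Φ c.1)).eval y = 0 ∧
      ∀ g ∈ c.2.toFinset, 0 < (Polynomial.spec x (Φ g)).eval y := by
    intro c _
    refine (((Polynomial.defPred_spec_eq_zero (Φ c.1)).and
      (Polynomial.defPred_exists_forall_pos c.2.toFinset fun g => Φ g)).or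
      (Polynomial.defPred_exists_root_forall_pos c.2.toFinset (Φ c.1) fun g => Φ g)).congr
      fun x => ?_
    -- If the equation degenerates to `0 = 0`, only the inequalities remain; otherwise `y` must be a
    -- root of a nonzero polynomial.
    by_cases hx : Polynomial.spec x (Φ c.1) = 0 <;> simp [hx]
  refine (DefPred.list_ex L key).congr fun x => ?_
  have : ∀ y, P x y ↔ ∃ c ∈ L, (Polynomial.spec x (Φ c.1)).eval y = 0 ∧
      ∀ g ∈ c.2.toFinset, 0 < (Polynomial.spec x (Φ g)).eval y := by
    intro y
    have := hL (fun o => Option.elim o y x)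
    simp only [mem_ofPred_eq, Option.elim] at this
    rw [this]
    simp only [List.mem_toFinset]
    refine exists_congr fun c => and_congr_right fun _ => ?_
    have he : ∀ p, (Polynomial.spec x (Φ p)).eval y =
        MvPolynomial.eval (fun o => Option.elim o y x) p := fun p =>
      eval_optionEquivLeft (fun o => Option.elim o y x) p
    simp only [he]
    rfl
  simp only [this]
  constructor
  · rintro ⟨y, c, hc, h⟩; exact ⟨c, hc, y, h⟩
  · rintro ⟨c, hc, y, h⟩; exact ⟨y, c, hc, h⟩

/-! ### Semialgebraic functions and first-order definability. -/

/-- A real function on `ℝ^ι` is semialgebraic if its graph is. -/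
def DefFun {ι : Type} (f : (ι → ℝ) → ℝ) : Prop :=
  DefPred fun z : Option ι → ℝ => z none = f fun i => z (some i)

namespace DefPred

variable {ι κ : Type}

theorem reindex {P : (ι → ℝ) → Prop} (h : DefPred P) (σ : ι → κ) :
    DefPred fun x : κ → ℝ => P fun i => x (σ i) :=
  (h.comp_poly fun i => MvPolynomial.X (σ i)).congr fun x => by simp

theorem all {P : (ι → ℝ) → ℝ → Prop}
    (h : DefPred fun z : Option ι → ℝ => P (fun i => z (some i)) (z none)) :
    DefPred fun x => ∀ y, P x y :=
  (DefPred.exists (P := fun x y => ¬ P x y) h.not).not.congr fun x => by push Not; rfl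

theorem poly_eq (p q : MvPolynomial ι ℝ) :
    DefPred fun x => MvPolynomial.eval x p = MvPolynomial.eval x q :=
  (poly_eq_zero (p - q)).congr fun x => by simp [sub_eq_zero]

/-- Substituting `f x` amounts to quantifying over a fresh variable bound to the graph of `f`. Every
later composition rule rests on this use of projection. -/
theorem subst {Q : (ι → ℝ) → ℝ → Prop} {f : (ι → ℝ) → ℝ}
    (hQ : DefPred fun z : Option ι → ℝ => Q (fun i => z (some i)) (z none)) (hf : DefFun f) :
    DefPred fun x => Q x (f x) :=
  (DefPred.exists (P := fun x y => y = f x ∧ Q x y) (hf.and hQ)).congr fun x => by simp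

end DefPred

namespace DefFun

variable {ι κ : Type} {f g : (ι → ℝ) → ℝ}

theorem reindex (h : DefFun f) (σ : ι → κ) : DefFun fun x : κ → ℝ => f fun i => x (σ i) :=
  DefPred.reindex h (Option.map σ)

theorem poly (p : MvPolynomial ι ℝ) : DefFun fun x => MvPolynomial.eval x p := by
  refine (DefPred.poly_eq (MvPolynomial.X none) (MvPolynomial.rename some p)).congr fun x => ?_
  rw [MvPolynomial.eval_X, MvPolynomial.eval_rename]; rfl

theorem coord (i : ι) : DefFun fun x : ι → ℝ => x i := by
  simpa using poly (MvPolynomial.X i)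

theorem const (c : ℝ) : DefFun fun _ : ι → ℝ => c := by
  simpa using poly (MvPolynomial.C c)

theorem poly_comp₂ (p : MvPolynomial (Fin 2) ℝ) (hf : DefFun f) (hg : DefFun g) :
    DefFun fun x => MvPolynomial.eval ![f x, g x] p := by
  refine DefPred.subst (ι := Option ι)
    (Q := fun z y => z none = MvPolynomial.eval ![y, g fun i => z (some i)] p)
    (DefPred.subst (ι := Option (Option ι))
      (Q := fun z y => z (some none) = MvPolynomial.eval ![z none, y] p) ?_
      (hg.reindex (fun i => some (some i)))) (hf.reindex some)
  refine (DefPred.poly_eq (MvPolynomial.X (some (some none)))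
    (MvPolynomial.bind₁ ![MvPolynomial.X (some none), MvPolynomial.X none] p)).congr fun x => ?_
  rw [MvPolynomial.eval_X, ← MvPolynomial.aeval_eq_eval x, MvPolynomial.aeval_bind₁,
    ← MvPolynomial.aeval_eq_eval]
  have : ![x (some none), x none] = fun i => (MvPolynomial.aeval x)
      ((![MvPolynomial.X (some none), MvPolynomial.X none] :
        Fin 2 → MvPolynomial (Option (Option (Option ι))) ℝ) i) := by
    funext i; fin_cases i <;> simp
  rw [this]

theorem add (hf : DefFun f) (hg : DefFun g) : DefFun fun x => f x + g x := by
  have := poly_comp₂ (MvPolynomial.X 0 + MvPolynomial.X 1) hf hg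
  simp only [map_add, MvPolynomial.eval_X] at this
  exact this

theorem sub (hf : DefFun f) (hg : DefFun g) : DefFun fun x => f x - g x := by
  have := poly_comp₂ (MvPolynomial.X 0 - MvPolynomial.X 1) hf hg
  simp only [map_sub, MvPolynomial.eval_X] at this
  exact this

theorem mul (hf : DefFun f) (hg : DefFun g) : DefFun fun x => f x * g x := by
  have := poly_comp₂ (MvPolynomial.X 0 * MvPolynomial.X 1) hf hg
  simp only [map_mul, MvPolynomial.eval_X] at this
  exact this

theorem neg (hf : DefFun f) : DefFun fun x => - f x := by
  simpa using (const 0).sub hf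

theorem pow (hf : DefFun f) (n : ℕ) : DefFun fun x => f x ^ n := by
  simpa using poly_comp₂ (MvPolynomial.X 0 ^ n) hf hf

end DefFun

namespace DefPred

variable {ι : Type} {f g : (ι → ℝ) → ℝ}

theorem lt (hf : DefFun f) (hg : DefFun g) : DefPred fun x => f x < g x := by
  refine DefPred.subst (Q := fun _ y => 0 < y) ?_ (hg.sub hf) |>.congr fun x => by simp
  simpa using poly_pos (MvPolynomial.X none : MvPolynomial (Option ι) ℝ)

theorem le (hf : DefFun f) (hg : DefFun g) : DefPred fun x => f x ≤ g x :=
  (lt hg hf).not.congr fun x => by simp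

theorem eq (hf : DefFun f) (hg : DefFun g) : DefPred fun x => f x = g x :=
  ((le hf hg).and (le hg hf)).congr fun _ => le_antisymm_iff

theorem ne (hf : DefFun f) (hg : DefFun g) : DefPred fun x => f x ≠ g x := (eq hf hg).not

end DefPred

/-! ### Tameness in one variable: germs at `0⁺`, generic continuity, monotonicity. -/

/-- Semialgebraic predicates of one real variable. -/
def Def1 (P : ℝ → Prop) : Prop := DefPred fun z : Fin 1 → ℝ => P (z 0)

/-- Semialgebraic relations between two reals. -/
def Def2 (M : ℝ → ℝ → Prop) : Prop := DefPred fun z : Fin 2 → ℝ => M (z 0) (z 1)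

/-- Semialgebraic functions of one real variable. -/
def SAFun (φ : ℝ → ℝ) : Prop := Def2 fun x y => y = φ x

theorem Def2.comp {M : ℝ → ℝ → Prop} (hM : Def2 M) {ι : Type} {f g : (ι → ℝ) → ℝ}
    (hf : DefFun f) (hg : DefFun g) : DefPred fun x => M (f x) (g x) := by
  refine DefPred.subst (Q := fun x y => M y (g x))
    (DefPred.subst (ι := Option ι) (Q := fun z y => M (z none) y) ?_ (hg.reindex some)) hf
  exact DefPred.reindex hM ![some none, none]

theorem Def1.comp {P : ℝ → Prop} (hP : Def1 P) {ι : Type} {f : (ι → ℝ) → ℝ}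
    (hf : DefFun f) : DefPred fun x => P (f x) :=
  DefPred.subst (Q := fun _ y => P y) (DefPred.reindex hP ![none]) hf

theorem SAFun.comp {φ : ℝ → ℝ} (hφ : SAFun φ) {ι : Type} {f : (ι → ℝ) → ℝ}
    (hf : DefFun f) : DefFun fun x => φ (f x) :=
  Def2.comp hφ (hf.reindex some) (DefFun.coord none)

theorem Def2.of_fiber {M : ℝ → ℝ → Prop} (hM : Def2 M) (c : ℝ) : Def1 (M c) :=
  hM.comp (DefFun.const c) (DefFun.coord 0)

theorem Def1.congr {P Q : ℝ → Prop} (h : Def1 P) (hPQ : ∀ x, Q x ↔ P x) : Def1 Q :=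
  DefPred.congr h fun _ => hPQ _

theorem Polynomial.eventually_pos_or_not_pos (q : Polynomial ℝ) :
    (∀ᶠ t in 𝓝[>] (0 : ℝ), 0 < q.eval t) ∨ ∀ᶠ t in 𝓝[>] (0 : ℝ), ¬ 0 < q.eval t := by
  by_cases hq : q = 0
  · right; simp [hq]
  obtain ⟨η, hη, hr⟩ : ∃ η > 0, ∀ t ∈ Ioo (0 : ℝ) η, q.eval t ≠ 0 := by
    have hfin : ({t | q.eval t = 0} \ {0} : Set ℝ).Finite :=
      (Polynomial.finite_setOfPred_isRoot hq).subset sdiff_subset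
    have h0 : ∀ᶠ t in 𝓝 (0 : ℝ), t ∉ ({t | q.eval t = 0} \ {0} : Set ℝ) :=
      hfin.isClosed.isOpen_compl.mem_nhds (by simp)
    obtain ⟨η, hη, h⟩ := Metric.eventually_nhds_iff.1 h0
    refine ⟨η, hη, fun t ht h0 => ?_⟩
    refine h (y := t) (by rw [Real.dist_eq, sub_zero, abs_of_pos ht.1]; exact ht.2) ⟨h0, ht.1.ne'⟩
  have hmem : ∀ᶠ t in 𝓝[>] (0 : ℝ), t ∈ Ioo 0 η := Ioo_mem_nhdsGT hη
  have key : ∀ s ∈ Ioo 0 η, ∀ t ∈ Ioo 0 η, 0 < q.eval s → 0 < q.eval t := by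
    intro s hs t ht h
    by_contra! hle
    obtain ⟨u, hu, hu0⟩ := intermediate_value_uIcc
      (f := fun t => q.eval t) (a := t) (b := s) q.continuous.continuousOn
      (show (0 : ℝ) ∈ uIcc _ _ from mem_uIcc.2 (Or.inl ⟨hle, h.le⟩))
    exact hr u (ordConnected_Ioo.uIcc_subset ht hs hu) hu0
  by_cases h : ∃ s ∈ Ioo 0 η, 0 < q.eval s
  · obtain ⟨s, hs, h⟩ := h
    left; filter_upwards [hmem] with t ht using key s hs t ht h
  · right; filter_upwards [hmem] with t ht h' using h ⟨t, ht, h'⟩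

/-- A one-variable polynomial has constant sign on some interval `(0, η)`, and the dichotomy
survives Boolean operations. -/
theorem Def1.eventually_or {P : ℝ → Prop} (h : Def1 P) :
    (∀ᶠ t in 𝓝[>] (0 : ℝ), P t) ∨ ∀ᶠ t in 𝓝[>] (0 : ℝ), ¬ P t := by
  have main : ∀ S : Set (Fin 1 → ℝ), Semialg S →
      (∀ᶠ t in 𝓝[>] (0 : ℝ), (fun _ => t) ∈ S) ∨ ∀ᶠ t in 𝓝[>] (0 : ℝ), (fun _ => t) ∉ S := by
    intro S hS
    induction hS with
    | pos p =>
      have : ∀ t : ℝ, MvPolynomial.eval (fun _ => t) p =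
          (MvPolynomial.aeval (fun _ => (Polynomial.X : Polynomial ℝ)) p).eval t := by
        intro t
        rw [← Polynomial.coe_aeval_eq_eval, ← MvPolynomial.aeval_eq_eval]
        have := MvPolynomial.comp_aeval (R := ℝ) (σ := Fin 1)
          (fun _ => (Polynomial.X : Polynomial ℝ)) (Polynomial.aeval t)
        have := DFunLike.congr_fun this p
        simpa using this.symm
      simp only [mem_ofPred_eq, this]
      exact Polynomial.eventually_pos_or_not_pos _
    | compl _ ih => simpa [or_comm] using ih
    | union _ _ ih ih' =>
      rcases ih with h | h
      · left; filter_upwards [h] with t ht using Or.inl ht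
      rcases ih' with h' | h'
      · left; filter_upwards [h'] with t ht using Or.inr ht
      · right; filter_upwards [h, h'] with t ht ht' using by simp [ht, ht']
  exact main _ h

theorem Def1.eventually_of_frequently {P : ℝ → Prop} (h : Def1 P)
    (hf : ∃ᶠ t in 𝓝[>] (0 : ℝ), P t) : ∀ᶠ t in 𝓝[>] (0 : ℝ), P t :=
  h.eventually_or.resolve_right hf

theorem eventually_nhdsGT_iff {P : ℝ → Prop} :
    (∀ᶠ t in 𝓝[>] (0 : ℝ), P t) ↔ ∃ η > 0, ∀ t, 0 < t → t < η → P t := by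
  rw [Filter.Eventually, mem_nhdsGT_iff_exists_Ioo_subset]
  simp only [subset_def, mem_Ioo, mem_Ioi, and_imp, gt_iff_lt]
  rfl

/-- Semialgebraic sets, and their complements, are countable unions of closed sets. -/
theorem Semialg.exists_iUnion_isClosed {ι : Type} {S : Set (ι → ℝ)} (h : Semialg S) :
    (∃ K : ℕ → Set (ι → ℝ), (∀ n, IsClosed (K n)) ∧ S = ⋃ n, K n) ∧
    ∃ K : ℕ → Set (ι → ℝ), (∀ n, IsClosed (K n)) ∧ Sᶜ = ⋃ n, K n := by
  induction h with
  | pos p =>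
    have hc : Continuous fun x : ι → ℝ => MvPolynomial.eval x p := MvPolynomial.continuous_eval p
    refine ⟨⟨fun n => {x | 1 / ((n : ℝ) + 1) ≤ MvPolynomial.eval x p},
      fun n => isClosed_le continuous_const hc, ?_⟩,
      ⟨fun _ => {x | MvPolynomial.eval x p ≤ 0}, fun n => isClosed_le hc continuous_const, ?_⟩⟩
    · ext x
      simp only [mem_ofPred_eq, mem_iUnion]
      constructor
      · intro hx
        obtain ⟨n, hn⟩ := exists_nat_one_div_lt hx
        exact ⟨n, hn.le⟩
      · rintro ⟨n, hn⟩
        exact lt_of_lt_of_le (by positivity) hn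
    · ext x; simp
  | compl _ ih => exact ⟨ih.2, by rw [compl_compl]; exact ih.1⟩
  | union _ _ ih ih' =>
    obtain ⟨⟨A, hA, hA'⟩, B, hB, hB'⟩ := ih
    obtain ⟨⟨C, hC, hC'⟩, D, hD, hD'⟩ := ih'
    refine ⟨⟨fun n => A n ∪ C n, fun n => (hA n).union (hC n), ?_⟩,
      ⟨fun n => B n.unpair.1 ∩ D n.unpair.2, fun n => (hB _).inter (hD _), ?_⟩⟩
    · rw [hA', hC', iUnion_union_distrib]
    · rw [compl_union, hB', hD']
      ext x
      simp only [mem_inter_iff, mem_iUnion]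
      constructor
      · rintro ⟨⟨i, hi⟩, j, hj⟩
        exact ⟨Nat.pair i j, by simpa using ⟨hi, hj⟩⟩
      · rintro ⟨n, h1, h2⟩; exact ⟨⟨_, h1⟩, _, h2⟩

/-- A Baire argument: the graph is a countable union of compact sets, whose projections cover the
line. A function with compact graph is continuous, so `φ` is continuous on each projection, and the
interiors of the projections have dense union. -/
theorem SAFun.dense_continuousAt {φ : ℝ → ℝ} (hφ : SAFun φ) : Dense {x | ContinuousAt φ x} := by
  obtain ⟨⟨K, hK, hgraph⟩, -⟩ := Semialg.exists_iUnion_isClosed hφ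
  let A : ℕ → Set (Fin 2 → ℝ) := fun n =>
    K n.unpair.1 ∩ Metric.closedBall 0 n.unpair.2
  have hA : ∀ n, IsCompact (A n) := fun n =>
    (isCompact_closedBall (0 : Fin 2 → ℝ) _).inter_left (hK _)
  have hAg : ∀ n, ∀ z ∈ A n, z 1 = φ (z 0) := by
    intro n z hz
    have : z ∈ {z : Fin 2 → ℝ | z 1 = φ (z 0)} := hgraph ▸ mem_iUnion.2 ⟨_, hz.1⟩
    exact this
  have hcov : ⋃ n, (fun z : Fin 2 → ℝ => z 0) '' A n = univ := by
    refine eq_univ_of_forall fun x => ?_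
    have hx : ![x, φ x] ∈ {z : Fin 2 → ℝ | z 1 = φ (z 0)} := by simp
    rw [hgraph] at hx
    obtain ⟨i, hi⟩ := mem_iUnion.1 hx
    obtain ⟨j, hj⟩ := exists_nat_ge ‖![x, φ x]‖
    exact mem_iUnion.2 ⟨Nat.pair i j, ![x, φ x],
      ⟨by simpa using hi, by simpa [-Matrix.zero_empty] using hj⟩, by simp⟩
  have hc0 : Continuous fun z : Fin 2 → ℝ => z 0 := continuous_apply 0
  have hd := dense_iUnion_interior_of_closed (fun n => ((hA n).image hc0).isClosed) hcov
  refine hd.mono fun x hx => ?_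
  obtain ⟨n, hn⟩ := mem_iUnion.1 hx
  have hcont : ContinuousOn φ ((fun z : Fin 2 → ℝ => z 0) '' A n) := by
    rw [continuousOn_iff_isClosed]
    intro C hC
    refine ⟨(fun z : Fin 2 → ℝ => z 0) '' (A n ∩ {z | z 1 ∈ C}),
      (((hA n).inter_right (hC.preimage (continuous_apply 1))).image hc0).isClosed, ?_⟩
    ext y
    constructor
    · rintro ⟨hy, z, hz, rfl⟩
      refine ⟨⟨z, ⟨hz, ?_⟩, rfl⟩, z, hz, rfl⟩
      simpa [hAg n z hz] using hy
    · rintro ⟨⟨z, ⟨hz, hzC⟩, rfl⟩, -⟩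
      refine ⟨?_, z, hz, rfl⟩
      simpa [hAg n z hz] using hzC
  exact hcont.continuousAt (mem_interior_iff_mem_nhds.1 hn)

theorem SAFun.def1_continuousAt {φ : ℝ → ℝ} (hφ : SAFun φ) : Def1 fun x => ContinuousAt φ x := by
  have h : Def1 fun x => ∀ e, 0 < e → ∃ d, 0 < d ∧ ∀ y, (y < x + d ∧ x < y + d) →
      (φ y < φ x + e ∧ φ x < φ y + e) := by
    refine DefPred.all (DefPred.imp (DefPred.lt (DefFun.const 0) (DefFun.coord _))
      (DefPred.exists (DefPred.and (DefPred.lt (DefFun.const 0) (DefFun.coord _))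
        (DefPred.all (DefPred.imp (DefPred.and ?_ ?_) (DefPred.and ?_ ?_))))))
    · exact DefPred.lt (DefFun.coord _) ((DefFun.coord _).add (DefFun.coord _))
    · exact DefPred.lt (DefFun.coord _) ((DefFun.coord _).add (DefFun.coord _))
    · exact DefPred.lt (hφ.comp (DefFun.coord _))
        ((hφ.comp (DefFun.coord _)).add (DefFun.coord _))
    · exact DefPred.lt (hφ.comp (DefFun.coord _))
        ((hφ.comp (DefFun.coord _)).add (DefFun.coord _))
  refine h.congr fun x => ?_
  rw [Metric.continuousAt_iff]
  have habs : ∀ a b c : ℝ, dist a b < c ↔ a < b + c ∧ b < a + c := by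
    intro a b c; rw [Real.dist_eq, abs_lt]
    constructor <;> rintro ⟨h, h'⟩ <;> constructor <;> linarith
  simp only [habs, gt_iff_lt]

theorem SAFun.eventually_continuousAt {φ : ℝ → ℝ} (hφ : SAFun φ) :
    ∀ᶠ x in 𝓝[>] (0 : ℝ), ContinuousAt φ x := by
  refine hφ.def1_continuousAt.eventually_of_frequently fun h => ?_
  obtain ⟨η, hη, h⟩ := eventually_nhdsGT_iff.1 h
  obtain ⟨x, hx, hx'⟩ := hφ.dense_continuousAt.exists_mem_open isOpen_Ioo
    (nonempty_Ioo.2 hη)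
  exact h x hx'.1 hx'.2 hx

/-- Each local maximum value is the supremum of `φ` over some interval with rational endpoints. -/
theorem countable_image_isLocalMax (φ : ℝ → ℝ) : (φ '' {t | IsLocalMax φ t}).Countable := by
  refine (countable_range fun p : ℚ × ℚ => sSup (φ '' Ioo (p.1 : ℝ) p.2)).mono ?_
  rintro _ ⟨t, ht, rfl⟩
  obtain ⟨d, hd, h⟩ := Metric.eventually_nhds_iff.1 ht
  obtain ⟨p, hp1, hp2⟩ := exists_rat_btwn (show t - d < t by linarith)
  obtain ⟨q, hq1, hq2⟩ := exists_rat_btwn (show t < t + d by linarith)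
  refine ⟨(p, q), ?_⟩
  have : IsGreatest (φ '' Ioo (p : ℝ) q) (φ t) := by
    refine ⟨⟨t, ⟨hp2, hq1⟩, rfl⟩, ?_⟩
    rintro _ ⟨s, hs, rfl⟩
    refine h ?_
    rw [Real.dist_eq, abs_lt]; constructor <;> linarith [hs.1, hs.2]
  exact this.csSup_eq

theorem countable_image_isLocalExtr (φ : ℝ → ℝ) : (φ '' {t | IsLocalExtr φ t}).Countable := by
  have h := countable_image_isLocalMax φ
  have h' := (countable_image_isLocalMax (-φ)).image Neg.neg
  refine (h'.union h).mono ?_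
  rintro _ ⟨t, ht | ht, rfl⟩
  · exact Or.inl ⟨-φ t, ⟨t, ht.neg, rfl⟩, by simp⟩
  · exact Or.inr ⟨t, ht, rfl⟩

theorem SAFun.def1_isLocalExtr {φ : ℝ → ℝ} (hφ : SAFun φ) : Def1 fun x => IsLocalExtr φ x := by
  have h : Def1 fun x => (∃ d, 0 < d ∧ ∀ y, (y < x + d ∧ x < y + d) → φ x ≤ φ y) ∨
      (∃ d, 0 < d ∧ ∀ y, (y < x + d ∧ x < y + d) → φ y ≤ φ x) := by
    refine DefPred.or (DefPred.exists (DefPred.and (DefPred.lt (DefFun.const 0) (DefFun.coord _))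
        (DefPred.all (DefPred.imp (DefPred.and ?_ ?_) ?_))))
      (DefPred.exists (DefPred.and (DefPred.lt (DefFun.const 0) (DefFun.coord _))
        (DefPred.all (DefPred.imp (DefPred.and ?_ ?_) ?_))))
    · exact DefPred.lt (DefFun.coord _) ((DefFun.coord _).add (DefFun.coord _))
    · exact DefPred.lt (DefFun.coord _) ((DefFun.coord _).add (DefFun.coord _))
    · exact DefPred.le (hφ.comp (DefFun.coord _)) (hφ.comp (DefFun.coord _))
    · exact DefPred.lt (DefFun.coord _) ((DefFun.coord _).add (DefFun.coord _))
    · exact DefPred.lt (DefFun.coord _) ((DefFun.coord _).add (DefFun.coord _))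
    · exact DefPred.le (hφ.comp (DefFun.coord _)) (hφ.comp (DefFun.coord _))
  refine h.congr fun x => ?_
  have habs : ∀ a b c : ℝ, dist a b < c ↔ a < b + c ∧ b < a + c := by
    intro a b c; rw [Real.dist_eq, abs_lt]
    constructor <;> rintro ⟨h, h'⟩ <;> constructor <;> linarith
  simp only [IsLocalExtr, IsExtrFilter, IsMinFilter, IsMaxFilter, Metric.eventually_nhds_iff, habs,
    gt_iff_lt]

/-- By the dichotomy, points near `0` are all local extrema or none is. The first case would make
every value in an interval extremal, against countability; in the second, two equal values would
force an extremum between them, so `φ` is injective and, being continuous, monotone. -/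
theorem SAFun.exists_strictMonoOn {φ : ℝ → ℝ} (hφ : SAFun φ) {ε : ℝ} (hε : 0 < ε)
    (hc : ContinuousOn φ (Ico 0 ε)) (h0 : φ 0 = 0) (hpos : ∀ᶠ t in 𝓝[>] (0 : ℝ), 0 < φ t) :
    ∃ η, 0 < η ∧ η < ε ∧ StrictMonoOn φ (Icc 0 η) := by
  obtain ⟨η₁, hη₁, hpos⟩ := eventually_nhdsGT_iff.1 hpos
  rcases hφ.def1_isLocalExtr.eventually_or with h | h <;>
  obtain ⟨η₂, hη₂, h⟩ := eventually_nhdsGT_iff.1 h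
  all_goals
    obtain ⟨η, hη, hlt⟩ : ∃ η > 0, η < min (min η₁ η₂) ε :=
      ⟨min (min η₁ η₂) ε / 2, by positivity, half_lt_self (by positivity)⟩
    simp only [lt_min_iff] at hlt
    have hcI : ContinuousOn φ (Icc 0 η) := hc.mono fun t ht => ⟨ht.1, ht.2.trans_lt hlt.2⟩
  · exfalso
    have hsub : Ioo 0 (φ η) ⊆ φ '' {t | IsLocalExtr φ t} := by
      intro y hy
      have hy' := intermediate_value_Ioo hη.le hcI (by rwa [h0])
      obtain ⟨t, ht, rfl⟩ := hy'
      exact ⟨t, h t ht.1 (ht.2.trans hlt.1.2), rfl⟩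
    have := (countable_image_isLocalExtr φ).mono hsub
    exact (Cardinal.Real.Ioo_countable_iff.1 this).not_gt (hpos η hη hlt.1.1)
  · refine ⟨η, hη, hlt.2, ?_⟩
    have hinj : InjOn φ (Icc 0 η) := by
      have : ∀ a ∈ Icc 0 η, ∀ b ∈ Icc 0 η, a < b → φ a ≠ φ b := by
        intro a ha b hb hab heq
        obtain ⟨c, hc, hext⟩ := exists_isLocalExtr_Ioo hab
          (hcI.mono (Icc_subset_Icc ha.1 hb.2)) heq
        exact h c (ha.1.trans_lt hc.1) (hc.2.trans_le (hb.2.trans hlt.1.2.le)) hext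
      intro a ha b hb heq
      rcases lt_trichotomy a b with h | h | h
      · exact absurd heq (this a ha b hb h)
      · exact h
      · exact absurd heq.symm (this b hb a ha h)
    exact hcI.strictMonoOn_of_injOn_Icc hη.le (by rw [h0]; exact (hpos η hη hlt.1.1).le) hinj

/-! ### Closest points and the medial axis in coordinates. -/

/-- `(a, b)` is a point of `X` closest to `(x, y)`. -/
def Near (X : ℝ → ℝ → Prop) (x y a b : ℝ) : Prop :=
  X a b ∧ ∀ c d, X c d → (a - x) ^ 2 + (b - y) ^ 2 ≤ (c - x) ^ 2 + (d - y) ^ 2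

/-- The medial axis of `X`, in coordinates. -/
def Med (X : ℝ → ℝ → Prop) (x y : ℝ) : Prop :=
  ¬ X x y ∧ ∃ a b c d, Near X x y a b ∧ Near X x y c d ∧ (a ≠ c ∨ b ≠ d)

section Definability

variable {X : ℝ → ℝ → Prop} {ι : Type} {f₁ f₂ f₃ f₄ : (ι → ℝ) → ℝ}

theorem DefPred.near (hX : Def2 X) (h₁ : DefFun f₁) (h₂ : DefFun f₂) (h₃ : DefFun f₃)
    (h₄ : DefFun f₄) : DefPred fun z => Near X (f₁ z) (f₂ z) (f₃ z) (f₄ z) := by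
  refine (hX.comp h₃ h₄).and (DefPred.all (DefPred.all (DefPred.imp
    (hX.comp (DefFun.coord _) (DefFun.coord _)) (DefPred.le ?_ ?_))))
  · exact (((h₃.reindex fun i => some (some i)).sub (h₁.reindex fun i => some (some i))).pow 2).add
      (((h₄.reindex fun i => some (some i)).sub (h₂.reindex fun i => some (some i))).pow 2)
  · exact (((DefFun.coord _).sub (h₁.reindex fun i => some (some i))).pow 2).add
      (((DefFun.coord _).sub (h₂.reindex fun i => some (some i))).pow 2)

theorem Def2.med (hX : Def2 X) : Def2 (Med X) := by
  refine (hX.comp (DefFun.coord _) (DefFun.coord _)).not.and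
    (DefPred.exists (DefPred.exists (DefPred.exists (DefPred.exists (DefPred.and ?_
      (DefPred.and ?_ (DefPred.or ?_ ?_)))))))
  · exact DefPred.near hX (DefFun.coord _) (DefFun.coord _) (DefFun.coord _) (DefFun.coord _)
  · exact DefPred.near hX (DefFun.coord _) (DefFun.coord _) (DefFun.coord _) (DefFun.coord _)
  · exact DefPred.ne (DefFun.coord _) (DefFun.coord _)
  · exact DefPred.ne (DefFun.coord _) (DefFun.coord _)

end Definability

section Nearest

variable {X : ℝ → ℝ → Prop}

/-- The ball about a later point of the segment, with `(a, b)` on its boundary, is internally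
tangent at `(a, b)` to the ball about `(x, y)`, whose interior misses `X`. Algebraically, combining
the two minimality inequalities gives `s * ‖(c, d) - (a, b)‖² ≤ 0`. -/
theorem Near.eq_of_segment {x y a b s c d : ℝ} (h : Near X x y a b) (hs : 0 < s) (hs1 : s ≤ 1)
    (h' : Near X (x + s * (a - x)) (y + s * (b - y)) c d) : c = a ∧ d = b := by
  have h1 := h.2 c d h'.1
  have h2 := h'.2 a b h.1
  have key : (c - a) ^ 2 + (d - b) ^ 2 ≤ 0 := by
    have h3 : s * ((c - a) ^ 2 + (d - b) ^ 2) ≤ 0 := by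
      have := mul_nonneg (sub_nonneg.2 hs1) (sub_nonneg.2 h1)
      nlinarith
    by_contra! hlt
    exact absurd h3 (not_le.2 (mul_pos hs hlt))
  constructor
  · have : (c - a) ^ 2 = 0 := le_antisymm (by nlinarith [sq_nonneg (d - b)]) (sq_nonneg _)
    linarith [pow_eq_zero_iff (two_ne_zero) |>.1 this]
  · have : (d - b) ^ 2 = 0 := le_antisymm (by nlinarith [sq_nonneg (c - a)]) (sq_nonneg _)
    linarith [pow_eq_zero_iff (two_ne_zero) |>.1 this]

theorem Near.not_med {x y a b s : ℝ} (h : Near X x y a b) (hs : 0 < s) (hs1 : s ≤ 1) :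
    ¬ Med X (x + s * (a - x)) (y + s * (b - y)) := by
  rintro ⟨-, c, d, c', d', h1, h2, hne⟩
  obtain ⟨rfl, rfl⟩ := h.eq_of_segment hs hs1 h1
  obtain ⟨rfl, rfl⟩ := h.eq_of_segment hs hs1 h2
  simp at hne

theorem near_of_tendsto (hX : IsClosed {p : ℝ × ℝ | X p.1 p.2}) {x y a b : ℕ → ℝ}
    {x₀ y₀ a₀ b₀ : ℝ} (hx : Tendsto x atTop (𝓝 x₀)) (hy : Tendsto y atTop (𝓝 y₀))
    (ha : Tendsto a atTop (𝓝 a₀)) (hb : Tendsto b atTop (𝓝 b₀))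
    (h : ∀ n, Near X (x n) (y n) (a n) (b n)) : Near X x₀ y₀ a₀ b₀ := by
  refine ⟨?_, fun c d hcd => ?_⟩
  · exact hX.mem_of_tendsto (ha.prodMk_nhds hb) (Eventually.of_forall fun n => (h n).1)
  · exact le_of_tendsto_of_tendsto' (((ha.sub hx).pow 2).add ((hb.sub hy).pow 2))
      (((tendsto_const_nhds.sub hx).pow 2).add ((tendsto_const_nhds.sub hy).pow 2))
      fun n => (h n).2 c d hcd

theorem exists_near_subseq (hX : IsClosed {p : ℝ × ℝ | X p.1 p.2}) {x y a b : ℕ → ℝ}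
    {x₀ y₀ : ℝ} (hx : Tendsto x atTop (𝓝 x₀)) (hy : Tendsto y atTop (𝓝 y₀))
    (h : ∀ n, Near X (x n) (y n) (a n) (b n)) :
    ∃ a₀ b₀, ∃ φ : ℕ → ℕ, StrictMono φ ∧ Tendsto (a ∘ φ) atTop (𝓝 a₀) ∧
      Tendsto (b ∘ φ) atTop (𝓝 b₀) ∧ Near X x₀ y₀ a₀ b₀ := by
  set c := a 0
  set d := b 0
  have hcd : X c d := (h 0).1
  have hlim : Tendsto (fun n => (c - x n) ^ 2 + (d - y n) ^ 2) atTop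
      (𝓝 ((c - x₀) ^ 2 + (d - y₀) ^ 2)) :=
    ((tendsto_const_nhds.sub hx).pow 2).add ((tendsto_const_nhds.sub hy).pow 2)
  obtain ⟨C, hC⟩ := hlim.bddAbove_range
  obtain ⟨Cx, hCx⟩ := hx.abs.bddAbove_range
  obtain ⟨Cy, hCy⟩ := hy.abs.bddAbove_range
  have hb1 : ∀ n, (a n, b n) ∈ Metric.closedBall (0 : ℝ × ℝ) (C + 1 + Cx + Cy) := by
    intro n
    have h1 := (h n).2 c d hcd
    have h2 : (c - x n) ^ 2 + (d - y n) ^ 2 ≤ C := hC ⟨n, rfl⟩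
    have h3 : |x n| ≤ Cx := hCx ⟨n, rfl⟩
    have h4 : |y n| ≤ Cy := hCy ⟨n, rfl⟩
    have hC0 : 0 ≤ C := le_trans (by positivity) h2
    have h5 : |a n - x n| ≤ C + 1 := by
      rw [abs_le]; constructor <;> nlinarith [sq_nonneg (b n - y n)]
    have h6 : |b n - y n| ≤ C + 1 := by
      rw [abs_le]; constructor <;> nlinarith [sq_nonneg (a n - x n)]
    rw [mem_closedBall_zero_iff, Prod.norm_def, Real.norm_eq_abs, Real.norm_eq_abs, max_le_iff]
    rw [abs_le] at h3 h4 h5 h6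
    exact ⟨abs_le.2 ⟨by dsimp only; linarith, by dsimp only; linarith⟩,
      abs_le.2 ⟨by dsimp only; linarith, by dsimp only; linarith⟩⟩
  obtain ⟨⟨a₀, b₀⟩, -, φ, hφ, hlim⟩ :=
    (isCompact_closedBall (0 : ℝ × ℝ) (C + 1 + Cx + Cy)).tendsto_subseq hb1
  have ha := (continuous_fst.tendsto _).comp hlim
  have hb := (continuous_snd.tendsto _).comp hlim
  exact ⟨a₀, b₀, φ, hφ, ha, hb, near_of_tendsto hX (hx.comp hφ.tendsto_atTop)
    (hy.comp hφ.tendsto_atTop) ha hb fun n => h (φ n)⟩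

theorem exists_near (hX : IsClosed {p : ℝ × ℝ | X p.1 p.2}) (hne : ∃ a b, X a b) (x y : ℝ) :
    ∃ a b, Near X x y a b := by
  obtain ⟨c, d, hcd⟩ := hne
  set R := (c - x) ^ 2 + (d - y) ^ 2 with hR
  have hcont : Continuous fun p : ℝ × ℝ => (p.1 - x) ^ 2 + (p.2 - y) ^ 2 := by fun_prop
  have hcomp : IsCompact ({p : ℝ × ℝ | X p.1 p.2} ∩ {p | (p.1 - x) ^ 2 + (p.2 - y) ^ 2 ≤ R}) := by
    refine Metric.isCompact_of_isClosed_isBounded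
      (hX.inter (isClosed_le hcont continuous_const)) ?_
    refine (Metric.isBounded_closedBall (x := (x, y)) (r := R + 1)).subset ?_
    rintro ⟨a, b⟩ ⟨-, hab⟩
    simp only [mem_ofPred_eq] at hab
    rw [Metric.mem_closedBall, Prod.dist_eq, Real.dist_eq, Real.dist_eq, max_le_iff, abs_le, abs_le]
    constructor <;> constructor <;> nlinarith [sq_nonneg (a - x), sq_nonneg (b - y)]
  obtain ⟨⟨a, b⟩, hab, hmin⟩ := hcomp.exists_isMinOn ⟨(c, d), hcd, show (c - x) ^ 2 + (d - y) ^ 2 ≤ R from le_rfl⟩ hcont.continuousOn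
  refine ⟨a, b, hab.1, fun c' d' h' => ?_⟩
  by_cases hle : (c' - x) ^ 2 + (d' - y) ^ 2 ≤ R
  · exact hmin (show (c', d') ∈ _ from ⟨h', hle⟩)
  · exact le_trans hab.2 (not_le.1 hle).le

theorem Med.exists_mem {x y : ℝ} (h : Med X x y) : ∃ a b, X a b := by
  obtain ⟨-, a, b, -, -, h, -⟩ := h
  exact ⟨a, b, h.1⟩

/-- Moving slightly from a medial point towards one of its closest points leaves the medial axis. -/
theorem not_eventually_med (x y : ℝ) : ¬ ∀ᶠ p in 𝓝 (x, y), Med X p.1 p.2 := by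
  intro h
  obtain ⟨-, a, b, -, -, hab, -⟩ := h.self_of_nhds
  have hc : Tendsto (fun s : ℝ => (x + s * (a - x), y + s * (b - y))) (𝓝 0) (𝓝 (x, y)) := by
    have : Continuous fun s : ℝ => (x + s * (a - x), y + s * (b - y)) := by fun_prop
    simpa using this.tendsto 0
  have h1 := (hc.mono_left nhdsWithin_le_nhds : Tendsto _ (𝓝[>] (0 : ℝ)) _).eventually h
  obtain ⟨s, hs, hs0⟩ := (h1.and (Ioo_mem_nhdsGT one_pos)).exists
  exact hab.not_med hs0.1 hs0.2.le hs

end Nearest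

/-! ### Arcs in the closure of the medial axis, and segments that cannot cross them. -/

theorem Def2.exists_uniform {Q : ℝ → ℝ → Prop} (hQ : Def2 Q)
    (h : ∀ᶠ x in 𝓝[>] (0 : ℝ), ∃ e > 0, ∀ s, 0 < s → s < e → Q x s) :
    ∀ᶠ x in 𝓝[>] (0 : ℝ), ∃ e > 0, ∀ᶠ x' in 𝓝 x, ∀ s, 0 < s → s < e → Q x' s := by
  -- The best threshold, capped at `1` so that the supremum exists, is a semialgebraic function of
  -- `x`. At a point where it is continuous and positive, half its value works for all nearby
  -- abscissas.
  let H : ℝ → Set ℝ := fun x => {e | 0 ≤ e ∧ e ≤ 1 ∧ ∀ s, 0 < s → s < e → Q x s}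
  have hH0 : ∀ x, 0 ∈ H x := fun x => ⟨le_rfl, zero_le_one, fun s hs hs' => absurd hs hs'.not_gt⟩
  have hHb : ∀ x, BddAbove (H x) := fun x => ⟨1, fun e he => he.2.1⟩
  have hgr : ∀ x, IsGreatest (H x) (sSup (H x)) := by
    intro x
    refine ⟨⟨le_csSup (hHb x) (hH0 x), csSup_le ⟨0, hH0 x⟩ fun e he => he.2.1, ?_⟩,
      fun e he => le_csSup (hHb x) he⟩
    intro s hs hlt
    obtain ⟨e, he, hse⟩ := exists_lt_of_lt_csSup ⟨0, hH0 x⟩ hlt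
    exact he.2.2 s hs hse
  have hφ : SAFun fun x => sSup (H x) := by
    have h1 : Def2 fun x e => 0 ≤ e ∧ e ≤ 1 ∧ ∀ s, 0 < s → s < e → Q x s := by
      refine DefPred.and (DefPred.le (DefFun.const _) (DefFun.coord _))
        (DefPred.and (DefPred.le (DefFun.coord _) (DefFun.const _)) (DefPred.all
        (DefPred.imp (DefPred.lt (DefFun.const _) (DefFun.coord _)) (DefPred.imp
        (DefPred.lt (DefFun.coord _) (DefFun.coord _)) ?_))))
      exact hQ.comp (DefFun.coord _) (DefFun.coord _)
    have h2 : Def2 fun x y => (0 ≤ y ∧ y ≤ 1 ∧ ∀ s, 0 < s → s < y → Q x s) ∧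
        ∀ e, (0 ≤ e ∧ e ≤ 1 ∧ ∀ s, 0 < s → s < e → Q x s) → e ≤ y :=
      DefPred.and h1 (DefPred.all (DefPred.imp (h1.comp (DefFun.coord (some 0)) (DefFun.coord _))
        (DefPred.le (DefFun.coord _) (DefFun.coord _))))
    refine DefPred.congr h2 fun z => ?_
    constructor
    · intro hz
      rw [hz]
      exact hgr (z 0)
    · intro hz
      exact IsGreatest.unique (s := H (z 0)) hz (hgr _)
  filter_upwards [h, hφ.eventually_continuousAt] with x ⟨e, he, hx⟩ hc
  have hpos : 0 < sSup (H x) := by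
    refine lt_of_lt_of_le (lt_min he one_pos) (le_csSup (hHb x) ?_)
    exact ⟨(lt_min he one_pos).le, min_le_right _ _, fun s hs hs' =>
      hx s hs (hs'.trans_le (min_le_left _ _))⟩
  refine ⟨sSup (H x) / 2, half_pos hpos, ?_⟩
  filter_upwards [hc.eventually (lt_mem_nhds (half_lt_self hpos))] with x' hx' s hs hs'
  exact (hgr x').1.2.2 s hs (hs'.trans hx')

/-- A semialgebraic graph contained in the closure of the medial axis is contained in the medial
axis, up to finitely many points. -/
theorem eventually_med_of_closure {X : ℝ → ℝ → Prop} (hX : Def2 X) {f : ℝ → ℝ} (hf : SAFun f)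
    (h : ∀ᶠ x in 𝓝[>] (0 : ℝ), (x, f x) ∈ closure {p : ℝ × ℝ | Med X p.1 p.2}) :
    ∀ᶠ x in 𝓝[>] (0 : ℝ), Med X x (f x) := by
  have hM := hX.med
  have hD : Def1 fun x => Med X x (f x) :=
    hM.comp (DefFun.coord _) (hf.comp (DefFun.coord _))
  refine hD.eventually_or.resolve_right fun hn => ?_
  have hQ1 : Def2 fun x s => Med X x (f x + s) :=
    hM.comp (DefFun.coord _) ((hf.comp (DefFun.coord _)).add (DefFun.coord _))
  have hQ2 : Def2 fun x s => Med X x (f x - s) :=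
    hM.comp (DefFun.coord _) ((hf.comp (DefFun.coord _)).sub (DefFun.coord _))
  have hQ3 : Def2 fun x s => ¬ Med X x (f x + s) ∧ ¬ Med X x (f x - s) :=
    DefPred.and (DefPred.not hQ1) (DefPred.not hQ2)
  have hdef : ∀ Q : ℝ → ℝ → Prop, Def2 Q →
      Def1 fun x => ∃ e > 0, ∀ s, 0 < s → s < e → Q x s := by
    intro Q hQ
    exact DefPred.exists (DefPred.and (DefPred.lt (DefFun.const _) (DefFun.coord _))
      (DefPred.all (DefPred.imp (DefPred.lt (DefFun.const _) (DefFun.coord _))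
      (DefPred.imp (DefPred.lt (DefFun.coord _) (DefFun.coord _))
      (hQ.comp (DefFun.coord _) (DefFun.coord _))))))
  have hall : ∀ x, (∃ e > 0, ∀ s, 0 < s → s < e → Med X x (f x + s)) ∨
      (∃ e > 0, ∀ s, 0 < s → s < e → Med X x (f x - s)) ∨
      (∃ e > 0, ∀ s, 0 < s → s < e → ¬ Med X x (f x + s) ∧ ¬ Med X x (f x - s)) := by
    intro x
    rcases (hQ1.of_fiber x).eventually_or with h1 | h1
    · exact Or.inl (eventually_nhdsGT_iff.1 h1)
    rcases (hQ2.of_fiber x).eventually_or with h2 | h2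
    · exact Or.inr (Or.inl (eventually_nhdsGT_iff.1 h2))
    · exact Or.inr (Or.inr (eventually_nhdsGT_iff.1 (h1.and h2)))
  have hc := hf.eventually_continuousAt
  have hshift : ∀ x u, ContinuousAt f x → Tendsto (fun p : ℝ × ℝ => p.2 - f p.1)
      (𝓝 (x, f x + u)) (𝓝 u) := by
    intro x u hx
    have : ContinuousAt (fun p : ℝ × ℝ => p.2 - f p.1) (x, f x + u) :=
      continuousAt_snd.sub (ContinuousAt.comp (f := Prod.fst) (g := f) hx continuousAt_fst)
    simpa [ContinuousAt] using this
  -- Medial points immediately above almost every graph point near `0`, uniformly in the abscissa,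
  -- would fill an open set; the same goes for points below.
  rcases (hdef _ hQ1).eventually_or with h1 | h1
  · obtain ⟨x, ⟨e, he, hx⟩, hxc⟩ := ((hQ1.exists_uniform h1).and hc).exists
    refine not_eventually_med (X := X) x (f x + e / 2) ?_
    filter_upwards [(continuous_fst.tendsto (x, f x + e / 2)).eventually hx,
      (hshift x (e / 2) hxc).eventually (Ioo_mem_nhds (half_pos he) (half_lt_self he))] with p hp hp'
    simpa using hp _ hp'.1 hp'.2
  rcases (hdef _ hQ2).eventually_or with h2 | h2
  · obtain ⟨x, ⟨e, he, hx⟩, hxc⟩ := ((hQ2.exists_uniform h2).and hc).exists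
    refine not_eventually_med (X := X) x (f x + -(e / 2)) ?_
    filter_upwards [(continuous_fst.tendsto (x, f x + -(e / 2))).eventually hx,
      (hshift x (-(e / 2)) hxc).eventually (Ioo_mem_nhds (a := -e) (b := 0) (by linarith)
        (by linarith))] with p hp hp'
    simpa using hp (-(p.2 - f p.1)) (by linarith [hp'.2]) (by linarith [hp'.1])
  -- Otherwise no medial point lies just above, just below or on the graph, uniformly near some
  -- abscissa, so a whole neighbourhood of a graph point avoids the medial axis, against `h`.
  · have h3 : ∀ᶠ x in 𝓝[>] (0 : ℝ), ∃ e > 0, ∀ s, 0 < s → s < e →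
        ¬ Med X x (f x + s) ∧ ¬ Med X x (f x - s) := by
      filter_upwards [h1, h2] with x h1 h2 using ((hall x).resolve_left h1).resolve_left h2
    obtain ⟨x, ⟨⟨⟨e, he, hx⟩, hxc⟩, hcl⟩, hn', hx0⟩ := ((((hQ3.exists_uniform h3).and hc).and h).and
      ((eventually_eventually_nhdsWithin.2 hn).and self_mem_nhdsWithin)).exists
    rw [nhdsWithin_eq_nhds.2 (Ioi_mem_nhds hx0)] at hn'
    rw [mem_closure_iff_frequently] at hcl
    refine hcl ?_
    filter_upwards [(continuous_fst.tendsto (x, f x)).eventually hx,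
      (continuous_fst.tendsto (x, f x)).eventually hn',
      (by simpa using hshift x 0 hxc : Tendsto _ (𝓝 (x, f x)) _).eventually (Ioo_mem_nhds (neg_lt_zero.2 he) he)] with p hp hpn hp'
    rcases lt_trichotomy (p.2 - f p.1) 0 with h0 | h0 | h0
    · simpa using (hp (-(p.2 - f p.1)) (by linarith) (by linarith [hp'.1])).2
    · rw [sub_eq_zero] at h0
      simpa [h0] using hpn
    · simpa using (hp _ h0 hp'.2).1

/-- A crossing point would be a medial point on a shortest segment, other than its start. The sign
of `σ` selects the side of the graph, and controlling the two end abscissas is enough by convexity.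
-/
theorem Near.trapped {X : ℝ → ℝ → Prop} {f : ℝ → ℝ} {x₀ σ : ℝ}
    (hf : ∀ x, 0 < x → x < x₀ → ContinuousAt f x) (hM : ∀ x, 0 < x → x < x₀ → Med X x (f x))
    {x y a b : ℝ} (h : Near X x y a b) (hy : 0 < σ * (y - f x)) {s₁ : ℝ} (hs0 : 0 ≤ s₁)
    (hs1 : s₁ ≤ 1) (hx : 0 < x ∧ x < x₀)
    (hx1 : 0 < x + s₁ * (a - x) ∧ x + s₁ * (a - x) < x₀) :
    0 < σ * (y + s₁ * (b - y) - f (x + s₁ * (a - x))) := by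
  have hmem : ∀ s ∈ Icc 0 s₁, x + s * (a - x) ∈ Ioo 0 x₀ := by
    intro s hs
    rcases hs0.eq_or_lt with h0 | h0
    · obtain rfl : s = 0 := le_antisymm (h0 ▸ hs.2) hs.1
      simpa using hx
    have : x + s * (a - x) = (1 - s / s₁) * x + s / s₁ * (x + s₁ * (a - x)) := by
      field_simp; ring
    rw [this]
    exact convex_Ioo 0 x₀ hx hx1 (sub_nonneg.2 ((div_le_one h0).2 hs.2)) (div_nonneg hs.1 hs0)
      (by ring)
  by_contra! hle
  have hcont : ContinuousOn (fun s => σ * (y + s * (b - y) - f (x + s * (a - x)))) (Icc 0 s₁) := by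
    intro s hs
    have h1 := hmem s hs
    have h2 : ContinuousAt (fun s => f (x + s * (a - x))) s :=
      ContinuousAt.comp (f := fun s => x + s * (a - x)) (g := f) (hf _ h1.1 h1.2) (by fun_prop)
    exact ((continuousAt_const.mul ((by fun_prop : ContinuousAt (fun s => y + s * (b - y)) s).sub
      h2))).continuousWithinAt
  obtain ⟨s, hs, hs'⟩ := intermediate_value_Icc' hs0 hcont ⟨hle, by simpa using hy.le⟩
  have hσ : σ ≠ 0 := by rintro rfl; simp at hy
  have hs0' : s ≠ 0 := by
    rintro rfl
    simp only [zero_mul, add_zero] at hs'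
    exact hy.ne' hs'
  have hsp : 0 < s := lt_of_le_of_ne hs.1 hs0'.symm
  have heq : y + s * (b - y) = f (x + s * (a - x)) := by
    rcases mul_eq_zero.1 hs' with h | h
    · exact absurd h hσ
    · linarith
  refine h.not_med hsp (hs.2.trans hs1) ?_
  rw [heq]
  exact hM _ (hmem s hs).1 (hmem s hs).2

/-! ### Wedges bounded by two medial arcs. -/

/-- Two graphs contained in the medial axis of a closed set `X` and tangent at the origin to the
positive `x`-axis, one above the other. -/
structure Wedge (X : ℝ → ℝ → Prop) (f₁ f₂ : ℝ → ℝ) (x₀ : ℝ) : Prop where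
  pos : 0 < x₀
  closed : IsClosed {p : ℝ × ℝ | X p.1 p.2}
  cont₁ : ∀ x, 0 < x → x < x₀ → ContinuousAt f₁ x
  cont₂ : ∀ x, 0 < x → x < x₀ → ContinuousAt f₂ x
  lt : ∀ x, 0 < x → x < x₀ → f₁ x < f₂ x
  med₁ : ∀ x, 0 < x → x < x₀ → Med X x (f₁ x)
  med₂ : ∀ x, 0 < x → x < x₀ → Med X x (f₂ x)
  le₁ : ∀ x, 0 < x → x < x₀ → |f₁ x| ≤ x
  le₂ : ∀ x, 0 < x → x < x₀ → |f₂ x| ≤ x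
  tendsto₁ : Tendsto (fun x => f₁ x / x) (𝓝[>] 0) (𝓝 0)
  tendsto₂ : Tendsto (fun x => f₂ x / x) (𝓝[>] 0) (𝓝 0)

namespace Wedge

variable {X : ℝ → ℝ → Prop} {f₁ f₂ : ℝ → ℝ} {x₀ : ℝ}

theorem trapped (W : Wedge X f₁ f₂ x₀) {x y a b : ℝ} (h : Near X x y a b)
    (hy : f₁ x < y ∧ y < f₂ x) {s : ℝ} (hs0 : 0 ≤ s) (hs1 : s ≤ 1) (hx : 0 < x ∧ x < x₀)
    (hxs : 0 < x + s * (a - x) ∧ x + s * (a - x) < x₀) :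
    f₁ (x + s * (a - x)) < y + s * (b - y) ∧ y + s * (b - y) < f₂ (x + s * (a - x)) := by
  have h1 := h.trapped W.cont₁ W.med₁ (σ := 1) (by linarith) hs0 hs1 hx hxs
  have h2 := h.trapped W.cont₂ W.med₂ (σ := -1) (by linarith) hs0 hs1 hx hxs
  constructor <;> linarith

theorem abs_le_of_mem (W : Wedge X f₁ f₂ x₀) {x y : ℝ} (hx : 0 < x ∧ x < x₀)
    (hy : f₁ x ≤ y ∧ y ≤ f₂ x) : |y| ≤ x :=
  abs_le.2 ⟨(abs_le.1 (W.le₁ x hx.1 hx.2)).1.trans hy.1,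
    hy.2.trans (abs_le.1 (W.le₂ x hx.1 hx.2)).2⟩

/-- A shortest segment to `X` that leaves the wedge backwards passes through its apex. -/
theorem through_apex (W : Wedge X f₁ f₂ x₀) {x y a b : ℝ} (h : Near X x y a b)
    (hy : f₁ x < y ∧ y < f₂ x) (hx : 0 < x ∧ x < x₀) (ha : a ≤ 0) :
    ∃ s, 0 < s ∧ s ≤ 1 ∧ x + s * (a - x) = 0 ∧ y + s * (b - y) = 0 := by
  have hxa : 0 < x - a := by linarith
  refine ⟨x / (x - a), div_pos hx.1 hxa, (div_le_one hxa).2 (by linarith), ?_, ?_⟩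
  · field_simp; ring
  set s₀ := x / (x - a) with hs₀
  have hs₀p : 0 < s₀ := div_pos hx.1 hxa
  have hs₀1 : s₀ ≤ 1 := (div_le_one hxa).2 (by linarith)
  have hs₀e : s₀ * (x - a) = x := by rw [hs₀]; field_simp
  -- Until abscissa `0` is reached the segment is trapped in the wedge, hence in the cone `|y| ≤ x`;
  -- in the limit its ordinate must vanish.
  have hle : ∀ᶠ s in 𝓝[<] s₀, |y + s * (b - y)| ≤ x + s * (a - x) := by
    filter_upwards [Ioo_mem_nhdsLT hs₀p] with s hs
    have h1 : 0 < x + s * (a - x) := by nlinarith [hs.2]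
    have h2 : x + s * (a - x) < x₀ := by nlinarith [hs.1]
    have := W.trapped h hy hs.1.le (hs.2.le.trans hs₀1) hx ⟨h1, h2⟩
    exact W.abs_le_of_mem ⟨h1, h2⟩ ⟨this.1.le, this.2.le⟩
  have hc1 : Tendsto (fun s => |y + s * (b - y)|) (𝓝[<] s₀) (𝓝 |y + s₀ * (b - y)|) :=
    ((by fun_prop : Continuous fun s : ℝ => |y + s * (b - y)|).tendsto s₀).mono_left
      nhdsWithin_le_nhds
  have hc2 : Tendsto (fun s => x + s * (a - x)) (𝓝[<] s₀) (𝓝 (x + s₀ * (a - x))) :=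
    ((by fun_prop : Continuous fun s : ℝ => x + s * (a - x)).tendsto s₀).mono_left
      nhdsWithin_le_nhds
  have := le_of_tendsto_of_tendsto hc1 hc2 hle
  rw [show x + s₀ * (a - x) = 0 by linarith] at this
  exact abs_eq_zero.1 (le_antisymm this (abs_nonneg _))

/-- The origin is at distance at most `√2 * x`, so `a ≤ (1 + √2) * x`. This bound forbids long
forward segments and forces closest points to tend to the apex. -/
theorem near_lt_three_mul {x y a b : ℝ} (h0 : X 0 0) (h : Near X x y a b) (hx : 0 < x)
    (hy : |y| ≤ x) : a < 3 * x := by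
  have h1 := h.2 0 0 h0
  have h2 : y ^ 2 ≤ x ^ 2 := sq_le_sq' (by linarith [(abs_le.1 hy).1]) (abs_le.1 hy).2
  nlinarith [sq_nonneg (b - y)]

/-- A point of `X` in the closed wedge lies in the open wedge. -/
theorem lt_of_le (W : Wedge X f₁ f₂ x₀) {a b : ℝ} (hX : X a b) (ha : 0 < a ∧ a < x₀)
    (hb : f₁ a ≤ b ∧ b ≤ f₂ a) : f₁ a < b ∧ b < f₂ a := by
  constructor
  · refine lt_of_le_of_ne hb.1 ?_
    rintro rfl; exact (W.med₁ a ha.1 ha.2).1 hX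
  · refine lt_of_le_of_ne hb.2 ?_
    rintro rfl; exact (W.med₂ a ha.1 ha.2).1 hX

/-- Limits of points of the closed wedge. -/
theorem mem_of_tendsto (W : Wedge X f₁ f₂ x₀) {a b : ℕ → ℝ} {a₀ b₀ : ℝ}
    (ha : Tendsto a atTop (𝓝 a₀)) (hb : Tendsto b atTop (𝓝 b₀)) (ha₀ : 0 < a₀ ∧ a₀ < x₀)
    (h : ∀ᶠ n in atTop, f₁ (a n) ≤ b n ∧ b n ≤ f₂ (a n)) : f₁ a₀ ≤ b₀ ∧ b₀ ≤ f₂ a₀ :=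
  ⟨le_of_tendsto_of_tendsto ((W.cont₁ a₀ ha₀.1 ha₀.2).tendsto.comp ha) hb (h.mono fun _ h => h.1),
    le_of_tendsto_of_tendsto hb ((W.cont₂ a₀ ha₀.1 ha₀.2).tendsto.comp ha) (h.mono fun _ h => h.2)⟩

/-- A point of the closed wedge has a closest point in the wedge, or its apex. -/
theorem exists_near_mem (W : Wedge X f₁ f₂ x₀) (h0 : X 0 0) {x y : ℝ} (hx : 0 < x) (hx' : 3 * x < x₀)
    (hy : f₁ x ≤ y ∧ y ≤ f₂ x) :
    Near X x y 0 0 ∨ ∃ a b, Near X x y a b ∧ 0 < a ∧ a < x₀ ∧ f₁ a < b ∧ b < f₂ a := by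
  have hx0 : x < x₀ := by linarith
  have hlt := W.lt x hx hx0
  set m := (f₁ x + f₂ x) / 2 with hm
  let u : ℕ → ℝ := fun n => 1 / ((n : ℝ) + 1)
  have hu : Tendsto u atTop (𝓝 0) := tendsto_one_div_add_atTop_nhds_zero_nat
  have hup : ∀ n, 0 < u n := fun n => by positivity
  have hu1 : ∀ n, u n ≤ 1 := fun n => by
    rw [div_le_one (by positivity)]; linarith [(Nat.cast_nonneg n : (0 : ℝ) ≤ n)]
  -- Trapping needs a start in the open wedge, so a possible wall point is approached from the
  -- middle of its vertical fibre.
  let z : ℕ → ℝ := fun n => y + u n * (m - y)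
  have hz : Tendsto z atTop (𝓝 y) := by simpa using (hu.mul_const (m - y)).const_add y
  have hzW : ∀ n, f₁ x < z n ∧ z n < f₂ x := by
    intro n
    have h1 := hup n
    have h2 := hu1 n
    simp only [z]
    constructor <;> nlinarith
  choose a b hab using fun n => exists_near W.closed ⟨0, 0, h0⟩ x (z n)
  have halt : ∀ n, a n < 3 * x := fun n => near_lt_three_mul h0 (hab n) hx
    (W.abs_le_of_mem ⟨hx, hx0⟩ ⟨(hzW n).1.le, (hzW n).2.le⟩)
  have hcase : ∀ n, (a n = 0 ∧ b n = 0) ∨ (0 < a n ∧ f₁ (a n) ≤ b n ∧ b n ≤ f₂ (a n)) := by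
    intro n
    rcases le_or_gt (a n) 0 with ha | ha
    · left
      obtain ⟨s, hs, hs1, e1, e2⟩ := W.through_apex (hab n) (hzW n) ⟨hx, hx0⟩ ha
      -- The segment passes through the origin, which is in `X` and is its own closest point;
      -- uniqueness along the segment makes the origin its endpoint.
      have hself : Near X 0 0 0 0 := ⟨h0, fun c d _ => by simp; positivity⟩
      have := (hab n).eq_of_segment (c := 0) (d := 0) hs hs1 (by rwa [e1, e2])
      exact ⟨this.1.symm, this.2.symm⟩
    · right
      have := W.trapped (hab n) (hzW n) zero_le_one le_rfl ⟨hx, hx0⟩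
        (by simpa using ⟨ha, (halt n).trans hx'⟩)
      simp only [one_mul, add_sub_cancel] at this
      exact ⟨ha, this.1.le, this.2.le⟩
  obtain ⟨a₀, b₀, φ, hφ, ha₀, hb₀, hnear⟩ := exists_near_subseq W.closed tendsto_const_nhds hz hab
  have ha₀0 : 0 ≤ a₀ := ge_of_tendsto' ha₀ fun n => by
    rcases hcase (φ n) with h | h
    · exact h.1.ge
    · exact h.1.le
  rcases ha₀0.eq_or_lt with h | h
  · left
    have hb : b₀ = 0 := by
      have h1 : |b₀| ≤ a₀ := le_of_tendsto_of_tendsto' hb₀.abs ha₀ fun n => by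
        rcases hcase (φ n) with h | h
        · simp [h.1, h.2]
        · exact W.abs_le_of_mem ⟨h.1, (halt _).trans hx'⟩ h.2
      rw [← h] at h1
      exact abs_eq_zero.1 (le_antisymm h1 (abs_nonneg _))
    rwa [← h, hb] at hnear
  · right
    have hlt' : a₀ < x₀ := lt_of_le_of_lt (le_of_tendsto' ha₀ fun n => (halt (φ n)).le) hx'
    refine ⟨a₀, b₀, hnear, h, hlt', W.lt_of_le hnear.1 ⟨h, hlt'⟩
      (W.mem_of_tendsto ha₀ hb₀ ⟨h, hlt'⟩ ?_)⟩
    filter_upwards [ha₀.eventually (lt_mem_nhds h)] with n hn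
    rcases hcase (φ n) with h | h
    · exact absurd h.1 hn.ne'
    · exact h.2

/-- Points in the interior of a triangle inscribed in the Voronoi cell of the origin are not on the
medial axis. -/
theorem not_med_of_triangle {p q x₁ y₁ x₂ y₂ : ℝ} (hp : 0 ≤ p) (hq : 0 ≤ q) (hpq : 0 < p + q)
    (hpq1 : p + q < 1) (h₁ : Near X x₁ y₁ 0 0) (h₂ : Near X x₂ y₂ 0 0) :
    ¬ Med X (p * x₁ + q * x₂) (p * y₁ + q * y₂) := by
  set μ := (p + q)⁻¹ with hμ
  have hμp : 0 < μ := inv_pos.2 hpq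
  have hμe : μ * (p + q) = 1 := inv_mul_cancel₀ hpq.ne'
  -- The Voronoi cell of the origin is cut out by the half-planes `2 * ⟨z, w⟩ ≤ ‖w‖ ^ 2`, `w ∈ X`,
  -- so it contains the normalized combination. The actual point is that one contracted towards the
  -- origin by `p + q < 1`.
  have hnear : Near X (μ * (p * x₁ + q * x₂)) (μ * (p * y₁ + q * y₂)) 0 0 := by
    refine ⟨h₁.1, fun c d hcd => ?_⟩
    have e1 := h₁.2 c d hcd
    have e2 := h₂.2 c d hcd
    have e1' : 2 * (x₁ * c + y₁ * d) ≤ c ^ 2 + d ^ 2 := by nlinarith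
    have e2' : 2 * (x₂ * c + y₂ * d) ≤ c ^ 2 + d ^ 2 := by nlinarith
    have e3 := mul_le_mul_of_nonneg_left e1' (mul_nonneg hμp.le hp)
    have e4 := mul_le_mul_of_nonneg_left e2' (mul_nonneg hμp.le hq)
    have e5 : (μ * p) * (c ^ 2 + d ^ 2) + (μ * q) * (c ^ 2 + d ^ 2) = c ^ 2 + d ^ 2 := by
      rw [← add_mul, ← mul_add, hμe, one_mul]
    nlinarith
  have := hnear.not_med (s := 1 - (p + q)) (by linarith) (by linarith)
  have e : ∀ v : ℝ, μ * v + (1 - (p + q)) * (0 - μ * v) = v := fun v => by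
    linear_combination v * hμe
  rwa [e, e] at this

/-- Fix an abscissa `t`; one has `f₂ t > 0` or `f₁ t < 0`. In the first case tangency puts some
earlier upper wall point below the chord from the origin to `(t, f₂ t)`, yet above the lower wall.
It then lies strictly inside a triangle with vertices the origin and two wall points of the Voronoi
cell, so it is not medial. The other case is symmetric. -/
theorem not_forall_near_apex (W : Wedge X f₁ f₂ x₀)
    (h₁ : ∀ x, 0 < x → x < x₀ → Near X x (f₁ x) 0 0)
    (h₂ : ∀ x, 0 < x → x < x₀ → Near X x (f₂ x) 0 0) : False := by
  obtain ⟨t, ht0, ht⟩ : ∃ t, 0 < t ∧ t < x₀ := ⟨x₀ / 2, half_pos W.pos, half_lt_self W.pos⟩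
  have hlt := W.lt t ht0 ht
  have aux : ∀ {s α y z w : ℝ}, 0 < s → s < t → 0 < α → α < 1 → Near X s y 0 0 →
      Near X t z 0 0 → w = α * y + (1 - α) * (s / t) * z → ¬ Med X s w := by
    intro s α y z w hs hst hα hα1 hy hz hw
    have hr : 0 < s / t := div_pos hs ht0
    have hr1 : s / t < 1 := (div_lt_one ht0).2 hst
    have := not_med_of_triangle (p := α) (q := (1 - α) * (s / t)) hα.le
      (mul_nonneg (by linarith) hr.le) (by nlinarith) (by nlinarith) hy hz
    rwa [show α * s + (1 - α) * (s / t) * t = s by field_simp; ring, ← hw] at this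
  -- Barycentric coordinates of `v` on the vertical segment from the opposite wall `u` to the chord
  -- `B`.
  have e : ∀ B u v : ℝ, B - u ≠ 0 → v = (B - v) / (B - u) * u + (1 - (B - v) / (B - u)) * B := by
    intro B u v h
    field_simp
    ring
  by_cases hpos : 0 < f₂ t
  · obtain ⟨s, hs, hs0, hst⟩ := ((W.tendsto₂.eventually (gt_mem_nhds (div_pos hpos ht0))).and
      (Ioo_mem_nhdsGT ht0)).exists
    have hs' : f₂ s < s / t * f₂ t := by
      rw [div_lt_iff₀ hs0] at hs
      calc f₂ s < f₂ t / t * s := hs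
        _ = _ := by ring
    have hlts := W.lt s hs0 (hst.trans ht)
    have hden : 0 < s / t * f₂ t - f₁ s := by linarith
    refine aux (α := (s / t * f₂ t - f₂ s) / (s / t * f₂ t - f₁ s)) hs0 hst
      (div_pos (by linarith) hden) ((div_lt_one hden).2 (by linarith)) (h₁ s hs0 (hst.trans ht))
      (h₂ t ht0 ht) ?_ (W.med₂ s hs0 (hst.trans ht))
    rw [mul_assoc]
    exact e _ _ _ hden.ne'
  · have hneg : f₁ t < 0 := by linarith
    obtain ⟨s, hs, hs0, hst⟩ := ((W.tendsto₁.eventually (lt_mem_nhds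
      (div_neg_of_neg_of_pos hneg ht0))).and (Ioo_mem_nhdsGT ht0)).exists
    have hs' : s / t * f₁ t < f₁ s := by
      rw [lt_div_iff₀ hs0] at hs
      calc _ = f₁ t / t * s := by ring
        _ < f₁ s := hs
    have hlts := W.lt s hs0 (hst.trans ht)
    have hden : 0 < f₂ s - s / t * f₁ t := by linarith
    refine aux (α := (f₁ s - s / t * f₁ t) / (f₂ s - s / t * f₁ t)) hs0 hst
      (div_pos (by linarith) hden) ((div_lt_one hden).2 (by linarith)) (h₂ s hs0 (hst.trans ht))
      (h₁ t ht0 ht) ?_ (W.med₁ s hs0 (hst.trans ht))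
    rw [mul_assoc, ← neg_div_neg_eq (f₁ s - _), neg_sub, neg_sub]
    exact e _ _ _ (by linarith : s / t * f₁ t - f₂ s < 0).ne

/-! ### The apex of a wedge lies in the set. -/

/-- The apex of a wedge belongs to `X`. -/
theorem apex_mem (W : Wedge X f₁ f₂ x₀) : X 0 0 := by
  by_contra h0
  obtain ⟨p, q, hpq⟩ := exists_near W.closed
    (W.med₁ (x₀ / 2) (half_pos W.pos) (half_lt_self W.pos)).exists_mem 0 0
  have hfar : ∀ c d, X c d → p ^ 2 + q ^ 2 ≤ c ^ 2 + d ^ 2 := fun c d h => by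
    simpa using hpq.2 c d h
  have hr : 0 < p ^ 2 + q ^ 2 := by
    by_contra! hle
    have h1 : p = 0 := by nlinarith [sq_nonneg q, sq_nonneg p]
    have h2 : q = 0 := by nlinarith [sq_nonneg q, sq_nonneg p]
    subst h1 h2
    exact h0 hpq.1
  -- In the cone `|y| ≤ x` with `x ≤ x₁`, squared norms are at most `2 * x₁ ^ 2`, below the squared
  -- distance from the origin to `X`; this part of the wedge contains no point of `X`.
  obtain ⟨x₁, hx₁, hx₁0, hx₁r⟩ : ∃ x₁, 0 < x₁ ∧ x₁ < x₀ ∧ 2 * x₁ ^ 2 < p ^ 2 + q ^ 2 := by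
    have h1 : Tendsto (fun x : ℝ => 2 * x ^ 2) (𝓝[>] 0) (𝓝 0) := by
      have : Continuous fun x : ℝ => 2 * x ^ 2 := by fun_prop
      simpa using (this.tendsto 0).mono_left (nhdsWithin_le_nhds (s := Ioi 0))
    obtain ⟨x, h, hx⟩ := ((h1.eventually (gt_mem_nhds hr)).and (Ioo_mem_nhdsGT W.pos)).exists
    exact ⟨x, hx.1, hx.2, h⟩
  -- the sequence of abscissas
  let t : ℕ → ℝ := fun n => x₁ / ((n : ℝ) + 2)
  have ht0 : ∀ n, 0 < t n := fun n => by positivity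
  have ht1 : ∀ n, t n < x₁ := fun n => by
    rw [div_lt_iff₀ (by positivity)]; nlinarith [(Nat.cast_nonneg n : (0 : ℝ) ≤ n)]
  have htx : ∀ n, t n < x₀ := fun n => (ht1 n).trans hx₁0
  have htlim : Tendsto t atTop (𝓝 0) := by
    have : Tendsto (fun n : ℕ => (n : ℝ) + 2) atTop atTop :=
      tendsto_atTop_add_const_right _ _ tendsto_natCast_atTop_atTop
    exact this.const_div_atTop x₁
  have htlim' : Tendsto t atTop (𝓝[>] 0) :=
    tendsto_nhdsWithin_iff.2 ⟨htlim, Eventually.of_forall ht0⟩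
  have hf₁ := W.tendsto₁.comp htlim'
  have hf₂ := W.tendsto₂.comp htlim'
  -- points inside the wedge
  obtain ⟨y, hy⟩ : ∃ y : ℕ → ℝ, ∀ n, y n ≠ 0 ∧ f₁ (t n) < y n ∧ y n < f₂ (t n) := by
    -- The midpoint of the fibre, unless it is on the axis. Avoiding ordinate `0` is what excludes
    -- backward segments in `hfront`.
    refine ⟨fun n => if f₁ (t n) + f₂ (t n) = 0 then f₂ (t n) / 2 else (f₁ (t n) + f₂ (t n)) / 2,
      fun n => ?_⟩
    have := W.lt (t n) (ht0 n) (htx n)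
    dsimp only
    split_ifs with h
    · refine ⟨?_, ?_, ?_⟩
      · intro h'; linarith
      · linarith
      · linarith
    · refine ⟨?_, ?_, ?_⟩
      · intro h'; exact h (by linarith)
      · linarith
      · linarith
  have hyt : Tendsto (fun n => y n / t n) atTop (𝓝 0) :=
    tendsto_of_tendsto_of_tendsto_of_le_of_le hf₁ hf₂
      (fun n => (div_le_div_iff_of_pos_right (ht0 n)).2 (hy n).2.1.le)
      (fun n => (div_le_div_iff_of_pos_right (ht0 n)).2 (hy n).2.2.le)
  have hylim : Tendsto y atTop (𝓝 0) := by
    have := hyt.mul htlim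
    simp only [mul_zero] at this
    exact this.congr fun n => div_mul_cancel₀ _ (ht0 n).ne'
  choose a b hab using fun n => exists_near W.closed ⟨p, q, hpq.1⟩ (t n) (y n)
  -- A segment not going past `x₁` must run back through the origin, whose closest point `(p, q)` is
  -- then its endpoint. Such starts lie on the line of `(p, q)`; if this recurs, `y n / t n → 0`
  -- forces that line to be the axis, and `y n = 0`.
  have hfront : ∀ᶠ n in atTop, x₁ < a n := by
    by_contra hfr
    rw [not_eventually] at hfr
    have hline : ∃ᶠ n in atTop, y n / t n = q / p := by
      refine hfr.mono fun n hn => ?_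
      rcases le_or_gt (a n) 0 with ha | ha
      · obtain ⟨s, hs, hs1, e1, e2⟩ := W.through_apex (hab n) (hy n).2 ⟨ht0 n, htx n⟩ ha
        obtain ⟨rfl, rfl⟩ := (hab n).eq_of_segment hs hs1 (by rwa [e1, e2])
        have hp0 : a n ≠ 0 := by
          intro h; rw [h] at e1
          have hs' : s = 1 := by nlinarith [ht0 n]
          rw [hs'] at e2
          have : b n = 0 := by linarith
          rw [h, this] at hr; simp at hr
        rw [div_eq_div_iff (ht0 n).ne' hp0]
        have hs1' : s ≠ 1 := by
          rintro rfl; exact hp0 (by linarith)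
        have h3 : (1 - s) * (y n * a n - b n * t n) = 0 := by
          linear_combination a n * e2 - b n * e1
        rcases mul_eq_zero.1 h3 with h | h
        · exact absurd (by linarith) hs1'
        · linarith
      · exfalso
        have hle := not_lt.1 hn
        have ha' := hle.trans_lt hx₁0
        have := W.trapped (hab n) (hy n).2 zero_le_one le_rfl ⟨ht0 n, htx n⟩
          (by simpa using ⟨ha, ha'⟩)
        simp only [one_mul, add_sub_cancel] at this
        have hb := W.abs_le_of_mem ⟨ha, ha'⟩ ⟨this.1.le, this.2.le⟩
        have h1 := hfar _ _ (hab n).1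
        have h2 : b n ^ 2 ≤ a n ^ 2 := sq_le_sq' (by linarith [(abs_le.1 hb).1])
          (abs_le.1 hb).2
        nlinarith
    have hq0 : q / p = 0 := by
      by_contra hne
      exact hline (hyt.eventually_ne (Ne.symm hne))
    obtain ⟨n, hn⟩ := hline.exists
    rw [hq0, div_eq_zero_iff] at hn
    exact hn.elim (hy n).1 (ht0 n).ne'
  obtain ⟨p₁, p₂, φ, hφ, ha, hb, hnear⟩ := exists_near_subseq W.closed htlim hylim hab
  have hp₁ : x₁ ≤ p₁ := ge_of_tendsto ha ((hφ.tendsto_atTop.eventually hfront).mono fun n h => h.le)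
  have hp₁0 : 0 < p₁ := hx₁.trans_le hp₁
  -- The trapped segments converge to the one from the origin to `(p₁, p₂)`, whose initial part thus
  -- lies in the closed wedge; tangency of both walls then gives it slope `0`.
  have hcross : ∀ x, 0 < x → x < x₁ → f₁ x ≤ x * (p₂ / p₁) ∧ x * (p₂ / p₁) ≤ f₂ x := by
    intro x hx hxx
    have hpt : ∀ᶠ n in atTop, t (φ n) < x ∧ x₁ < a (φ n) :=
      hφ.tendsto_atTop.eventually ((htlim.eventually (gt_mem_nhds hx)).and hfront)
    have htφ := htlim.comp hφ.tendsto_atTop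
    have hyφ := hylim.comp hφ.tendsto_atTop
    have hlim : Tendsto (fun n => y (φ n) + (x - t (φ n)) / (a (φ n) - t (φ n)) *
        (b (φ n) - y (φ n))) atTop (𝓝 (x * (p₂ / p₁))) := by
      have := hyφ.add (((tendsto_const_nhds (x := x)).sub htφ).div (ha.sub htφ)
        (by simpa using hp₁0.ne') |>.mul (hb.sub hyφ))
      convert this using 2
      simp; ring
    have hin : ∀ᶠ n in atTop, f₁ x < y (φ n) + (x - t (φ n)) / (a (φ n) - t (φ n)) *
        (b (φ n) - y (φ n)) ∧ y (φ n) + (x - t (φ n)) / (a (φ n) - t (φ n)) *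
        (b (φ n) - y (φ n)) < f₂ x := by
      filter_upwards [hpt] with n hn
      have hden : 0 < a (φ n) - t (φ n) := by linarith [ht1 (φ n)]
      have e : t (φ n) + (x - t (φ n)) / (a (φ n) - t (φ n)) * (a (φ n) - t (φ n)) = x := by
        field_simp; ring
      have := W.trapped (hab (φ n)) (hy (φ n)).2 (s := (x - t (φ n)) / (a (φ n) - t (φ n)))
        (div_nonneg (by linarith) hden.le) ((div_le_one hden).2 (by linarith))
        ⟨ht0 _, htx _⟩ (by rw [e]; exact ⟨hx, hxx.trans hx₁0⟩)
      rwa [e] at this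
    exact ⟨ge_of_tendsto hlim (hin.mono fun n h => h.1.le),
      le_of_tendsto hlim (hin.mono fun n h => h.2.le)⟩
  have hp₂ : p₂ = 0 := by
    have hin : ∀ᶠ x in 𝓝[>] (0 : ℝ), f₁ x / x ≤ p₂ / p₁ ∧ p₂ / p₁ ≤ f₂ x / x := by
      filter_upwards [Ioo_mem_nhdsGT hx₁] with x hx
      rw [div_le_iff₀ hx.1, le_div_iff₀ hx.1, mul_comm]
      exact hcross x hx.1 hx.2
    have := le_antisymm (ge_of_tendsto W.tendsto₂ (hin.mono fun x h => h.2))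
      (le_of_tendsto W.tendsto₁ (hin.mono fun x h => h.1))
    rw [div_eq_zero_iff] at this
    exact this.resolve_right hp₁0.ne'
  -- the lower boundary of the wedge is strictly below the axis
  subst hp₂
  set x₂ := x₁ / 2 with hx₂
  have hx₂0 : 0 < x₂ := half_pos hx₁
  have hx₂1 : x₂ < x₁ := half_lt_self hx₁
  have hneg : f₁ x₂ < 0 := by
    -- Equality would put a medial wall point on the shortest segment from the origin to `(p₁, 0)`.
    refine lt_of_le_of_ne (by simpa using (hcross x₂ hx₂0 hx₂1).1) fun h => ?_
    have h1 := hnear.not_med (s := x₂ / p₁) (by positivity)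
      ((div_le_one hp₁0).2 (by linarith))
    have h2 := W.med₁ x₂ hx₂0 (hx₂1.trans hx₁0)
    rw [h] at h2
    exact h1 (by simpa [hp₁0.ne'] using h2)
  -- points just below the wedge
  let w : ℕ → ℝ := fun n => f₁ (t n) - t n ^ 2
  have hwt : Tendsto (fun n => w n / t n) atTop (𝓝 0) := by
    have := hf₁.sub htlim
    simp only [sub_zero] at this
    refine this.congr fun n => ?_
    simp only [w, Function.comp]
    field_simp [(ht0 n).ne']
  have hwlim : Tendsto w atTop (𝓝 0) := by
    have := hwt.mul htlim
    simp only [mul_zero] at this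
    exact this.congr fun n => div_mul_cancel₀ _ (ht0 n).ne'
  choose a' b' hab' using fun n => exists_near W.closed ⟨p, q, hpq.1⟩ (t n) (w n)
  obtain ⟨c, d, ψ, hψ, hc, hd, hnear'⟩ := exists_near_subseq W.closed htlim hwlim hab'
  have htψ := htlim.comp hψ.tendsto_atTop
  have hwψ := hwlim.comp hψ.tendsto_atTop
  have hnorm : c ^ 2 + d ^ 2 = p₁ ^ 2 := by
    have h1 := hnear.2 c d hnear'.1
    have h2 := hnear'.2 p₁ 0 hnear.1
    simp only [sub_zero] at h1 h2
    linarith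
  -- Comparing distances from `(t, w)` and from the origin to `(p₁, 0)` and `(a', b')` yields `t *
  -- p₁ ≤ t * a' + w * b'`. As `w / t → 0`, the limit point `(c, d)` can only be `(p₁, 0)`.
  have hcp : p₁ ≤ c := by
    have hineq : ∀ n, p₁ ≤ a' (ψ n) + w (ψ n) / t (ψ n) * b' (ψ n) := by
      intro n
      have h1 := (hab' (ψ n)).2 p₁ 0 hnear.1
      have h2 := hnear.2 _ _ (hab' (ψ n)).1
      have h3 : t (ψ n) * p₁ ≤ t (ψ n) * a' (ψ n) + w (ψ n) * b' (ψ n) := by nlinarith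
      have h4 := ht0 (ψ n)
      have h5 : a' (ψ n) + w (ψ n) / t (ψ n) * b' (ψ n) =
          (t (ψ n) * a' (ψ n) + w (ψ n) * b' (ψ n)) / t (ψ n) := by field_simp
      rw [h5, le_div_iff₀ h4]; linarith
    have := hc.add ((hwt.comp hψ.tendsto_atTop).mul hd)
    simp only [zero_mul, add_zero] at this
    exact ge_of_tendsto' this hineq
  have hcp' : c = p₁ := le_antisymm (by nlinarith [sq_nonneg d]) hcp
  have hd0 : d = 0 := by
    rw [hcp'] at hnorm
    have : d ^ 2 = 0 := by linarith
    exact pow_eq_zero_iff two_ne_zero |>.1 this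
  subst hcp' hd0
  -- These segments start below the lower wall and stay below it, yet at abscissa `x₂` they tend to
  -- the axis, which is strictly above that wall: a contradiction.
  have hlim : Tendsto (fun n => w (ψ n) + (x₂ - t (ψ n)) / (a' (ψ n) - t (ψ n)) *
      (b' (ψ n) - w (ψ n))) atTop (𝓝 0) := by
    have := hwψ.add (((tendsto_const_nhds (x := x₂)).sub htψ).div (hc.sub htψ)
      (by simpa using hp₁0.ne') |>.mul (hd.sub hwψ))
    simpa using this
  have hin : ∀ᶠ n in atTop, w (ψ n) + (x₂ - t (ψ n)) / (a' (ψ n) - t (ψ n)) *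
      (b' (ψ n) - w (ψ n)) ≤ f₁ x₂ := by
    filter_upwards [htψ.eventually (gt_mem_nhds hx₂0),
      hc.eventually (lt_mem_nhds (hx₂1.trans_le hp₁))] with n hn hn'
    simp only [Function.comp] at hn hn'
    have hden : 0 < a' (ψ n) - t (ψ n) := by linarith
    have e : t (ψ n) + (x₂ - t (ψ n)) / (a' (ψ n) - t (ψ n)) * (a' (ψ n) - t (ψ n)) = x₂ := by
      field_simp; ring
    have h3 : 0 < -1 * (w (ψ n) - f₁ (t (ψ n))) := by
      simp only [w]; nlinarith [ht0 (ψ n)]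
    have := (hab' (ψ n)).trapped W.cont₁ W.med₁ (σ := -1) h3
      (s₁ := (x₂ - t (ψ n)) / (a' (ψ n) - t (ψ n)))
      (div_nonneg (by linarith) hden.le) ((div_le_one hden).2 (by linarith))
      ⟨ht0 _, htx _⟩ (by rw [e]; exact ⟨hx₂0, hx₂1.trans hx₁0⟩)
    rw [e] at this
    linarith
  exact absurd (le_of_tendsto hlim hin) (not_le.2 hneg)

end Wedge

/-! ### Semialgebraic selection of closest points inside a wedge. -/

namespace Wedge

variable {X : ℝ → ℝ → Prop} {f₁ f₂ : ℝ → ℝ} {x₀ : ℝ}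

/-- The germ of a wedge at its apex. -/
theorem exists_of_eventually (hX : Def2 X) (hXc : IsClosed {p : ℝ × ℝ | X p.1 p.2})
    (h₁ : SAFun f₁) (h₂ : SAFun f₂) (hlt : ∀ᶠ x in 𝓝[>] (0 : ℝ), f₁ x < f₂ x)
    (ht₁ : Tendsto (fun x => f₁ x / x) (𝓝[>] 0) (𝓝 0))
    (ht₂ : Tendsto (fun x => f₂ x / x) (𝓝[>] 0) (𝓝 0))
    (hM₁ : ∀ᶠ x in 𝓝[>] (0 : ℝ), (x, f₁ x) ∈ closure {p : ℝ × ℝ | Med X p.1 p.2})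
    (hM₂ : ∀ᶠ x in 𝓝[>] (0 : ℝ), (x, f₂ x) ∈ closure {p : ℝ × ℝ | Med X p.1 p.2}) :
    ∃ x₀, Wedge X f₁ f₂ x₀ := by
  have habs : ∀ f : ℝ → ℝ, Tendsto (fun x => f x / x) (𝓝[>] 0) (𝓝 0) →
      ∀ᶠ x in 𝓝[>] (0 : ℝ), |f x| ≤ x := by
    intro f hf
    filter_upwards [hf.abs.eventually (gt_mem_nhds (by simp : |(0 : ℝ)| < 1)),
      self_mem_nhdsWithin] with x hx hx0
    rw [abs_div, abs_of_pos (show 0 < x from hx0), div_lt_one hx0] at hx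
    exact hx.le
  obtain ⟨x₀, hx₀, h⟩ := eventually_nhdsGT_iff.1 ((h₁.eventually_continuousAt.and
    h₂.eventually_continuousAt).and (hlt.and ((eventually_med_of_closure hX h₁ hM₁).and
    ((eventually_med_of_closure hX h₂ hM₂).and ((habs _ ht₁).and (habs _ ht₂))))))
  exact ⟨x₀, hx₀, hXc, fun x hx hx' => (h x hx hx').1.1, fun x hx hx' => (h x hx hx').1.2,
    fun x hx hx' => (h x hx hx').2.1, fun x hx hx' => (h x hx hx').2.2.1,
    fun x hx hx' => (h x hx hx').2.2.2.1, fun x hx hx' => (h x hx hx').2.2.2.2.1,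
    fun x hx hx' => (h x hx hx').2.2.2.2.2, ht₁, ht₂⟩

theorem mono (W : Wedge X f₁ f₂ x₀) {x₁ : ℝ} (h0 : 0 < x₁) (h : x₁ ≤ x₀) : Wedge X f₁ f₂ x₁ :=
  ⟨h0, W.closed, fun x hx hx' => W.cont₁ x hx (hx'.trans_le h),
    fun x hx hx' => W.cont₂ x hx (hx'.trans_le h), fun x hx hx' => W.lt x hx (hx'.trans_le h),
    fun x hx hx' => W.med₁ x hx (hx'.trans_le h), fun x hx hx' => W.med₂ x hx (hx'.trans_le h),
    fun x hx hx' => W.le₁ x hx (hx'.trans_le h), fun x hx hx' => W.le₂ x hx (hx'.trans_le h),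
    W.tendsto₁, W.tendsto₂⟩

/-- `(a, b)` is a point of `X` in the open wedge closest to `(x, y)`. -/
def NearIn (X : ℝ → ℝ → Prop) (f₁ f₂ : ℝ → ℝ) (x₀ x y a b : ℝ) : Prop :=
  Near X x y a b ∧ 0 < a ∧ a < x₀ ∧ f₁ a < b ∧ b < f₂ a

theorem defPred_nearIn (hX : Def2 X) (h₁ : SAFun f₁) (h₂ : SAFun f₂) {ι : Type}
    {g₁ g₂ g₃ g₄ : (ι → ℝ) → ℝ} (hg₁ : DefFun g₁) (hg₂ : DefFun g₂) (hg₃ : DefFun g₃)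
    (hg₄ : DefFun g₄) : DefPred fun z => NearIn X f₁ f₂ x₀ (g₁ z) (g₂ z) (g₃ z) (g₄ z) :=
  (DefPred.near hX hg₁ hg₂ hg₃ hg₄).and ((DefPred.lt (DefFun.const 0) hg₃).and
    ((DefPred.lt hg₃ (DefFun.const _)).and
      ((DefPred.lt (h₁.comp hg₃) hg₄).and (DefPred.lt hg₄ (h₂.comp hg₃)))))

/-- By the dichotomy, failure on both walls means failure at every small abscissa; the apex is then
closest to every point of both walls of a shorter wedge, which `not_forall_near_apex` excludes. -/
theorem eventually_exists_nearIn (W : Wedge X f₁ f₂ x₀) (hX : Def2 X) (h₁ : SAFun f₁)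
    (h₂ : SAFun f₂) :
    (∀ᶠ x in 𝓝[>] (0 : ℝ), ∃ a b, NearIn X f₁ f₂ x₀ x (f₁ x) a b) ∨
    ∀ᶠ x in 𝓝[>] (0 : ℝ), ∃ a b, NearIn X f₁ f₂ x₀ x (f₂ x) a b := by
  have h0 := W.apex_mem
  have hd : ∀ f, SAFun f → Def1 fun x => ∃ a b, NearIn X f₁ f₂ x₀ x (f x) a b := by
    intro f hf
    exact DefPred.exists (DefPred.exists (defPred_nearIn hX h₁ h₂ (DefFun.coord _)
      (hf.comp (DefFun.coord _)) (DefFun.coord _) (DefFun.coord _)))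
  rcases (hd f₁ h₁).eventually_or with h | h
  · exact Or.inl h
  rcases (hd f₂ h₂).eventually_or with h' | h'
  · exact Or.inr h'
  exfalso
  obtain ⟨η, hη, h⟩ := eventually_nhdsGT_iff.1 (h.and h')
  have hmin : 0 < min η (x₀ / 3) := lt_min hη (div_pos W.pos (by norm_num))
  have hle : min η (x₀ / 3) ≤ x₀ := (min_le_right _ _).trans (by linarith [W.pos])
  refine (W.mono hmin hle).not_forall_near_apex ?_ ?_
  · intro x hx hx'
    have hx3 : 3 * x < x₀ := by linarith [hx'.trans_le (min_le_right _ _)]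
    have := W.lt x hx (by linarith)
    exact (W.exists_near_mem h0 hx hx3 ⟨le_rfl, this.le⟩).resolve_right
      (h x hx (hx'.trans_le (min_le_left _ _))).1
  · intro x hx hx'
    have hx3 : 3 * x < x₀ := by linarith [hx'.trans_le (min_le_right _ _)]
    have := W.lt x hx (by linarith)
    exact (W.exists_near_mem h0 hx hx3 ⟨this.le, le_rfl⟩).resolve_right
      (h x hx (hx'.trans_le (min_le_left _ _))).2

/-- `(a, b)` is the lexicographically largest point of `X` in the wedge closest to `(x, y)`. -/
def LexMax (X : ℝ → ℝ → Prop) (f₁ f₂ : ℝ → ℝ) (x₀ x y a b : ℝ) : Prop :=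
  NearIn X f₁ f₂ x₀ x y a b ∧ ∀ c d, NearIn X f₁ f₂ x₀ x y c d → c < a ∨ (c = a ∧ d ≤ b)

theorem LexMax.unique {x y a b c d : ℝ} (h : LexMax X f₁ f₂ x₀ x y a b)
    (h' : LexMax X f₁ f₂ x₀ x y c d) : a = c ∧ b = d := by
  rcases h.2 c d h'.1 with h1 | h1 <;> rcases h'.2 a b h.1 with h2 | h2
  · exact absurd h1 h2.not_gt
  · exact absurd h2.1 h1.ne'
  · exact absurd h1.1 h2.ne'
  · exact ⟨h2.1, le_antisymm h2.2 h1.2⟩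

theorem exists_lexMax (W : Wedge X f₁ f₂ x₀) {x y : ℝ} (hx : 0 < x) (hx' : 3 * x < x₀)
    (hy : |y| ≤ x) (h : ∃ a b, NearIn X f₁ f₂ x₀ x y a b) :
    ∃ a b, LexMax X f₁ f₂ x₀ x y a b := by
  obtain ⟨a₀, b₀, hab⟩ := h
  -- The bound `a₀ ≤ p.1` keeps limits away from the apex, `3 * x < x₀` away from the far end, and
  -- the walls contain no point of `X`; hence `K` is compact although the wedge is open.
  let K : Set (ℝ × ℝ) := {p | a₀ ≤ p.1 ∧ NearIn X f₁ f₂ x₀ x y p.1 p.2}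
  have hK3 : ∀ p ∈ K, p.1 < 3 * x := fun p hp => near_lt_three_mul W.apex_mem hp.2.1 hx hy
  have hKc : IsClosed K := by
    refine IsSeqClosed.isClosed fun p q hp hpq => ?_
    have h1 : Tendsto (fun n => (p n).1) atTop (𝓝 q.1) := (continuous_fst.tendsto q).comp hpq
    have h2 : Tendsto (fun n => (p n).2) atTop (𝓝 q.2) := (continuous_snd.tendsto q).comp hpq
    have hn := near_of_tendsto W.closed tendsto_const_nhds tendsto_const_nhds h1 h2
      fun n => (hp n).2.1
    have hge : a₀ ≤ q.1 := ge_of_tendsto' h1 fun n => (hp n).1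
    have hpos : 0 < q.1 := hab.2.1.trans_le hge
    have hlt : q.1 < x₀ := lt_of_le_of_lt (le_of_tendsto' h1 fun n => (hK3 _ (hp n)).le) hx'
    have := W.mem_of_tendsto h1 h2 ⟨hpos, hlt⟩
      (Eventually.of_forall fun n => ⟨(hp n).2.2.2.2.1.le, (hp n).2.2.2.2.2.le⟩)
    exact ⟨hge, hn, hpos, hlt, W.lt_of_le hn.1 ⟨hpos, hlt⟩ this⟩
  have hKcomp : IsCompact K := by
    refine Metric.isCompact_of_isClosed_isBounded hKc
      ((Metric.isBounded_closedBall (x := (0 : ℝ × ℝ)) (r := x₀)).subset fun p hp => ?_)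
    have h1 := W.abs_le_of_mem ⟨hp.2.2.1, hp.2.2.2.1⟩ ⟨hp.2.2.2.2.1.le, hp.2.2.2.2.2.le⟩
    rw [mem_closedBall_zero_iff, Prod.norm_def, Real.norm_eq_abs, Real.norm_eq_abs, max_le_iff,
      abs_of_pos hp.2.2.1]
    exact ⟨hp.2.2.2.1.le, h1.trans hp.2.2.2.1.le⟩
  obtain ⟨p, hp, hpmax⟩ := hKcomp.exists_isMaxOn ⟨(a₀, b₀), le_refl a₀, hab⟩
    continuous_fst.continuousOn
  obtain ⟨q, hq, hqmax⟩ := (hKcomp.inter_right (isClosed_singleton (x := p.1) |>.preimage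
    continuous_fst)).exists_isMaxOn ⟨p, hp, rfl⟩ continuous_snd.continuousOn
  have hqp : q.1 = p.1 := hq.2
  refine ⟨q.1, q.2, hq.1.2, fun c d hcd => ?_⟩
  rcases lt_or_ge c q.1 with hc | hc
  · exact Or.inl hc
  right
  have hmem : (c, d) ∈ K := ⟨hq.1.1.trans hc, hcd⟩
  have hc' : c = q.1 := le_antisymm (hqp ▸ hpmax hmem) hc
  exact ⟨hc', hqmax (show (c, d) ∈ _ from ⟨hmem, by simp [hc', hqp]⟩)⟩

theorem exists_selection (W : Wedge X f₁ f₂ x₀) (hX : Def2 X) (h₁ : SAFun f₁) (h₂ : SAFun f₂)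
    {φ ψ : ℝ → ℝ} (hφ : SAFun φ) (hψ : SAFun ψ)
    (h : ∀ᶠ t in 𝓝[>] (0 : ℝ), 0 < φ t ∧ 3 * φ t < x₀ ∧ |ψ t| ≤ φ t ∧
      ∃ a b, NearIn X f₁ f₂ x₀ (φ t) (ψ t) a b) :
    ∃ A B : ℝ → ℝ, SAFun A ∧ SAFun B ∧ A 0 = 0 ∧ B 0 = 0 ∧
      ∀ᶠ t in 𝓝[>] (0 : ℝ), NearIn X f₁ f₂ x₀ (φ t) (ψ t) (A t) (B t) := by
  classical
  -- Uniqueness of the lexicographic maximum makes the choice definable. Requiring `0 < t` gives the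
  -- selection its default value `0` at `t = 0`.
  let L : ℝ → ℝ → ℝ → Prop := fun t a b => 0 < t ∧ LexMax X f₁ f₂ x₀ (φ t) (ψ t) a b
  have hL : ∀ {ι : Type} (g₁ g₂ g₃ : (ι → ℝ) → ℝ), DefFun g₁ → DefFun g₂ → DefFun g₃ →
      DefPred fun z => L (g₁ z) (g₂ z) (g₃ z) := by
    intro ι g₁ g₂ g₃ hg₁ hg₂ hg₃
    refine (DefPred.lt (DefFun.const 0) hg₁).and
      ((defPred_nearIn hX h₁ h₂ (hφ.comp hg₁) (hψ.comp hg₁) hg₂ hg₃).and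
      (DefPred.all (DefPred.all (DefPred.imp (defPred_nearIn hX h₁ h₂
        ((hφ.comp hg₁).reindex fun i => some (some i))
        ((hψ.comp hg₁).reindex fun i => some (some i)) (DefFun.coord _) (DefFun.coord _))
      (DefPred.or (DefPred.lt (DefFun.coord _) (hg₂.reindex fun i => some (some i)))
      (DefPred.and (DefPred.eq (DefFun.coord _) (hg₂.reindex fun i => some (some i)))
        (DefPred.le (DefFun.coord _) (hg₃.reindex fun i => some (some i)))))))))
  have hex : Def1 fun t => ∃ a b, L t a b :=
    DefPred.exists (DefPred.exists (hL _ _ _ (DefFun.coord _) (DefFun.coord _) (DefFun.coord _)))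
  let A : ℝ → ℝ := fun t => if h : ∃ a b, L t a b then h.choose else 0
  let B : ℝ → ℝ := fun t => if h : ∃ a b, L t a b then h.choose_spec.choose else 0
  have hspec : ∀ t, (∃ a b, L t a b) → L t (A t) (B t) := by
    intro t ht
    simp only [A, B, dif_pos ht]
    exact ht.choose_spec.choose_spec
  have hnot : ∀ t, (¬ ∃ a b, L t a b) → A t = 0 ∧ B t = 0 := by
    intro t ht
    simp only [A, B, dif_neg ht, and_self]
  have h00 : ¬ ∃ a b, L 0 a b := by rintro ⟨a, b, h, -⟩; exact h.false
  refine ⟨A, B, ?_, ?_, (hnot 0 h00).1, (hnot 0 h00).2, ?_⟩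
  · have : Def2 fun t y => (∃ b, L t y b) ∨ (¬ (∃ a b, L t a b) ∧ y = 0) :=
      (DefPred.exists (hL _ _ _ (DefFun.coord _) (DefFun.coord _) (DefFun.coord _))).or
        ((hex.comp (DefFun.coord _)).not.and (DefPred.eq (DefFun.coord _) (DefFun.const 0)))
    refine DefPred.congr this fun z => ?_
    by_cases hz : ∃ a b, L (z 0) a b
    · have hs := hspec _ hz
      simp only [hz, not_true, false_and, or_false]
      constructor
      · intro e; rw [e]; exact ⟨_, hs⟩
      · rintro ⟨b, hb⟩; exact (hb.2.unique hs.2).1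
    · have : ¬ ∃ b, L (z 0) (z 1) b := fun ⟨b, hb⟩ => hz ⟨_, b, hb⟩
      simp [hz, this, (hnot _ hz).1]
  · have : Def2 fun t y => (∃ a, L t a y) ∨ (¬ (∃ a b, L t a b) ∧ y = 0) :=
      (DefPred.exists (hL _ _ _ (DefFun.coord _) (DefFun.coord _) (DefFun.coord _))).or
        ((hex.comp (DefFun.coord _)).not.and (DefPred.eq (DefFun.coord _) (DefFun.const 0)))
    refine DefPred.congr this fun z => ?_
    by_cases hz : ∃ a b, L (z 0) a b
    · have hs := hspec _ hz
      simp only [hz, not_true, false_and, or_false]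
      constructor
      · intro e; rw [e]; exact ⟨_, hs⟩
      · rintro ⟨b, hb⟩; exact (hb.2.unique hs.2).2
    · have : ¬ ∃ a, L (z 0) a (z 1) := fun ⟨a, ha⟩ => hz ⟨a, _, ha⟩
      simp [hz, this, (hnot _ hz).2]
  · filter_upwards [h, self_mem_nhdsWithin] with t ⟨hp, h3, hle, hne⟩ ht
    obtain ⟨a, b, hab⟩ := W.exists_lexMax hp h3 hle hne
    exact (hspec t ⟨a, b, ht, hab⟩).2.1

end Wedge

/-! ### Curves with increasing abscissa as graphs. -/

/-- The curve `(φ, ψ)` parametrizes, over `[0, η]`, the graph of `f` over `[0, φ η]`. -/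
structure GraphCurve (φ ψ f : ℝ → ℝ) (η : ℝ) : Prop where
  pos : 0 < η
  zero : φ 0 = 0
  zero' : ψ 0 = 0
  strictMonoOn : StrictMonoOn φ (Icc 0 η)
  continuousOn : ContinuousOn φ (Icc 0 η)
  eq : ∀ t ∈ Icc 0 η, f (φ t) = ψ t

namespace GraphCurve

variable {φ ψ f : ℝ → ℝ} {η : ℝ}

theorem mono (h : GraphCurve φ ψ f η) {η' : ℝ} (h0 : 0 < η') (hle : η' ≤ η) :
    GraphCurve φ ψ f η' :=
  ⟨h0, h.zero, h.zero', h.strictMonoOn.mono (Icc_subset_Icc_right hle),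
    h.continuousOn.mono (Icc_subset_Icc_right hle),
    fun t ht => h.eq t ⟨ht.1, ht.2.trans hle⟩⟩

theorem phi_pos (h : GraphCurve φ ψ f η) {t : ℝ} (ht : 0 < t) (ht' : t ≤ η) : 0 < φ t := by
  have := h.strictMonoOn ⟨le_rfl, h.pos.le⟩ ⟨ht.le, ht'⟩ ht
  rwa [h.zero] at this

theorem exists_of_saFun (hφ : SAFun φ) (hψ : SAFun ψ) (h0 : φ 0 = 0) (h0' : ψ 0 = 0) {ε : ℝ}
    (hε : 0 < ε) (hc : ContinuousOn φ (Ico 0 ε)) (hpos : ∀ᶠ t in 𝓝[>] (0 : ℝ), 0 < φ t) :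
    ∃ f η, SAFun f ∧ η < ε ∧ GraphCurve φ ψ f η := by
  classical
  obtain ⟨η, hη, hηε, hmono⟩ := hφ.exists_strictMonoOn hε hc h0 hpos
  -- This is `ψ ∘ φ⁻¹` on the image of `[0, η]`, extended by `0`; the choice is harmless since `φ`
  -- is injective there.
  let f : ℝ → ℝ := fun x => if h : ∃ t ∈ Icc 0 η, φ t = x then ψ h.choose else 0
  have hf : ∀ t ∈ Icc 0 η, f (φ t) = ψ t := by
    intro t ht
    have h : ∃ s ∈ Icc 0 η, φ s = φ t := ⟨t, ht, rfl⟩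
    simp only [f, dif_pos h]
    rw [hmono.injOn h.choose_spec.1 ht h.choose_spec.2]
  refine ⟨f, η, ?_, hηε, hη, h0, h0', hmono,
    hc.mono fun t ht => ⟨ht.1, ht.2.trans_lt hηε⟩, hf⟩
  have hd1 : Def2 fun t x => (0 ≤ t ∧ t ≤ η) ∧ φ t = x :=
    ((DefPred.le (DefFun.const _) (DefFun.coord _)).and
      (DefPred.le (DefFun.coord _) (DefFun.const _))).and
      (DefPred.eq (hφ.comp (DefFun.coord _)) (DefFun.coord _))
  have hd : Def2 fun x y => (∃ t, ((0 ≤ t ∧ t ≤ η) ∧ φ t = x) ∧ ψ t = y) ∨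
      (¬ (∃ t, (0 ≤ t ∧ t ≤ η) ∧ φ t = x) ∧ y = 0) :=
    (DefPred.exists ((hd1.comp (DefFun.coord none) (DefFun.coord (some 0))).and
      (DefPred.eq (hψ.comp (DefFun.coord _)) (DefFun.coord _)))).or
    ((DefPred.exists (hd1.comp (DefFun.coord none) (DefFun.coord (some 0)))).not.and
      (DefPred.eq (DefFun.coord _) (DefFun.const _)))
  refine DefPred.congr hd fun z => ?_
  by_cases hz : ∃ t ∈ Icc 0 η, φ t = z 0
  · obtain ⟨t, ht, htz⟩ := hz
    have hz' : ∃ t, (0 ≤ t ∧ t ≤ η) ∧ φ t = z 0 := ⟨t, ht, htz⟩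
    simp only [hz', not_true, false_and, or_false]
    rw [← htz, hf t ht]
    constructor
    · intro h; exact ⟨t, ⟨ht, rfl⟩, h.symm⟩
    · rintro ⟨s, ⟨hs, hst⟩, h⟩
      rw [← h, hmono.injOn hs ht hst]
  · have hz' : ¬ ∃ t, (0 ≤ t ∧ t ≤ η) ∧ φ t = z 0 := fun ⟨t, ht, h⟩ => hz ⟨t, ht, h⟩
    have hz'' : ¬ ∃ t, ((0 ≤ t ∧ t ≤ η) ∧ φ t = z 0) ∧ ψ t = z 1 := fun ⟨t, ht, _⟩ => hz' ⟨t, ht⟩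
    simp [hz', hz'', f]

/-- Statements about small parameters and about small abscissas become interchangeable. -/
theorem map_nhdsGT (h : GraphCurve φ ψ f η) : map φ (𝓝[>] 0) = 𝓝[>] 0 := by
  ext S
  rw [mem_map]
  constructor
  · intro hS
    obtain ⟨d, hd, hS⟩ := eventually_nhdsGT_iff.1 (hS : ∀ᶠ t in 𝓝[>] (0 : ℝ), φ t ∈ S)
    set r := min d η
    have hr : 0 < r := lt_min hd h.pos
    have hc : ContinuousOn φ (Icc 0 r) :=
      h.continuousOn.mono (Icc_subset_Icc_right (min_le_right _ _))
    have hsub : Ioo 0 (φ r) ⊆ S := by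
      intro x hx
      obtain ⟨t, ht, rfl⟩ := intermediate_value_Ioo hr.le hc (by rwa [h.zero])
      exact hS t ht.1 (ht.2.trans_le (min_le_left _ _))
    exact mem_of_superset (Ioo_mem_nhdsGT (h.phi_pos hr (min_le_right _ _))) hsub
  · intro hS
    have hc : Tendsto φ (𝓝[>] 0) (𝓝 0) := by
      have := (h.continuousOn 0 ⟨le_rfl, h.pos.le⟩).tendsto
      rw [h.zero] at this
      refine this.mono_left (nhdsWithin_le_iff.2 ?_)
      exact mem_of_superset (Ioo_mem_nhdsGT h.pos) Ioo_subset_Icc_self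
    have hc' : Tendsto φ (𝓝[>] 0) (𝓝[>] 0) := by
      refine tendsto_nhdsWithin_iff.2 ⟨hc, ?_⟩
      filter_upwards [Ioo_mem_nhdsGT h.pos] with t ht using h.phi_pos ht.1 ht.2.le
    exact hc' hS

theorem eventually_iff (h : GraphCurve φ ψ f η) {P : ℝ → Prop} :
    (∀ᶠ t in 𝓝[>] (0 : ℝ), P (φ t)) ↔ ∀ᶠ x in 𝓝[>] (0 : ℝ), P x := by
  conv_rhs => rw [← h.map_nhdsGT]
  rw [eventually_map]

theorem eventually_eq (h : GraphCurve φ ψ f η) : ∀ᶠ t in 𝓝[>] (0 : ℝ), f (φ t) = ψ t := by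
  filter_upwards [Ioo_mem_nhdsGT h.pos] with t ht using h.eq t ⟨ht.1.le, ht.2.le⟩

theorem tendsto_div (h : GraphCurve φ ψ f η)
    (ht : Tendsto (fun t => ψ t / φ t) (𝓝[>] 0) (𝓝 0)) :
    Tendsto (fun x => f x / x) (𝓝[>] 0) (𝓝 0) := by
  rw [← h.map_nhdsGT, tendsto_map'_iff]
  refine ht.congr' ?_
  filter_upwards [h.eventually_eq] with t ht
  simp [ht]

theorem tendsto_phi (h : GraphCurve φ ψ f η) : Tendsto φ (𝓝[>] 0) (𝓝[>] 0) :=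
  h.map_nhdsGT.le

end GraphCurve

namespace Wedge

variable {X : ℝ → ℝ → Prop} {f₁ f₂ : ℝ → ℝ} {x₀ : ℝ}

/-- The selected closest points form a curve with the parameter of the given wall. Its coordinates
are generically continuous by tameness and continuous at `0` because they are bounded by `3 * φ t`;
monotonicity of the abscissa `A` makes it a graph. -/
theorem exists_branch (W : Wedge X f₁ f₂ x₀) (hX : Def2 X) (h₁ : SAFun f₁) (h₂ : SAFun f₂)
    {φ ψ f : ℝ → ℝ} (hφ : SAFun φ) (hψ : SAFun ψ) {ε : ℝ} (hG : GraphCurve φ ψ f ε)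
    (hf : ∀ᶠ x in 𝓝[>] (0 : ℝ), |f x| ≤ x)
    (h : ∀ᶠ x in 𝓝[>] (0 : ℝ), ∃ a b, NearIn X f₁ f₂ x₀ x (f x) a b) :
    ∃ A B g η, η ≤ ε ∧ SAFun A ∧ SAFun B ∧ GraphCurve A B g η ∧ ContinuousOn B (Icc 0 η) ∧
      ∀ t, 0 < t → t ≤ η → NearIn X f₁ f₂ x₀ (φ t) (ψ t) (A t) (B t) := by
  have hsmall : ∀ᶠ x in 𝓝[>] (0 : ℝ), 0 < x ∧ 3 * x < x₀ := by
    filter_upwards [Ioo_mem_nhdsGT (div_pos W.pos (by norm_num : (0 : ℝ) < 3))] with x hx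
    exact ⟨hx.1, by linarith [hx.2]⟩
  have hall : ∀ᶠ t in 𝓝[>] (0 : ℝ), 0 < φ t ∧ 3 * φ t < x₀ ∧ |ψ t| ≤ φ t ∧
      ∃ a b, NearIn X f₁ f₂ x₀ (φ t) (ψ t) a b := by
    filter_upwards [hG.eventually_eq, hG.eventually_iff.2 (hsmall.and (hf.and h))] with t he ht
    rw [he] at ht
    exact ⟨ht.1.1, ht.1.2, ht.2⟩
  obtain ⟨A, B, hA, hB, hA0, hB0, hAB⟩ := W.exists_selection hX h₁ h₂ hφ hψ hall
  obtain ⟨r, hr, hr'⟩ := eventually_nhdsGT_iff.1 ((hall.and hAB).and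
    (hA.eventually_continuousAt.and hB.eventually_continuousAt))
  have hφ0 : Tendsto (fun t => 3 * φ t) (𝓝[>] 0) (𝓝 0) := by
    simpa using (hG.tendsto_phi.mono_right nhdsWithin_le_nhds).const_mul 3
  have hAlt : ∀ t, 0 < t → t < r → |A t| ≤ 3 * φ t ∧ |B t| ≤ 3 * φ t := by
    intro t ht0 ht
    obtain ⟨⟨h1, h2⟩, -⟩ := hr' t ht0 ht
    have h3 := near_lt_three_mul W.apex_mem h2.1 h1.1 h1.2.2.1
    have h4 := W.abs_le_of_mem ⟨h2.2.1, h2.2.2.1⟩ ⟨h2.2.2.2.1.le, h2.2.2.2.2.le⟩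
    rw [abs_of_pos h2.2.1]
    exact ⟨h3.le, h4.trans h3.le⟩
  have hcont : ∀ F : ℝ → ℝ, F 0 = 0 → (∀ t, 0 < t → t < r → |F t| ≤ 3 * φ t) →
      (∀ t, 0 < t → t < r → ContinuousAt F t) → ContinuousOn F (Ico 0 r) := by
    intro F hF0 hF hFc t ht
    rcases ht.1.eq_or_lt with rfl | h0
    · have h1 : Tendsto F (𝓝[>] 0) (𝓝 (F 0)) := by
        rw [hF0]
        refine squeeze_zero_norm' ?_ hφ0
        filter_upwards [Ioo_mem_nhdsGT hr] with t ht using hF t ht.1 ht.2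
      have h2 : ContinuousWithinAt F (Ici 0) 0 := continuousWithinAt_Ioi_iff_Ici.1 h1
      exact h2.mono Ico_subset_Ici_self
    · exact (hFc t h0 ht.2).continuousWithinAt
  have hAc := hcont A hA0 (fun t h0 h => (hAlt t h0 h).1) fun t h0 h => (hr' t h0 h).2.1
  have hBc := hcont B hB0 (fun t h0 h => (hAlt t h0 h).2) fun t h0 h => (hr' t h0 h).2.2
  obtain ⟨g, η, -, hη, hg⟩ := GraphCurve.exists_of_saFun hA hB hA0 hB0 hr hAc
    (hAB.mono fun t ht => ht.2.1)
  have hmin : 0 < min η ε := lt_min hg.pos hG.pos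
  refine ⟨A, B, g, min η ε, min_le_right _ _, hA, hB, hg.mono hmin (min_le_left _ _),
    hBc.mono fun t ht => ⟨ht.1, (ht.2.trans (min_le_left _ _)).trans_lt hη⟩, fun t h0 ht => ?_⟩
  exact (hr' t h0 ((ht.trans (min_le_left _ _)).trans_lt hη)).1.2

end Wedge

/-! ### From the Euclidean plane to coordinates in an orthonormal frame. -/

theorem IsSemialgebraic.semialg {n : ℕ} {S : Set (EuclideanSpace ℝ (Fin n))}
    (h : IsSemialgebraic S) : Semialg {x : Fin n → ℝ | WithLp.toLp 2 x ∈ S} := by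
  induction h with
  | pos p => exact Semialg.pos p
  | compl _ ih => exact ih.compl
  | union _ _ ih ih' => exact ih.union ih'

theorem Semialg.isSemialgebraic {n : ℕ} {S : Set (Fin n → ℝ)} (h : Semialg S) :
    IsSemialgebraic {x : EuclideanSpace ℝ (Fin n) | (fun i => x i) ∈ S} := by
  induction h with
  | pos p => exact IsSemialgebraic.pos p
  | compl _ ih => exact ih.compl
  | union _ _ ih ih' => exact ih.union ih'

/-- The point of the plane with coordinates `(x, y)` in the orthonormal frame whose first vector is
`(c, s)`. -/
noncomputable def framePoint (c s x y : ℝ) : EuclideanSpace ℝ (Fin 2) :=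
  !₂[c * x - s * y, s * x + c * y]

/-- The coordinates in the orthonormal frame whose first vector is `(c, s)`. -/
noncomputable def frame {c s : ℝ} (h : c ^ 2 + s ^ 2 = 1) :
    EuclideanSpace ℝ (Fin 2) ≃ₗ[ℝ] EuclideanSpace ℝ (Fin 2) where
  toFun p := !₂[c * p 0 + s * p 1, -s * p 0 + c * p 1]
  invFun p := framePoint c s (p 0) (p 1)
  map_add' p q := by ext i; fin_cases i <;> simp <;> ring
  map_smul' a p := by ext i; fin_cases i <;> simp <;> ring
  left_inv p := by
    ext i; fin_cases i <;> simp [framePoint]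
    · linear_combination p 0 * h
    · linear_combination p 1 * h
  right_inv p := by
    ext i; fin_cases i <;> simp [framePoint]
    · linear_combination p 0 * h
    · linear_combination p 1 * h

section Frame

variable {c s : ℝ} (h : c ^ 2 + s ^ 2 = 1)

theorem frame_apply_zero (p : EuclideanSpace ℝ (Fin 2)) :
    frame h p 0 = c * p 0 + s * p 1 := rfl

theorem frame_apply_one (p : EuclideanSpace ℝ (Fin 2)) :
    frame h p 1 = -s * p 0 + c * p 1 := rfl

theorem framePoint_frame (p : EuclideanSpace ℝ (Fin 2)) :
    framePoint c s (frame h p 0) (frame h p 1) = p :=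
  (frame h).left_inv p

theorem frame_framePoint_zero (x y : ℝ) : frame h (framePoint c s x y) 0 = x := by
  rw [frame_apply_zero]; simp [framePoint]; linear_combination x * h

theorem frame_framePoint_one (x y : ℝ) : frame h (framePoint c s x y) 1 = y := by
  rw [frame_apply_one]; simp [framePoint]; linear_combination y * h

theorem continuous_framePoint (c s : ℝ) :
    Continuous fun p : ℝ × ℝ => framePoint c s p.1 p.2 := by
  unfold framePoint; fun_prop

theorem continuous_frame (i : Fin 2) :
    Continuous fun p : EuclideanSpace ℝ (Fin 2) => frame h p i := by
  fin_cases i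
  · simp only [Fin.zero_eta, frame_apply_zero]; fun_prop
  · simp only [Fin.mk_one, frame_apply_one]; fun_prop

theorem norm_sub_sq_frame (p q : EuclideanSpace ℝ (Fin 2)) :
    ‖p - q‖ ^ 2 = (frame h p 0 - frame h q 0) ^ 2 + (frame h p 1 - frame h q 1) ^ 2 := by
  rw [EuclideanSpace.norm_sq_eq, Fin.sum_univ_two]
  simp only [frame_apply_zero, frame_apply_one, Real.norm_eq_abs, sq_abs, PiLp.sub_apply]
  linear_combination (-((p 0 - q 0) ^ 2 + (p 1 - q 1) ^ 2)) * h

theorem framePoint_smul (a x y : ℝ) : a • framePoint c s x y = framePoint c s (a * x) (a * y) := by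
  ext i; fin_cases i <;> simp [framePoint] <;> ring

/-- A subset of the plane, in the coordinates of a frame. -/
def frameSet (c s : ℝ) (X : Set (EuclideanSpace ℝ (Fin 2))) (x y : ℝ) : Prop :=
  framePoint c s x y ∈ X

variable {X : Set (EuclideanSpace ℝ (Fin 2))}

theorem frameSet_frame (p : EuclideanSpace ℝ (Fin 2)) :
    frameSet c s X (frame h p 0) (frame h p 1) ↔ p ∈ X := by
  rw [frameSet, framePoint_frame]

theorem def2_frameSet (c s : ℝ) (hX : IsSemialgebraic X) : Def2 (frameSet c s X) := by
  have := DefPred.comp_poly (R := fun x => WithLp.toLp 2 x ∈ X) (ι := Fin 2) hX.semialg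
    ![MvPolynomial.C c * MvPolynomial.X 0 - MvPolynomial.C s * MvPolynomial.X 1,
      MvPolynomial.C s * MvPolynomial.X 0 + MvPolynomial.C c * MvPolynomial.X 1]
  refine DefPred.congr this fun z => ?_
  have e : framePoint c s (z 0) (z 1) = WithLp.toLp 2 fun k => MvPolynomial.eval z
      ((![MvPolynomial.C c * MvPolynomial.X 0 - MvPolynomial.C s * MvPolynomial.X 1,
      MvPolynomial.C s * MvPolynomial.X 0 + MvPolynomial.C c * MvPolynomial.X 1] :
        Fin 2 → MvPolynomial (Fin 2) ℝ) k) := by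
    ext i; fin_cases i <;> simp [framePoint]
  rw [frameSet, e]

theorem isClosed_frameSet (c s : ℝ) (hX : IsClosed X) :
    IsClosed {p : ℝ × ℝ | frameSet c s X p.1 p.2} :=
  hX.preimage (continuous_framePoint c s)

theorem near_frameSet_iff (p z : EuclideanSpace ℝ (Fin 2)) :
    Near (frameSet c s X) (frame h z 0) (frame h z 1) (frame h p 0) (frame h p 1) ↔
      p ∈ closestPoints X z := by
  constructor
  · rintro ⟨hp, hmin⟩
    rw [frameSet_frame] at hp
    refine ⟨hp, le_antisymm ?_ ?_⟩
    · refine (Metric.le_infDist ⟨p, hp⟩).2 fun q hq => ?_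
      have := hmin _ _ ((frameSet_frame h q).2 hq)
      rw [← norm_sub_sq_frame, ← norm_sub_sq_frame] at this
      rw [dist_comm, dist_eq_norm]
      exact (pow_le_pow_iff_left₀ (norm_nonneg _) (norm_nonneg _) two_ne_zero).1 this
    · rw [← dist_eq_norm, dist_comm]; exact Metric.infDist_le_dist_of_mem hp
  · rintro ⟨hp, hmin⟩
    refine ⟨(frameSet_frame h p).2 hp, fun a b hab => ?_⟩
    have h1 : ‖p - z‖ ≤ ‖framePoint c s a b - z‖ := by
      rw [hmin, ← dist_eq_norm, dist_comm]; exact Metric.infDist_le_dist_of_mem hab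
    have h2 := (pow_le_pow_iff_left₀ (norm_nonneg _) (norm_nonneg _) two_ne_zero).2 h1
    rwa [norm_sub_sq_frame h, norm_sub_sq_frame h, frame_framePoint_zero,
      frame_framePoint_one] at h2

theorem med_of_mem_medialAxis {z : EuclideanSpace ℝ (Fin 2)} (hz : z ∈ medialAxis X) :
    Med (frameSet c s X) (frame h z 0) (frame h z 1) := by
  obtain ⟨hzX, p, hp, q, hq, hne⟩ := hz
  refine ⟨by rwa [frameSet_frame], _, _, _, _, (near_frameSet_iff h p z).2 hp,
    (near_frameSet_iff h q z).2 hq, ?_⟩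
  by_contra! heq
  exact hne (by rw [← framePoint_frame h p, ← framePoint_frame h q, heq.1, heq.2])

theorem mem_closure_med {z : EuclideanSpace ℝ (Fin 2)} (hz : z ∈ closure (medialAxis X)) :
    (frame h z 0, frame h z 1) ∈ closure {p : ℝ × ℝ | Med (frameSet c s X) p.1 p.2} :=
  map_mem_closure (f := fun p => (frame h p 0, frame h p 1))
    ((continuous_frame h 0).prodMk (continuous_frame h 1)) hz
    fun _ hw => med_of_mem_medialAxis h hw

/-- The half-line spanned by `v` is the positive first axis of the frame. -/
structure IsAxis (v : EuclideanSpace ℝ (Fin 2)) : Prop where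
  pos : 0 < frame h v 0
  eq : frame h v 1 = 0

theorem exists_frame {v : EuclideanSpace ℝ (Fin 2)} (hv : v ≠ 0) :
    ∃ (c s : ℝ) (h : c ^ 2 + s ^ 2 = 1), IsAxis h v := by
  have hn : 0 < ‖v‖ := norm_pos_iff.2 hv
  have hsq : v 0 ^ 2 + v 1 ^ 2 = ‖v‖ ^ 2 := by
    rw [EuclideanSpace.norm_sq_eq, Fin.sum_univ_two]; simp
  refine ⟨v 0 / ‖v‖, v 1 / ‖v‖, ?_, ?_, ?_⟩
  · rw [div_pow, div_pow, ← add_div, hsq, div_self (by positivity)]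
  · rw [frame_apply_zero]
    have : v 0 / ‖v‖ * v 0 + v 1 / ‖v‖ * v 1 = ‖v‖ := by
      field_simp; linarith
    rwa [this]
  · rw [frame_apply_one]; ring

theorem IsAxis.mem_halfLine_iff {h : c ^ 2 + s ^ 2 = 1} {v : EuclideanSpace ℝ (Fin 2)}
    (hv : IsAxis h v) (p : EuclideanSpace ℝ (Fin 2)) :
    p ∈ halfLine v ↔ 0 ≤ frame h p 0 ∧ frame h p 1 = 0 := by
  constructor
  · rintro ⟨a, ha, rfl⟩
    simp only [map_smul, PiLp.smul_apply, smul_eq_mul, hv.eq, mul_zero, and_true]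
    exact mul_nonneg ha hv.pos.le
  · rintro ⟨h0, h1⟩
    refine ⟨frame h p 0 / frame h v 0, div_nonneg h0 hv.pos.le, ?_⟩
    have e := framePoint_smul (c := c) (s := s) (frame h p 0 / frame h v 0) (frame h v 0)
      (frame h v 1)
    rw [framePoint_frame, div_mul_cancel₀ _ hv.pos.ne', hv.eq, mul_zero, ← h1,
      framePoint_frame] at e
    exact e.symm

end Frame

/-! ### Semialgebraic curves with a tangent half-line. -/

section Curve

variable {c s : ℝ} {h : c ^ 2 + s ^ 2 = 1} {δ : ℝ → EuclideanSpace ℝ (Fin 2)} {ε : ℝ}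

theorem IsSemialgebraicCurve.defPred_graph (hδ : IsSemialgebraicCurve δ ε) :
    DefPred fun z : Fin 3 → ℝ => z 0 ∈ Ico 0 ε ∧ z 1 = δ (z 0) 0 ∧ z 2 = δ (z 0) 1 := by
  have := hδ.semialgebraic.semialg
  refine DefPred.congr this fun z => ?_
  simp [Fin.forall_fin_two]

/-- The curve `δ` on `[0, ε)` has coordinates `φ` and `ψ`. -/
structure HasCoords (h : c ^ 2 + s ^ 2 = 1) (δ : ℝ → EuclideanSpace ℝ (Fin 2)) (ε : ℝ)
    (φ ψ : ℝ → ℝ) : Prop where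
  fst : ∀ t ∈ Ico 0 ε, frame h (δ t) 0 = φ t
  snd : ∀ t ∈ Ico 0 ε, frame h (δ t) 1 = ψ t

theorem HasCoords.eq_framePoint {φ ψ : ℝ → ℝ} (H : HasCoords h δ ε φ ψ) {t : ℝ}
    (ht : t ∈ Ico 0 ε) : δ t = framePoint c s (φ t) (ψ t) := by
  rw [← H.fst t ht, ← H.snd t ht, framePoint_frame]

theorem IsSemialgebraicCurve.exists_coords (h : c ^ 2 + s ^ 2 = 1)
    (hδ : IsSemialgebraicCurve δ ε) :
    ∃ φ ψ, SAFun φ ∧ SAFun ψ ∧ HasCoords h δ ε φ ψ := by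
  classical
  have key : ∀ a b : ℝ, SAFun fun t => if t ∈ Ico 0 ε then a * δ t 0 + b * δ t 1 else 0 := by
    intro a b
    have hg : DefPred fun z : Option (Option (Fin 2)) → ℝ => z (some (some 0)) ∈ Ico 0 ε ∧
        z (some none) = δ (z (some (some 0))) 0 ∧ z none = δ (z (some (some 0))) 1 :=
      hδ.defPred_graph.reindex ![some (some 0), some none, none]
    have hd : Def2 fun t y => (∃ p q, (t ∈ Ico 0 ε ∧ p = δ t 0 ∧ q = δ t 1) ∧ y = a * p + b * q) ∨
        (¬ (0 ≤ t ∧ t < ε) ∧ y = 0) :=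
      (DefPred.exists (DefPred.exists (hg.and (DefPred.eq (DefFun.coord _)
        (((DefFun.const a).mul (DefFun.coord _)).add
          ((DefFun.const b).mul (DefFun.coord _))))))).or
      (((DefPred.le (DefFun.const 0) (DefFun.coord _)).and
        (DefPred.lt (DefFun.coord _) (DefFun.const ε))).not.and
        (DefPred.eq (DefFun.coord _) (DefFun.const 0)))
    refine DefPred.congr hd fun z => ?_
    by_cases hz : 0 ≤ z 0 ∧ z 0 < ε <;> simp [hz]
  refine ⟨_, _, key c s, key (-s) c, fun t ht => ?_, fun t ht => ?_⟩
  · rw [if_pos ht]; rfl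
  · rw [if_pos ht]; rfl

theorem IsSemialgebraicCurve.continuousOn_coord (hδ : IsSemialgebraicCurve δ ε)
    (h : c ^ 2 + s ^ 2 = 1) (i : Fin 2) {φ : ℝ → ℝ} (hφ : ∀ t ∈ Ico 0 ε, frame h (δ t) i = φ t) :
    ContinuousOn φ (Ico 0 ε) :=
  ((continuous_frame h i).comp_continuousOn hδ.continuousOn).congr fun t ht => (hφ t ht).symm

theorem eventually_mem_Ico {ε : ℝ} (hε : 0 < ε) : ∀ᶠ t in 𝓝[>] (0 : ℝ), t ∈ Ico 0 ε := by
  filter_upwards [Ioo_mem_nhdsGT hε] with t ht using ⟨ht.1.le, ht.2⟩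

theorem HasTangent.eventually_ne_zero {v : EuclideanSpace ℝ (Fin 2)} (hv : v ≠ 0)
    (hl : HasTangent δ (halfLine v)) (h0 : δ 0 = 0) : ∃ᶠ t in 𝓝[>] (0 : ℝ), δ t ≠ 0 := by
  intro hn
  simp only [not_not] at hn
  obtain ⟨r, hr, hn⟩ := eventually_nhdsGT_iff.1 hn
  obtain ⟨η, hη, hηr⟩ := (Eventually.and hl (Ioo_mem_nhdsGT hr)).exists
  have hvm : v ∈ peanoTangentCone (δ '' Ico 0 η) 0 := by
    rw [hη]; exact ⟨1, zero_le_one, (one_smul _ _).symm⟩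
  obtain ⟨x, a, hx, -, -, hlim⟩ := hvm
  have hx0 : ∀ k, x k = 0 := by
    intro k
    obtain ⟨t, ht, htx⟩ := hx k
    rcases ht.1.eq_or_lt with h | h
    · rw [← htx, ← h, h0]
    · rw [← htx, hn t h (ht.2.trans hηr.2)]
  simp only [hx0, sub_zero, smul_zero] at hlim
  exact hv (tendsto_nhds_unique hlim tendsto_const_nhds)

/-- If the cone condition failed, it would fail for all small parameters, and the unit directions of
such points would accumulate at a unit vector `w` of the tangent cone with `κ * w₀ ≤ |w₁|`. On the
half-line `w₁ = 0` and `w₀ ≥ 0`, so `w = 0`, which is absurd. -/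
theorem HasTangent.eventually_abs_le {v : EuclideanSpace ℝ (Fin 2)} (hv : IsAxis h v)
    (hl : HasTangent δ (halfLine v)) (hδ : IsSemialgebraicCurve δ ε) {φ ψ : ℝ → ℝ}
    (hφ : SAFun φ) (hψ : SAFun ψ) (H : HasCoords h δ ε φ ψ)
    (hne : ∀ᶠ t in 𝓝[>] (0 : ℝ), δ t ≠ 0) {κ : ℝ} (hκ : 0 < κ) :
    ∀ᶠ t in 𝓝[>] (0 : ℝ), |ψ t| ≤ κ * φ t := by
  have hd : Def1 fun t => ψ t ≤ κ * φ t ∧ - ψ t ≤ κ * φ t :=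
    (DefPred.le (hψ.comp (DefFun.coord _)) ((DefFun.const κ).mul (hφ.comp (DefFun.coord _)))).and
    (DefPred.le (hψ.comp (DefFun.coord _)).neg ((DefFun.const κ).mul (hφ.comp (DefFun.coord _))))
  rcases hd.eventually_or with h1 | h1
  · filter_upwards [h1] with t ht using abs_le.2 ⟨by linarith [ht.2], ht.1⟩
  exfalso
  obtain ⟨η, ⟨hη, hη0⟩, hηε⟩ := ((Eventually.and hl self_mem_nhdsWithin).and
    (Ioo_mem_nhdsGT hδ.pos)).exists
  have hη0 : 0 < η := hη0
  obtain ⟨t, ht, ht'⟩ : ∃ t : ℕ → ℝ, Tendsto t atTop (𝓝[>] 0) ∧ ∀ k, t k ∈ Ioo 0 η ∧ δ (t k) ≠ 0 ∧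
      ¬ (ψ (t k) ≤ κ * φ (t k) ∧ - ψ (t k) ≤ κ * φ (t k)) :=
    exists_seq_forall_of_frequently
      (Eventually.and (Ioo_mem_nhdsGT hη0) (hne.and h1)).frequently
  have hmem : ∀ k, t k ∈ Ico 0 ε := fun k => ⟨(ht' k).1.1.le, (ht' k).1.2.trans hηε.2⟩
  have hpos : ∀ k, 0 < ‖δ (t k)‖⁻¹ := fun k => inv_pos.2 (norm_pos_iff.2 (ht' k).2.1)
  have hsph : ∀ k, ‖δ (t k)‖⁻¹ • δ (t k) ∈ Metric.sphere (0 : EuclideanSpace ℝ (Fin 2)) 1 := by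
    intro k
    rw [mem_sphere_zero_iff_norm, norm_smul, norm_inv, norm_norm,
      inv_mul_cancel₀ (norm_ne_zero_iff.2 (ht' k).2.1)]
  obtain ⟨w, hw, θ, hθ, hlim⟩ := (isCompact_sphere _ _).tendsto_subseq hsph
  have hδ0 : Tendsto (fun k => δ (t k)) atTop (𝓝 0) := by
    have h2 : Tendsto δ (𝓝[Ico 0 ε] 0) (𝓝 (δ 0)) := hδ.continuousOn 0 ⟨le_rfl, hδ.pos⟩
    rw [hδ.map_zero] at h2
    exact h2.comp (tendsto_nhdsWithin_iff.2 ⟨ht.mono_right nhdsWithin_le_nhds,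
      Eventually.of_forall hmem⟩)
  have hwm : w ∈ peanoTangentCone (δ '' Ico 0 η) 0 := by
    refine ⟨fun k => δ (t (θ k)), fun k => ‖δ (t (θ k))‖⁻¹, fun k =>
      ⟨_, ⟨(ht' _).1.1.le, (ht' _).1.2⟩, rfl⟩, fun k => hpos _, hδ0.comp hθ.tendsto_atTop, ?_⟩
    simp only [sub_zero]
    exact hlim
  rw [hη, hv.mem_halfLine_iff] at hwm
  have e0 := ((continuous_frame h 0).tendsto w).comp hlim
  have e1 := ((continuous_frame h 1).tendsto w).comp hlim
  have hle : κ * frame h w 0 ≤ |frame h w 1| := by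
    refine le_of_tendsto_of_tendsto' (e0.const_mul κ) e1.abs fun k => ?_
    simp only [Function.comp, map_smul, PiLp.smul_apply, smul_eq_mul, H.fst _ (hmem _),
      H.snd _ (hmem _), abs_mul, abs_of_pos (hpos _)]
    rw [mul_left_comm]
    refine mul_le_mul_of_nonneg_left ?_ (hpos _).le
    by_contra! hlt
    exact (ht' (θ k)).2.2 ⟨(le_abs_self _).trans hlt.le, (neg_le_abs _).trans hlt.le⟩
  rw [hwm.2, abs_zero] at hle
  have hw0 : frame h w 0 = 0 := le_antisymm (by nlinarith) hwm.1
  have : w = 0 := by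
    rw [← framePoint_frame h w, hw0, hwm.2]; ext i; fin_cases i <;> simp [framePoint]
  rw [this] at hw
  simp at hw

/-- A semialgebraic curve tangent to the first axis of a frame is, near the origin, a graph in the
coordinates of the frame. -/
theorem IsSemialgebraicCurve.exists_graphCurve {v : EuclideanSpace ℝ (Fin 2)} (hv : IsAxis h v)
    (hδ : IsSemialgebraicCurve δ ε) (hl : HasTangent δ (halfLine v)) :
    ∃ φ ψ f η, SAFun φ ∧ SAFun ψ ∧ SAFun f ∧ η < ε ∧ GraphCurve φ ψ f η ∧ HasCoords h δ ε φ ψ ∧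
      Tendsto (fun x => f x / x) (𝓝[>] 0) (𝓝 0) := by
  obtain ⟨φ, ψ, hφ, hψ, H⟩ := hδ.exists_coords h
  have hv0 : v ≠ 0 := by rintro rfl; simpa using hv.pos
  have hzero : ∀ t ∈ Ico 0 ε, (δ t = 0 ↔ φ t = 0 ∧ ψ t = 0) := by
    intro t ht
    constructor
    · intro h0; rw [← H.fst t ht, ← H.snd t ht, h0]; simp
    · rintro ⟨h0, h1⟩
      rw [H.eq_framePoint ht, h0, h1]; ext i; fin_cases i <;> simp [framePoint]
  have hmem := eventually_mem_Ico hδ.pos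
  have hd : Def1 fun t => ¬ (φ t = 0 ∧ ψ t = 0) :=
    ((DefPred.eq (hφ.comp (DefFun.coord _)) (DefFun.const 0)).and
      (DefPred.eq (hψ.comp (DefFun.coord _)) (DefFun.const 0))).not
  have hne' : ∀ᶠ t in 𝓝[>] (0 : ℝ), ¬ (φ t = 0 ∧ ψ t = 0) := by
    refine hd.eventually_of_frequently (((hl.eventually_ne_zero hv0 hδ.map_zero).and_eventually
      hmem).mono fun t ht => ?_)
    rw [← hzero t ht.2]; exact ht.1
  have hne : ∀ᶠ t in 𝓝[>] (0 : ℝ), δ t ≠ 0 := by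
    filter_upwards [hne', hmem] with t ht htm
    rwa [ne_eq, hzero t htm]
  have hcone := fun κ (hκ : 0 < κ) => hl.eventually_abs_le hv hδ hφ hψ H hne (κ := κ) hκ
  have hpos : ∀ᶠ t in 𝓝[>] (0 : ℝ), 0 < φ t := by
    filter_upwards [hcone 1 one_pos, hne'] with t ht hn
    rw [one_mul] at ht
    refine lt_of_le_of_ne ((abs_nonneg _).trans ht) fun h0 => hn ⟨h0.symm, ?_⟩
    rw [← h0] at ht
    exact abs_eq_zero.1 (le_antisymm ht (abs_nonneg _))
  obtain ⟨h00, h00'⟩ := (hzero 0 ⟨le_rfl, hδ.pos⟩).1 hδ.map_zero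
  obtain ⟨f, η, hf, hηε, hG⟩ := GraphCurve.exists_of_saFun hφ hψ h00 h00' hδ.pos
    (hδ.continuousOn_coord h 0 H.fst) hpos
  refine ⟨φ, ψ, f, η, hφ, hψ, hf, hηε, hG, H, hG.tendsto_div ?_⟩
  rw [Metric.tendsto_nhds]
  intro κ hκ
  filter_upwards [hcone (κ / 2) (half_pos hκ), hpos] with t ht htp
  rw [Real.dist_eq, sub_zero, abs_div, abs_of_pos htp, div_lt_iff₀ htp]
  nlinarith

variable {φ ψ f : ℝ → ℝ} {η : ℝ}

theorem GraphCurve.isGraphGerm (hG : GraphCurve φ ψ f η) (H : HasCoords h δ ε φ ψ) (hε : 0 < ε) :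
    IsGraphGerm (frame h) δ f := by
  filter_upwards [Ioo_mem_nhdsGT (lt_min hG.pos hε)] with ζ hζ
  rw [mem_Ioo, lt_min_iff] at hζ
  have hG' := hG.mono hζ.1 hζ.2.1.le
  have h0 : ∀ᶠ p in 𝓝 (0 : EuclideanSpace ℝ (Fin 2)), frame h p 0 < φ ζ := by
    have := (continuous_frame h 0).tendsto 0
    rw [map_zero] at this
    exact this.eventually (gt_mem_nhds (hG.phi_pos hζ.1 hζ.2.1.le))
  filter_upwards [h0] with p hp
  constructor
  · rintro ⟨t, ht, rfl⟩
    have hm : t ∈ Ico 0 ε := ⟨ht.1, ht.2.trans hζ.2.2⟩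
    rw [H.fst t hm, H.snd t hm, hG'.eq t ⟨ht.1, ht.2.le⟩]
    refine ⟨?_, rfl⟩
    rcases ht.1.eq_or_lt with h | h
    · rw [← h, hG.zero]
    · exact (hG'.phi_pos h ht.2.le).le
  · rintro ⟨h1, h2⟩
    obtain ⟨t, ht, htp⟩ := intermediate_value_Ico hζ.1.le hG'.continuousOn
      (show frame h p 0 ∈ Ico (φ 0) (φ ζ) from ⟨by rwa [hG.zero], hp⟩)
    refine ⟨t, ht, ?_⟩
    rw [H.eq_framePoint ⟨ht.1, ht.2.trans hζ.2.2⟩, ← hG'.eq t ⟨ht.1, ht.2.le⟩, htp, ← h2,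
      framePoint_frame]

theorem GraphCurve.hasTangent {v : EuclideanSpace ℝ (Fin 2)} (hv : IsAxis h v)
    (hG : GraphCurve φ ψ f η) (H : HasCoords h δ ε φ ψ) (hε : 0 < ε)
    (hc : ContinuousOn δ (Ico 0 ε)) (ht : Tendsto (fun x => f x / x) (𝓝[>] 0) (𝓝 0)) :
    HasTangent δ (halfLine v) := by
  filter_upwards [Ioo_mem_nhdsGT (lt_min hG.pos hε)] with ζ hζ
  rw [mem_Ioo, lt_min_iff] at hζ
  have hG' := hG.mono hζ.1 hζ.2.1.le
  have hm : ∀ t ∈ Ico 0 ζ, t ∈ Ico 0 ε := fun t ht => ⟨ht.1, ht.2.trans hζ.2.2⟩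
  have hnn : ∀ t ∈ Ico 0 ζ, 0 ≤ φ t := by
    intro t ht
    rcases ht.1.eq_or_lt with h | h
    · rw [← h, hG.zero]
    · exact (hG'.phi_pos h ht.2.le).le
  have hρ : Tendsto (fun x => f x / x) (𝓝[≥] 0) (𝓝 0) := by
    have : ContinuousWithinAt (fun x => f x / x) (Ici 0) 0 :=
      continuousWithinAt_Ioi_iff_Ici.1 (by simpa [ContinuousWithinAt] using ht)
    simpa [ContinuousWithinAt] using this
  ext w
  rw [hv.mem_halfLine_iff]
  constructor
  · rintro ⟨x, a, hx, ha, hx0, hlim⟩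
    choose t ht htx using hx
    have hX : ∀ k, frame h (x k) 0 = φ (t k) := fun k => by rw [← htx, H.fst _ (hm _ (ht k))]
    have hY : ∀ k, frame h (x k) 1 = f (φ (t k)) / φ (t k) * φ (t k) := fun k => by
      rw [← htx, H.snd _ (hm _ (ht k)), hG'.eq _ ⟨(ht k).1, (ht k).2.le⟩]
      by_cases h0 : φ (t k) = 0
      · have : t k = 0 := hG'.strictMonoOn.injOn ⟨(ht k).1, (ht k).2.le⟩ ⟨le_rfl, hζ.1.le⟩
          (by rw [h0, hG.zero])
        rw [h0, this, hG.zero']; simp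
      · rw [div_mul_cancel₀ _ h0]
    have e0 : Tendsto (fun k => a k * φ (t k)) atTop (𝓝 (frame h w 0)) := by
      have := ((continuous_frame h 0).tendsto w).comp hlim
      refine this.congr fun k => ?_
      simp [hX]
    have e1 : Tendsto (fun k => a k * (f (φ (t k)) / φ (t k) * φ (t k))) atTop
        (𝓝 (frame h w 1)) := by
      have := ((continuous_frame h 1).tendsto w).comp hlim
      refine this.congr fun k => ?_
      simp [hY]
    have hφ0 : Tendsto (fun k => φ (t k)) atTop (𝓝[≥] 0) := by
      refine tendsto_nhdsWithin_iff.2 ⟨?_, Eventually.of_forall fun k => hnn _ (ht k)⟩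
      have := ((continuous_frame h 0).tendsto 0).comp hx0
      rw [map_zero] at this
      exact this.congr fun k => hX k
    refine ⟨ge_of_tendsto' e0 fun k => mul_nonneg (ha k).le (hnn _ (ht k)), ?_⟩
    have := (hρ.comp hφ0).mul e0
    rw [zero_mul] at this
    refine tendsto_nhds_unique e1 (this.congr fun k => ?_)
    simp only [Function.comp]; ring
  · rintro ⟨hw0, hw1⟩
    let t : ℕ → ℝ := fun k => ζ / ((k : ℝ) + 2)
    have ht0 : ∀ k, 0 < t k := fun k => div_pos hζ.1 (by positivity)
    have ht1 : ∀ k, t k < ζ := fun k => by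
      rw [div_lt_iff₀ (by positivity)]
      nlinarith [(Nat.cast_nonneg k : (0 : ℝ) ≤ k), hζ.1]
    have htlim : Tendsto t atTop (𝓝 0) := by
      have : Tendsto (fun n : ℕ => (n : ℝ) + 2) atTop atTop :=
        tendsto_atTop_add_const_right _ _ tendsto_natCast_atTop_atTop
      exact this.const_div_atTop ζ
    have htm : ∀ k, t k ∈ Ico 0 ζ := fun k => ⟨(ht0 k).le, ht1 k⟩
    have htlim' : Tendsto t atTop (𝓝[>] 0) :=
      tendsto_nhdsWithin_iff.2 ⟨htlim, Eventually.of_forall ht0⟩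
    have hφp : ∀ k, 0 < φ (t k) := fun k => hG'.phi_pos (ht0 k) (ht1 k).le
    -- The added `1 / (k + 1)` keeps the scaling factors strictly positive even when `w = 0`.
    have hu : Tendsto (fun k : ℕ => frame h w 0 + 1 / ((k : ℝ) + 1)) atTop (𝓝 (frame h w 0)) := by
      simpa using (tendsto_one_div_add_atTop_nhds_zero_nat (𝕜 := ℝ)).const_add (frame h w 0)
    have hup : ∀ k : ℕ, 0 < frame h w 0 + 1 / ((k : ℝ) + 1) := fun k => by positivity
    have hδ0 : δ 0 = 0 := by
      rw [H.eq_framePoint ⟨le_rfl, hε⟩, hG.zero, hG.zero']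
      ext i; fin_cases i <;> simp [framePoint]
    refine ⟨fun k => δ (t k), fun k => (frame h w 0 + 1 / ((k : ℝ) + 1)) / φ (t k),
      fun k => ⟨_, htm k, rfl⟩, fun k => div_pos (hup k) (hφp k), ?_, ?_⟩
    · have h2 : Tendsto δ (𝓝[Ico 0 ε] 0) (𝓝 (δ 0)) := hc 0 ⟨le_rfl, hε⟩
      rw [hδ0] at h2
      exact h2.comp (tendsto_nhdsWithin_iff.2 ⟨htlim, Eventually.of_forall fun k => hm _ (htm k)⟩)
    · have e : ∀ k : ℕ, ((frame h w 0 + 1 / ((k : ℝ) + 1)) / φ (t k)) • (δ (t k) - 0) =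
          framePoint c s (frame h w 0 + 1 / ((k : ℝ) + 1))
            ((frame h w 0 + 1 / ((k : ℝ) + 1)) * (f (φ (t k)) / φ (t k))) := by
        intro k
        rw [sub_zero, H.eq_framePoint (hm _ (htm k)), framePoint_smul,
          hG'.eq _ ⟨(ht0 k).le, (ht1 k).le⟩, div_mul_cancel₀ _ (hφp k).ne']
        congr 1; ring
      simp only [e]
      have h3 := hu.mul (ht.comp (hG.tendsto_phi.comp htlim'))
      rw [mul_zero] at h3
      have h4 := ((continuous_framePoint c s).tendsto (frame h w 0, 0)).comp (hu.prodMk_nhds h3)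
      have h5 : framePoint c s (frame h w 0) 0 = w := by
        rw [← hw1, framePoint_frame]
      dsimp only at h4
      rw [h5] at h4
      exact h4

theorem isSemialgebraicCurve_framePoint {A B : ℝ → ℝ} (hA : SAFun A) (hB : SAFun B) {η : ℝ}
    (hη : 0 < η) (hAc : ContinuousOn A (Ico 0 η)) (hBc : ContinuousOn B (Ico 0 η))
    (hA0 : A 0 = 0) (hB0 : B 0 = 0) (c s : ℝ) :
    IsSemialgebraicCurve (fun t => framePoint c s (A t) (B t)) η := by
  refine ⟨hη, (continuous_framePoint c s).comp_continuousOn (hAc.prodMk hBc), ?_, ?_⟩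
  · have hd : DefPred fun z : Fin 3 → ℝ => (0 ≤ z 0 ∧ z 0 < η) ∧
        (z 1 = c * A (z 0) - s * B (z 0) ∧ z 2 = s * A (z 0) + c * B (z 0)) := by
      refine DefPred.and (DefPred.and (DefPred.le (DefFun.const _) (DefFun.coord _))
        (DefPred.lt (DefFun.coord _) (DefFun.const _)))
        (DefPred.and (DefPred.eq (DefFun.coord _) ?_) (DefPred.eq (DefFun.coord _) ?_))
      · exact ((DefFun.const c).mul (hA.comp (DefFun.coord _))).sub
          ((DefFun.const s).mul (hB.comp (DefFun.coord _)))
      · exact ((DefFun.const s).mul (hA.comp (DefFun.coord _))).add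
          ((DefFun.const c).mul (hB.comp (DefFun.coord _)))
    convert Semialg.isSemialgebraic hd using 1
    ext z
    simp [Fin.forall_fin_two, framePoint]
  · ext i; fin_cases i <;> simp [framePoint, hA0, hB0]

end Curve

/-! ### Assembling the branch. -/

theorem sameGerm_of_eventually_eq {e : EuclideanSpace ℝ (Fin 2) ≃ₗ[ℝ] EuclideanSpace ℝ (Fin 2)}
    {δ₁ δ₂ : ℝ → EuclideanSpace ℝ (Fin 2)} {f₁ f₂ : ℝ → ℝ} (h₁ : IsGraphGerm e δ₁ f₁)
    (h₂ : IsGraphGerm e δ₂ f₂) (h0 : f₁ 0 = f₂ 0)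
    (h : ∀ᶠ x in 𝓝[>] (0 : ℝ), f₁ x = f₂ x) : SameGerm δ₁ δ₂ := by
  obtain ⟨r, hr, h⟩ := eventually_nhdsGT_iff.1 h
  filter_upwards [h₁, h₂] with η h₁ h₂
  have hc : Continuous fun p => e p 0 :=
    (EuclideanSpace.proj (0 : Fin 2)).continuous.comp
      (LinearMap.continuous_of_finiteDimensional e.toLinearMap)
  have hlt : ∀ᶠ p in 𝓝 (0 : EuclideanSpace ℝ (Fin 2)), e p 0 < r := by
    have := hc.tendsto 0
    simp only [map_zero, PiLp.zero_apply] at this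
    exact this.eventually (gt_mem_nhds hr)
  filter_upwards [h₁, h₂, hlt] with p h₁ h₂ hp
  rw [h₁, h₂]
  refine and_congr_right fun hp0 => ?_
  rcases hp0.eq_or_lt with h' | h'
  · rw [← h', h0]
  · rw [h _ h' hp]

/-- The branch between two curves, the first of which is below the second. -/
theorem exists_branch_of_lt {c s : ℝ} (h : c ^ 2 + s ^ 2 = 1) {X : Set (EuclideanSpace ℝ (Fin 2))}
    (hXc : IsClosed X) (hX : IsSemialgebraic X) {ε : ℝ} (hε : 0 < ε)
    {δ₁ δ₂ : ℝ → EuclideanSpace ℝ (Fin 2)} {v : EuclideanSpace ℝ (Fin 2)} (hv : IsAxis h v)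
    {φ₁ ψ₁ f₁ φ₂ ψ₂ f₂ : ℝ → ℝ} {η₁ η₂ : ℝ} (hη₁ : η₁ < ε) (hη₂ : η₂ < ε)
    (hφ₁ : SAFun φ₁) (hψ₁ : SAFun ψ₁) (hf₁ : SAFun f₁)
    (hφ₂ : SAFun φ₂) (hψ₂ : SAFun ψ₂) (hf₂ : SAFun f₂)
    (hG₁ : GraphCurve φ₁ ψ₁ f₁ η₁) (hG₂ : GraphCurve φ₂ ψ₂ f₂ η₂)
    (H₁ : HasCoords h δ₁ ε φ₁ ψ₁) (H₂ : HasCoords h δ₂ ε φ₂ ψ₂)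
    (ht₁ : Tendsto (fun x => f₁ x / x) (𝓝[>] 0) (𝓝 0))
    (ht₂ : Tendsto (fun x => f₂ x / x) (𝓝[>] 0) (𝓝 0))
    (hM₁ : ∀ t ∈ Ico 0 ε, δ₁ t ∈ closure (medialAxis X))
    (hM₂ : ∀ t ∈ Ico 0 ε, δ₂ t ∈ closure (medialAxis X))
    (hlt : ∀ᶠ x in 𝓝[>] (0 : ℝ), f₁ x < f₂ x) :
    ∃ (η : ℝ) (γ : ℝ → EuclideanSpace ℝ (Fin 2)) (g : ℝ → ℝ), η ≤ ε ∧ IsBranch X γ η ∧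
      IsGraphGerm (frame h) γ g ∧ (∀ᶠ x in 𝓝[>] (0 : ℝ), f₁ x < g x ∧ g x < f₂ x) ∧
      ((∀ t ∈ Ico 0 η, γ t ∈ closestPoints X (δ₁ t)) ∨
        (∀ t ∈ Ico 0 η, γ t ∈ closestPoints X (δ₂ t))) ∧
      HasTangent γ (halfLine v) := by
  have hD := def2_frameSet c s hX
  have hcl : ∀ {δ : ℝ → EuclideanSpace ℝ (Fin 2)} {φ ψ f : ℝ → ℝ} {η : ℝ}, GraphCurve φ ψ f η →
      HasCoords h δ ε φ ψ → (∀ t ∈ Ico 0 ε, δ t ∈ closure (medialAxis X)) →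
      ∀ᶠ x in 𝓝[>] (0 : ℝ), (x, f x) ∈ closure {p : ℝ × ℝ | Med (frameSet c s X) p.1 p.2} := by
    intro δ φ ψ f η hG H hM
    rw [← hG.eventually_iff (P := fun x => (x, f x) ∈
      closure {p : ℝ × ℝ | Med (frameSet c s X) p.1 p.2})]
    filter_upwards [hG.eventually_eq, eventually_mem_Ico hε] with t he ht
    rw [he, ← H.fst t ht, ← H.snd t ht]
    exact mem_closure_med h (hM t ht)
  obtain ⟨x₀, W⟩ := Wedge.exists_of_eventually hD (isClosed_frameSet c s hXc) hf₁ hf₂ hlt ht₁ ht₂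
    (hcl hG₁ H₁ hM₁) (hcl hG₂ H₂ hM₂)
  have h0 := W.apex_mem
  have key : ∀ {δ : ℝ → EuclideanSpace ℝ (Fin 2)} {φ ψ f : ℝ → ℝ} {ε' : ℝ}, SAFun φ → SAFun ψ →
      GraphCurve φ ψ f ε' → ε' < ε → HasCoords h δ ε φ ψ → (∀ᶠ x in 𝓝[>] (0 : ℝ), |f x| ≤ x) →
      (∀ᶠ x in 𝓝[>] (0 : ℝ), ∃ a b, Wedge.NearIn (frameSet c s X) f₁ f₂ x₀ x (f x) a b) →
      ∃ (η : ℝ) (γ : ℝ → EuclideanSpace ℝ (Fin 2)) (g : ℝ → ℝ), η ≤ ε ∧ IsBranch X γ η ∧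
      IsGraphGerm (frame h) γ g ∧ (∀ᶠ x in 𝓝[>] (0 : ℝ), f₁ x < g x ∧ g x < f₂ x) ∧
      (∀ t ∈ Ico 0 η, γ t ∈ closestPoints X (δ t)) ∧ HasTangent γ (halfLine v) := by
    intro δ φ ψ f ε' hφ hψ hG hε' H hle hne
    obtain ⟨A, B, g, η, hη, hA, hB, hg, hBc, hN⟩ := W.exists_branch hD hf₁ hf₂ hφ hψ hG hle hne
    have hcurve : IsSemialgebraicCurve (fun t => framePoint c s (A t) (B t)) η :=
      isSemialgebraicCurve_framePoint hA hB hg.pos (hg.continuousOn.mono Ico_subset_Icc_self)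
        (hBc.mono Ico_subset_Icc_self) hg.zero hg.zero' c s
    have HA : HasCoords h (fun t => framePoint c s (A t) (B t)) η A B :=
      ⟨fun t _ => frame_framePoint_zero h _ _, fun t _ => frame_framePoint_one h _ _⟩
    have hbt : ∀ᶠ x in 𝓝[>] (0 : ℝ), f₁ x < g x ∧ g x < f₂ x := by
      rw [← hg.eventually_iff (P := fun x => f₁ x < g x ∧ g x < f₂ x)]
      filter_upwards [hg.eventually_eq, Ioo_mem_nhdsGT hg.pos] with t he ht
      rw [he]
      exact (hN t ht.1 ht.2.le).2.2.2
    have hgt : Tendsto (fun x => g x / x) (𝓝[>] 0) (𝓝 0) := by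
      refine tendsto_of_tendsto_of_tendsto_of_le_of_le' ht₁ ht₂ ?_ ?_
      all_goals
        filter_upwards [hbt, self_mem_nhdsWithin] with x hx hx0
      · exact (div_le_div_iff_of_pos_right hx0).2 hx.1.le
      · exact (div_le_div_iff_of_pos_right hx0).2 hx.2.le
    -- The selection covers `t > 0`; at `t = 0` all curves are at the apex, which is its own closest
    -- point because it belongs to `X`.
    have hzero : ∀ t ∈ Ico 0 η, Near (frameSet c s X) (φ t) (ψ t) (A t) (B t) := by
      intro t ht
      rcases ht.1.eq_or_lt with h' | h'
      · rw [← h', hG.zero, hG.zero', hg.zero, hg.zero']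
        exact ⟨h0, fun a b _ => by simp; positivity⟩
      · exact (hN t h' ht.2.le).1
    refine ⟨η, fun t => framePoint c s (A t) (B t), g, hη.trans hε'.le, ⟨hcurve, ?_, ?_⟩,
      hg.isGraphGerm HA hg.pos, hbt, ?_, hg.hasTangent hv HA hg.pos hcurve.continuousOn hgt⟩
    · intro t ht t' ht' heq
      have : A t = A t' := by
        rw [← HA.fst t ht, ← HA.fst t' ht']
        exact congrArg (fun p => frame h p 0) heq
      exact hg.strictMonoOn.injOn (Ico_subset_Icc_self ht) (Ico_subset_Icc_self ht') this
    · intro t ht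
      exact (hzero t ht).1
    · intro t ht
      have hm : t ∈ Ico 0 ε := ⟨ht.1, ht.2.trans_le (hη.trans hε'.le)⟩
      rw [← near_frameSet_iff h, HA.fst t ht, HA.snd t ht, H.fst t hm, H.snd t hm]
      exact hzero t ht
  have hle₁ : ∀ᶠ x in 𝓝[>] (0 : ℝ), |f₁ x| ≤ x := by
    filter_upwards [Ioo_mem_nhdsGT W.pos] with x hx using W.le₁ x hx.1 hx.2
  have hle₂ : ∀ᶠ x in 𝓝[>] (0 : ℝ), |f₂ x| ≤ x := by
    filter_upwards [Ioo_mem_nhdsGT W.pos] with x hx using W.le₂ x hx.1 hx.2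
  rcases W.eventually_exists_nearIn hD hf₁ hf₂ with hne | hne
  · obtain ⟨η, γ, g, a1, a2, a3, a4, a5, a6⟩ := key hφ₁ hψ₁ hG₁ hη₁ H₁ hle₁ hne
    exact ⟨η, γ, g, a1, a2, a3, a4, Or.inl a5, a6⟩
  · obtain ⟨η, γ, g, a1, a2, a3, a4, a5, a6⟩ := key hφ₂ hψ₂ hG₂ hη₂ H₂ hle₂ hne
    exact ⟨η, γ, g, a1, a2, a3, a4, Or.inr a5, a6⟩

theorem mainTheorem5 (X : Set (EuclideanSpace ℝ (Fin 2))) (hXclosed : IsClosed X)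
    (hX : IsSemialgebraic X) (hdim : HasSemialgebraicDim X 1)
    (ε : ℝ) (δ₁ δ₂ : ℝ → EuclideanSpace ℝ (Fin 2))
    (hδ₁ : IsSemialgebraicCurve δ₁ ε) (hδ₂ : IsSemialgebraicCurve δ₂ ε)
    (hne : ¬ SameGerm δ₁ δ₂)
    (v : EuclideanSpace ℝ (Fin 2)) (hv : v ≠ 0)
    (hl₁ : HasTangent δ₁ (halfLine v)) (hl₂ : HasTangent δ₂ (halfLine v))
    (hM₁ : ∀ t ∈ Ico 0 ε, δ₁ t ∈ closure (medialAxis X))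
    (hM₂ : ∀ t ∈ Ico 0 ε, δ₂ t ∈ closure (medialAxis X)) :
    ∃ (η : ℝ) (γ : ℝ → EuclideanSpace ℝ (Fin 2)), η ≤ ε ∧
      IsBranch X γ η ∧
      LiesBetween (halfLine v) δ₁ δ₂ γ ∧
      ((∀ t ∈ Ico 0 η, γ t ∈ closestPoints X (δ₁ t)) ∨
        (∀ t ∈ Ico 0 η, γ t ∈ closestPoints X (δ₂ t))) ∧
      HasTangent γ (halfLine v) := by

  obtain ⟨c, s, h, hvA⟩ := exists_frame hv
  obtain ⟨φ₁, ψ₁, f₁, η₁, hφ₁, hψ₁, hf₁, hη₁, hG₁, H₁, ht₁⟩ := hδ₁.exists_graphCurve hvA hl₁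
  obtain ⟨φ₂, ψ₂, f₂, η₂, hφ₂, hψ₂, hf₂, hη₂, hG₂, H₂, ht₂⟩ := hδ₂.exists_graphCurve hvA hl₂
  have hε := hδ₁.pos
  have g₁ := hG₁.isGraphGerm H₁ hε
  have g₂ := hG₂.isGraphGerm H₂ hε
  have hzero : f₁ 0 = f₂ 0 := by
    have e₁ := hG₁.eq 0 ⟨le_rfl, hG₁.pos.le⟩
    have e₂ := hG₂.eq 0 ⟨le_rfl, hG₂.pos.le⟩
    rw [hG₁.zero, hG₁.zero'] at e₁
    rw [hG₂.zero, hG₂.zero'] at e₂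
    rw [e₁, e₂]
  have hdeq : Def1 fun x => f₁ x = f₂ x :=
    DefPred.eq (hf₁.comp (DefFun.coord _)) (hf₂.comp (DefFun.coord _))
  have hdlt : Def1 fun x => f₁ x < f₂ x :=
    DefPred.lt (hf₁.comp (DefFun.coord _)) (hf₂.comp (DefFun.coord _))
  -- Distinct germs forbid equality for all small `x`, and the dichotomy upgrades this to inequality
  -- for all small `x`.
  have hneq : ∀ᶠ x in 𝓝[>] (0 : ℝ), f₁ x ≠ f₂ x :=
    hdeq.eventually_or.resolve_left fun heq => hne (sameGerm_of_eventually_eq g₁ g₂ hzero heq)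
  rcases hdlt.eventually_or with hlt | hlt
  · obtain ⟨η, γ, g, a1, a2, a3, a4, a5, a6⟩ := exists_branch_of_lt h hXclosed hX hε hvA hη₁ hη₂
      hφ₁ hψ₁ hf₁ hφ₂ hψ₂ hf₂ hG₁ hG₂ H₁ H₂ ht₁ ht₂ hM₁ hM₂ hlt
    exact ⟨η, γ, a1, a2, ⟨frame h, f₁, f₂, g, hvA.mem_halfLine_iff, g₁, g₂, a3, Or.inl a4⟩, a5, a6⟩
  · have hlt' : ∀ᶠ x in 𝓝[>] (0 : ℝ), f₂ x < f₁ x := by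
      filter_upwards [hlt, hneq] with x h1 h2
      exact lt_of_le_of_ne (not_lt.1 h1) h2.symm
    obtain ⟨η, γ, g, a1, a2, a3, a4, a5, a6⟩ := exists_branch_of_lt h hXclosed hX hε hvA hη₂ hη₁
      hφ₂ hψ₂ hf₂ hφ₁ hψ₁ hf₁ hG₂ hG₁ H₂ H₁ ht₂ ht₁ hM₂ hM₁ hlt'
    exact ⟨η, γ, a1, a2, ⟨frame h, f₁, f₂, g, hvA.mem_halfLine_iff, g₁, g₂, a3, Or.inr a4⟩,
      a5.symm, a6⟩
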